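/- For an integer $k$ and an integer $m\ge 0$, let $\widetilde J_{k,m}$ be the space of weak Jacobi forms of weight $k$ and index $m$ on $\mathrm{SL}(2,\mathbb Z)$, i.e. holomorphic functions $\Phi:\mathcal H\times\mathbb C\to\mathbb C$ such that $$(c\tau+d)^{-k}e^{-2\pi i m\frac{cz^2}{c\tau+d}}\,\Phi\Big(\frac{a\tau+b}{c\tau+d},\frac z{c\tau+d}\Big)=\Phi(\tau,z)=e^{2\pi i m(\lambda^2\tau+2\lambda z)}\,\Phi(\tau,z+\lambda\tau+\mu)$$ for all $\begin{pmatrix}a&b\\c&d\end{pmatrix}\in\mathrm{SL}(2,\mathbb Z)$ and $(\lambda,\mu)\in\mathbb Z^2$, with a Fourier expansion $\Phi(\tau,z)=\sum_{n\ge 0}\sum_{r^2\le 4nm+m^2}c(n,r)e^{2\pi i(n\tau+rz)}$. Let $\widetilde J_{\mathrm{ev},*}=\bigoplus_{k\in2\mathbb Z,\,m\ge0}\widetilde J_{k,m}$, a bigraded commutative $\mathbb C$-algebra, and let $M_*=\bigoplus_k M_k$ be the algebra of modular forms on $\mathrm{SL}(2,\mathbb Z)$, regarded as a subalgebra of $\widetilde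 J_{\mathrm{ev},*}$ (forms independent of $z$, of index $0$). Let $E_4,E_6$ be the normalized Eisenstein series, $\Delta=(E_4^3-E_6^2)/1728$, and, for $k=4,6$, let $$E_{k,1}(\tau,z)=\frac12\sum_{(c,d)=1}\sum_{\lambda\in\mathbb Z}(c\tau+d)^{-k}\exp\Big(2\pi i\Big(\lambda^2\frac{a\tau+b}{c\tau+d}+\frac{2\lambda z}{c\tau+d}-\frac{cz^2}{c\tau+d}\Big)\Big)$$ (where, for each $(c,d)$, integers $a,b$ with $ad-bc=1$ are chosen). Put $$A=\frac{E_6E_{4,1}-E_4E_{6,1}}{144\,\Delta},\qquad B=\frac{E_4^2E_{4,1}-E_6E_{6,1}}{144\,\Delta}.$$ The Serre derivation of $M_*$ is $\mathrm{Se}(f)=\frac1{2\pi i}\frac{df}{d\tau}-\frac k{12}E_2f$ for $f\in M_k$. **Theorem A.** One has $A\in\widetilde J_{-2,1}$ and $B\in\widetilde J_{0,1}$, and for all $(a,b)\in\mathbb C^2$ there is a unique $\mathbb C$-derivation $S_{a,b}$ of $\widetilde J_{\mathrm{ev},*}$ that extends $\mathrm{Se}$ and satisfies $S_{a,b}(A)=aB$,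 $S_{a,b}(B)=bE_4A$. For $c\in\mathbb C$ and $n\ge0$ let $\{\cdot,\cdot\}^{[a,b,c]}_n$ be the bilinear map on $\widetilde J_{\mathrm{ev},*}$ given, for $f\in\widetilde J_{k,p}$ and $g\in\widetilde J_{\ell,q}$ ($k,\ell$ even), by $$\{f,g\}^{[a,b,c]}_n=\sum_{r=0}^n(-1)^r\binom{k+cp+n-1}{n-r}\binom{\ell+cq+n-1}{r}S_{a,b}^r(f)\,S_{a,b}^{n-r}(g).$$ Then, for all $(a,b,c)\in\mathbb C^3$: 1. $(\{\cdot,\cdot\}^{[a,b,c]}_n)_{n\ge0}$ is a formal deformation of $\widetilde J_{\mathrm{ev},*}$: $\{f,g\}^{[a,b,c]}_0=fg$, and the product on $\widetilde J_{\mathrm{ev},*}[[\hbar]]$ extending $f\star g=\sum_n\{f,g\}^{[a,b,c]}_n\hbar^n$ is associative. 2. $\{\widetilde J_{k,p},\widetilde J_{\ell,q}\}^{[a,b,c]}_n\subset\widetilde J_{k+\ell+2n,p+q}$ for all $k,\ell\in2\mathbb Z$ and $p,q,n\in\mathbb Z_{\ge0}$. 3. $M_*$ is stable under all $\{\cdot,\cdot\}^{[a,b,c]}_n$,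 and on $M_*$ they are the Serre–Rankin–Cohen brackets: for $f\in M_k$, $g\in M_\ell$, $$\{f,g\}^{[a,b,c]}_n=\sum_{r=0}^n(-1)^r\binom{k+n-1}{n-r}\binom{\ell+n-1}{r}\mathrm{Se}^r(f)\,\mathrm{Se}^{n-r}(g)\in M_{k+\ell+2n}.$$ 4. Call two such deformations modular-isomorphic if there is a $\mathbb C$-linear bijection $\phi$ of $\widetilde J_{\mathrm{ev},*}$ that preserves the weight and the index of homogeneous forms and satisfies $\phi(\{f,g\}^{[a,b,c]}_n)=\{\phi(f),\phi(g)\}^{[a',b',c']}_n$ for all $n,f,g$. The deformation with parameters $[a,b,c]$ is modular-isomorphic to one with parameters $[1,b',c']$ ($b',c'\in\mathbb C$), $[0,1,c']$ ($c'\in\mathbb C$) or $[0,0,c']$ ($c'\in\mathbb C$); and two deformations with parameters in this list are modular-isomorphic only if their parameters are equal. -/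

import Mathlib

open scoped MatrixGroups DirectSum ModularForm
open UpperHalfPlane hiding I
open Complex

noncomputable section

namespace WeakJacobi

/-! ### Weak Jacobi forms on `SL(2, ℤ)` -/

/-- The weight `k`, index `m` action of `SL(2, ℤ)` on functions on `ℍ × ℂ`. -/
def modularSlash (k : ℤ) (m : ℕ) (γ : SL(2, ℤ)) (Φ : ℍ × ℂ → ℂ) : ℍ × ℂ → ℂ := fun p =>
  ((γ 1 0 : ℂ) * p.1 + (γ 1 1 : ℂ)) ^ (-k) *
    exp (-(2 * Real.pi * I * m * ((γ 1 0 : ℂ) * p.2 ^ 2) / ((γ 1 0 : ℂ) * p.1 + (γ 1 1 : ℂ)))) *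
    Φ (γ • p.1, p.2 / ((γ 1 0 : ℂ) * p.1 + (γ 1 1 : ℂ)))

/-- The index `m` action of `(l, u) ∈ ℤ²` on functions on `ℍ × ℂ`. -/
def latticeSlash (m : ℕ) (l u : ℤ) (Φ : ℍ × ℂ → ℂ) : ℍ × ℂ → ℂ := fun p =>
  exp (2 * Real.pi * I * m * ((l : ℂ) ^ 2 * p.1 + 2 * l * p.2)) * Φ (p.1, p.2 + l * p.1 + u)

/-- The exponential `e^{2πi(nτ + rz)}`. -/
def fourierMode (x : ℕ × ℤ) (p : ℍ × ℂ) : ℂ :=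
  exp (2 * Real.pi * I * ((x.1 : ℂ) * p.1 + (x.2 : ℂ) * p.2))

/-- `Φ` is a weak Jacobi form of weight `k` and index `m`. -/
structure IsWeakJacobiForm (k : ℤ) (m : ℕ) (Φ : ℍ × ℂ → ℂ) : Prop where
  holo : DifferentiableOn ℂ (fun w : ℂ × ℂ => Φ (ofComplex w.1, w.2)) {w | 0 < w.1.im}
  modular : ∀ γ : SL(2, ℤ), modularSlash k m γ Φ = Φ
  lattice : ∀ l u : ℤ, latticeSlash m l u Φ = Φ
  fourier : ∃ c : ℕ × ℤ → ℂ,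
    (∀ (n : ℕ) (r : ℤ), 4 * (n : ℤ) * m + (m : ℤ) ^ 2 < r ^ 2 → c (n, r) = 0) ∧
    ∀ p, HasSum (fun x => c x * fourierMode x p) (Φ p)

theorem IsWeakJacobiForm.zero (k : ℤ) (m : ℕ) : IsWeakJacobiForm k m 0 where
  holo := by simp
  modular γ := by ext; simp [modularSlash]
  lattice l u := by ext; simp [latticeSlash]
  fourier := ⟨0, by simp, by simp⟩

theorem IsWeakJacobiForm.add {k : ℤ} {m : ℕ} {Φ Ψ : ℍ × ℂ → ℂ}
    (h : IsWeakJacobiForm k m Φ) (h' : IsWeakJacobiForm k m Ψ) :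
    IsWeakJacobiForm k m (Φ + Ψ) where
  holo := h.holo.add h'.holo
  modular γ := by
    ext p
    conv_rhs => rw [← h.modular γ, ← h'.modular γ]
    simp [modularSlash, mul_add]
  lattice l u := by
    ext p
    conv_rhs => rw [← h.lattice l u, ← h'.lattice l u]
    simp [latticeSlash, mul_add]
  fourier := by
    obtain ⟨c, hc, hs⟩ := h.fourier
    obtain ⟨c', hc', hs'⟩ := h'.fourier
    refine ⟨c + c', fun n r hr => by simp [hc n r hr, hc' n r hr], fun p => ?_⟩
    simpa [add_mul] using (hs p).add (hs' p)

theorem IsWeakJacobiForm.smul {k : ℤ} {m : ℕ} {Φ : ℍ × ℂ → ℂ} (a : ℂ)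
    (h : IsWeakJacobiForm k m Φ) : IsWeakJacobiForm k m (a • Φ) where
  holo := h.holo.const_smul a
  modular γ := by
    ext p
    conv_rhs => rw [← h.modular γ]
    simp [modularSlash, mul_left_comm]
  lattice l u := by
    ext p
    conv_rhs => rw [← h.lattice l u]
    simp [latticeSlash, mul_left_comm]
  fourier := by
    obtain ⟨c, hc, hs⟩ := h.fourier
    refine ⟨a • c, fun n r hr => by simp [hc n r hr], fun p => ?_⟩
    simpa [mul_assoc] using (hs p).mul_left a

theorem fourierMode_add (x y : ℕ × ℤ) (p : ℍ × ℂ) :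
    fourierMode (x + y) p = fourierMode x p * fourierMode y p := by
  simp only [fourierMode, ← Complex.exp_add]
  congr 1
  push_cast [Prod.fst_add, Prod.snd_add]
  ring

theorem sq_add_le {n₁ n₂ m₁ m₂ : ℕ} {r₁ r₂ : ℤ}
    (h₁ : r₁ ^ 2 ≤ 4 * (n₁ : ℤ) * m₁ + (m₁ : ℤ) ^ 2)
    (h₂ : r₂ ^ 2 ≤ 4 * (n₂ : ℤ) * m₂ + (m₂ : ℤ) ^ 2) :
    (r₁ + r₂) ^ 2 ≤ 4 * ((n₁ + n₂ : ℕ) : ℤ) * ((m₁ + m₂ : ℕ) : ℤ) + ((m₁ + m₂ : ℕ) : ℤ) ^ 2 := by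
  push_cast
  rcases Nat.eq_zero_or_pos m₁ with rfl | hm₁
  · have : r₁ = 0 := by
      have : r₁ ^ 2 ≤ 0 := by simpa using h₁
      exact pow_eq_zero_iff (two_ne_zero) |>.1 (le_antisymm this (sq_nonneg _))
    subst this
    have : (0 : ℤ) ≤ (n₁ : ℤ) * m₂ := by positivity
    push_cast
    nlinarith
  rcases Nat.eq_zero_or_pos m₂ with rfl | hm₂
  · have : r₂ = 0 := by
      have : r₂ ^ 2 ≤ 0 := by simpa using h₂
      exact pow_eq_zero_iff (two_ne_zero) |>.1 (le_antisymm this (sq_nonneg _))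
    subst this
    have : (0 : ℤ) ≤ (n₂ : ℤ) * m₁ := by positivity
    push_cast
    nlinarith
  have a₁ : (0 : ℤ) < m₁ := by exact_mod_cast hm₁
  have a₂ : (0 : ℤ) < m₂ := by exact_mod_cast hm₂
  generalize (m₁ : ℤ) = M₁ at *
  generalize (m₂ : ℤ) = M₂ at *
  generalize (n₁ : ℤ) = N₁ at *
  generalize (n₂ : ℤ) = N₂ at *
  have key : 0 ≤ M₁ * M₂ *
      (4 * (N₁ + N₂) * (M₁ + M₂) + (M₁ + M₂) ^ 2 - (r₁ + r₂) ^ 2) := by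
    have e₁ := mul_le_mul_of_nonneg_left h₁ (mul_nonneg a₂.le (add_pos a₁ a₂).le)
    have e₂ := mul_le_mul_of_nonneg_left h₂ (mul_nonneg a₁.le (add_pos a₁ a₂).le)
    nlinarith [sq_nonneg (M₂ * r₁ - M₁ * r₂)]
  have := nonneg_of_mul_nonneg_right key (mul_pos a₁ a₂)
  linarith

theorem hasSum_fiber {α β : Type*} (φ : α → β) {f : α → ℂ} {a : ℂ} (h : HasSum f a) :
    HasSum (fun y => ∑' x : {x // φ x = y}, f x.1) a := by
  have h2 : HasSum (f ∘ Equiv.sigmaFiberEquiv φ) a := (Equiv.sigmaFiberEquiv φ).hasSum_iff.2 h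
  exact h2.sigma (fun y => (h2.summable.sigma_factor y).hasSum)

theorem IsWeakJacobiForm.mul {k k' : ℤ} {m m' : ℕ} {Φ Ψ : ℍ × ℂ → ℂ}
    (h : IsWeakJacobiForm k m Φ) (h' : IsWeakJacobiForm k' m' Ψ) :
    IsWeakJacobiForm (k + k') (m + m') (Φ * Ψ) where
  holo := h.holo.mul h'.holo
  modular γ := by
    ext p
    conv_rhs => rw [← h.modular γ, ← h'.modular γ]
    have hj : (γ 1 0 : ℂ) * p.1 + (γ 1 1 : ℂ) ≠ 0 := by
      have := UpperHalfPlane.denom_ne_zero (γ : GL (Fin 2) ℝ) p.1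
      rwa [ModularGroup.denom_apply] at this
    simp only [modularSlash, Pi.mul_apply]
    rw [neg_add, zpow_add₀ hj, Nat.cast_add]
    simp only [mul_add, add_mul, add_div, neg_add, Complex.exp_add]
    ring
  lattice l u := by
    ext p
    conv_rhs => rw [← h.lattice l u, ← h'.lattice l u]
    simp only [latticeSlash, Pi.mul_apply, Nat.cast_add]
    rw [mul_add (2 * (Real.pi : ℂ) * I), add_mul, Complex.exp_add]
    ring
  fourier := by
    obtain ⟨c, hc, hs⟩ := h.fourier
    obtain ⟨c', hc', hs'⟩ := h'.fourier
    let φ : (ℕ × ℤ) × (ℕ × ℤ) → ℕ × ℤ := fun x => x.1 + x.2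
    refine ⟨fun y => ∑' x : {x // φ x = y}, c x.1.1 * c' x.1.2, fun n r hr => ?_, fun p => ?_⟩
    · rw [← tsum_zero (α := ℂ) (β := {x // φ x = (n, r)})]
      refine tsum_congr fun ⟨⟨⟨n₁, r₁⟩, ⟨n₂, r₂⟩⟩, hx⟩ => ?_
      simp only [φ, Prod.mk_add_mk, Prod.mk.injEq] at hx
      obtain ⟨rfl, rfl⟩ := hx
      by_cases e₁ : r₁ ^ 2 ≤ 4 * (n₁ : ℤ) * m + (m : ℤ) ^ 2
      · by_cases e₂ : r₂ ^ 2 ≤ 4 * (n₂ : ℤ) * m' + (m' : ℤ) ^ 2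
        · exact absurd (sq_add_le e₁ e₂) (not_le.2 hr)
        · simp [hc' _ _ (not_le.1 e₂)]
      · simp [hc _ _ (not_le.1 e₁)]
    · have hm : Summable fun x : (ℕ × ℤ) × (ℕ × ℤ) =>
          (c x.1 * fourierMode x.1 p) * (c' x.2 * fourierMode x.2 p) :=
        summable_mul_of_summable_norm (f := fun x => c x * fourierMode x p)
          (g := fun x => c' x * fourierMode x p) (hs p).summable.norm (hs' p).summable.norm
      have hsum : HasSum (fun x : (ℕ × ℤ) × (ℕ × ℤ) =>
          (c x.1 * fourierMode x.1 p) * (c' x.2 * fourierMode x.2 p)) ((Φ * Ψ) p) :=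
        HasSum.mul (f := fun x => c x * fourierMode x p)
          (g := fun x => c' x * fourierMode x p) (hs p) (hs' p) hm
      refine (hasSum_fiber φ hsum).congr_fun fun y => ?_
      rw [← tsum_mul_right]
      refine tsum_congr fun x => ?_
      obtain ⟨x, rfl⟩ := x
      have e : fourierMode (φ x) p = fourierMode x.1 p * fourierMode x.2 p :=
        fourierMode_add _ _ p
      rw [e]
      change c x.1 * c' x.2 * _ = c x.1 * fourierMode x.1 p * (c' x.2 * fourierMode x.2 p)
      ring

/-- The space `J̃_{k,m}` of weak Jacobi forms of weight `k` and index `m`. -/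
def weakJacobi (k : ℤ) (m : ℕ) : Submodule ℂ (ℍ × ℂ → ℂ) where
  carrier := {Φ | IsWeakJacobiForm k m Φ}
  zero_mem' := .zero k m
  add_mem' h h' := h.add h'
  smul_mem' a _ h := h.smul a

/-- A modular form of weight `k`, as a function on `ℍ × ℂ` independent of the second variable,
is a weak Jacobi form of weight `k` and index `0`. -/
theorem isWeakJacobiForm_modularForm {k : ℤ} (f : ModularForm 𝒮ℒ k) :
    IsWeakJacobiForm k 0 (fun p => f p.1) where
  holo := by
    have := UpperHalfPlane.mdifferentiable_iff.1 (ModularFormClass.holo f)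
    exact this.comp differentiableOn_fst (fun w hw => hw)
  modular γ := by
    ext p
    have h := congrFun (SlashInvariantForm.slash_action_eqn f (γ : GL (Fin 2) ℝ) ⟨γ, rfl⟩) p.1
    have h' : (⇑f ∣[k] γ) p.1 = f p.1 := h
    rw [ModularForm.SL_slash_apply, ModularGroup.denom_apply] at h'
    rw [← h']
    simp [modularSlash, mul_comm]
  lattice l u := by ext; simp [latticeSlash]
  fourier := by
    refine ⟨fun x => if x.2 = 0 then (qExpansion 1 f).coeff x.1 else 0, fun n r hr => ?_,
      fun p => ?_⟩
    · have : r ≠ 0 := by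
        rintro rfl
        simp at hr
      simp [this]
    · have h := ModularForm.hasSum_qExpansion (f := f) one_pos one_mem_strictPeriods_SL p.1
      have hi : Function.Injective (fun n : ℕ => ((n, 0) : ℕ × ℤ)) := fun a b hab => by
        simpa using hab
      refine (hi.hasSum_iff ?_).1 ?_
      · rintro ⟨n, r⟩ hx
        have : r ≠ 0 := by
          rintro rfl
          exact hx ⟨n, rfl⟩
        simp [this]
      · refine h.congr_fun fun n => ?_
        simp only [Function.comp, if_true, fourierMode, Function.Periodic.qParam]
        rw [← Complex.exp_nat_mul]
        congr 2
        push_cast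
        ring

/-! ### The bigraded algebra of weak Jacobi forms of even weight -/

/-- The homogeneous component of bidegree `i = (κ, m)`: weak Jacobi forms of weight `2κ` and
index `m`. -/
def component (i : ℤ × ℕ) : Submodule ℂ (ℍ × ℂ → ℂ) := weakJacobi (2 * i.1) i.2

instance : SetLike.GradedMonoid component where
  one_mem := by
    have h := isWeakJacobiForm_modularForm (1 : ModularForm 𝒮ℒ 0)
    have e : (fun p : ℍ × ℂ => (1 : ModularForm 𝒮ℒ 0) p.1) = 1 := by ext; simp
    rw [e] at h
    exact h
  mul_mem i j Φ Ψ hΦ hΨ := by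
    have h := IsWeakJacobiForm.mul (k := 2 * i.1) (k' := 2 * j.1) hΦ hΨ
    rw [← mul_add] at h
    exact h

/-- The algebra `J̃_{ev,*} = ⨁ J̃_{k,m}` (sum over even integers `k` and integers `m ≥ 0`), with the
multiplication of functions. -/
def JacobiAlgebra : Type := ⨁ i : ℤ × ℕ, component i

instance : CommRing JacobiAlgebra := inferInstanceAs (CommRing (⨁ i : ℤ × ℕ, component i))

instance : Algebra ℂ JacobiAlgebra := inferInstanceAs (Algebra ℂ (⨁ i : ℤ × ℕ, component i))

/-- The inclusion of the homogeneous component of bidegree `i` in the algebra. -/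
def incl (i : ℤ × ℕ) : component i →ₗ[ℂ] JacobiAlgebra :=
  DirectSum.lof ℂ (ℤ × ℕ) (fun i => component i) i

/-- The linear map on the algebra with given restrictions to the homogeneous components. -/
def extend {N : Type*} [AddCommMonoid N] [Module ℂ N] (F : ∀ i, component i →ₗ[ℂ] N) :
    JacobiAlgebra →ₗ[ℂ] N :=
  DirectSum.toModule ℂ (ℤ × ℕ) N F

theorem extend_incl {N : Type*} [AddCommMonoid N] [Module ℂ N]
    (F : ∀ i, component i →ₗ[ℂ] N) (i : ℤ × ℕ) (x : component i) :
    extend F (incl i x) = F i x :=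
  DirectSum.toModule_lof (M := fun i => component i) (φ := F) ℂ i x

/-- The homogeneous component of bidegree `i`, as a subspace of the algebra. -/
def homogeneous (i : ℤ × ℕ) : Submodule ℂ JacobiAlgebra := LinearMap.range (incl i)

/-- The inclusion of the space of modular forms of weight `2κ` in the algebra, through the
identification of modular forms with weak Jacobi forms of index `0`. -/
def ofModular (κ : ℤ) : ModularForm 𝒮ℒ (2 * κ) →ₗ[ℂ] JacobiAlgebra :=
  incl (κ, 0) ∘ₗ
    { toFun := fun f => ⟨fun p => f p.1, isWeakJacobiForm_modularForm f⟩
      map_add' := fun _ _ => rfl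
      map_smul' := fun _ _ => rfl }

/-- The algebra `M_*` of modular forms, as a subspace of the algebra of weak Jacobi forms. (Level
one modular forms have even weight.) -/
def modularPart : Submodule ℂ JacobiAlgebra := ⨆ κ : ℤ, LinearMap.range (ofModular κ)

/-! ### The generators of index one -/

/-- The Jacobi-Eisenstein series `E_{k,m}`: the sum over coprime `(c, d)` and over `l ∈ ℤ` of
`(cτ+d)^{-k} exp (2πim (l² (aτ+b)/(cτ+d) + 2lz/(cτ+d) - cz²/(cτ+d)))`, halved, where
`ad - bc = 1` (the summands do not depend on the choice of `a` and `b`). -/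
def jacobiEisenstein (k : ℤ) (m : ℕ) (p : ℍ × ℂ) : ℂ :=
  1 / 2 * ∑' x : {v : ℤ × ℤ // IsCoprime v.1 v.2} × ℤ,
    let c : ℤ := x.1.1.1
    let d : ℤ := x.1.1.2
    let a : ℤ := Int.gcdB c d
    let b : ℤ := -Int.gcdA c d
    let l : ℤ := x.2
    ((c : ℂ) * p.1 + d) ^ (-k) *
      exp (2 * Real.pi * I * m * ((l : ℂ) ^ 2 * ((a * p.1 + b) / (c * p.1 + d)) +
        2 * l * p.2 / (c * p.1 + d) - c * p.2 ^ 2 / (c * p.1 + d)))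

/-- The discriminant form `Δ = (E₄³ - E₆²) / 1728`. -/
def discr (τ : ℍ) : ℂ := (ModularForm.E₄ τ ^ 3 - ModularForm.E₆ τ ^ 2) / 1728

/-- The function `A = Φ_{10,1} / Δ`, with `Φ_{10,1} = (E₆ E_{4,1} - E₄ E_{6,1}) / 144`. -/
def formA (p : ℍ × ℂ) : ℂ :=
  (ModularForm.E₆ p.1 * jacobiEisenstein 4 1 p - ModularForm.E₄ p.1 * jacobiEisenstein 6 1 p) / 144
    / discr p.1

/-- The function `B = Φ_{12,1} / Δ`, with `Φ_{12,1} = (E₄² E_{4,1} - E₆ E_{6,1}) / 144`. -/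
def formB (p : ℍ × ℂ) : ℂ :=
  (ModularForm.E₄ p.1 ^ 2 * jacobiEisenstein 4 1 p - ModularForm.E₆ p.1 * jacobiEisenstein 6 1 p)
    / 144 / discr p.1

/-! ### Serre derivation and its extensions -/

/-- The iterates `Se^i f` of the Serre derivation at a form `f` of weight `k`: each application
raises the weight by `2`. -/
def serreIterate (k : ℤ) (f : ℍ → ℂ) : ℕ → ℍ → ℂ
  | 0 => f
  | i + 1 => Derivative.serreDerivative ((k + 2 * i : ℤ) : ℂ) (serreIterate k f i)

/-- The `n`-th Serre-Rankin-Cohen bracket of forms `f` of weight `k` and `g` of weight `l`. -/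
def serreRankinCohen (k l : ℤ) (n : ℕ) (f g : ℍ → ℂ) : ℍ → ℂ := fun τ =>
  ∑ r ∈ Finset.range (n + 1), (-1 : ℂ) ^ r * Ring.choose ((k : ℂ) + n - 1) (n - r) *
    Ring.choose ((l : ℂ) + n - 1) r * (serreIterate k f r τ * serreIterate l g (n - r) τ)

/-- `D` is the derivation `S_{a,b}`: it extends the Serre derivation of `M_*`, and it satisfies
`D A = a B` and `D B = b E₄ A`. -/
structure IsSerreExtension (A : component (-1, 1)) (B : component (0, 1)) (a b : ℂ)
    (D : Derivation ℂ JacobiAlgebra JacobiAlgebra) : Prop where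
  serre : ∀ (κ : ℤ) (f : ModularForm 𝒮ℒ (2 * κ)), ∃ h : ModularForm 𝒮ℒ (2 * (κ + 1)),
    ⇑h = Derivative.serreDerivative ((2 * κ : ℤ) : ℂ) f ∧
      D (ofModular κ f) = ofModular (κ + 1) h
  map_A : D (incl _ A) = a • incl _ B
  map_B : D (incl _ B) =
    b • (ofModular 2 (ModularForm.mcast (by norm_num) ModularForm.E₄) * incl _ A)

/-! ### Brackets and deformations -/

/-- The value of the `n`-th bracket on the homogeneous components of bidegrees `i` and `j`, for
`f` of weight `k` and index `p`, and `g` of weight `l` and index `q`: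
`∑ (-1)^r binom(k + cp + n - 1, n - r) binom(l + cq + n - 1, r) V^r f V^{n-r} g`. -/
def bracketHom (V : Module.End ℂ JacobiAlgebra) (c : ℂ) (n : ℕ) (i j : ℤ × ℕ) :
    component i →ₗ[ℂ] component j →ₗ[ℂ] JacobiAlgebra :=
  ∑ r ∈ Finset.range (n + 1),
    ((-1 : ℂ) ^ r * Ring.choose (((2 * i.1 : ℤ) : ℂ) + c * i.2 + n - 1) (n - r) *
      Ring.choose (((2 * j.1 : ℤ) : ℂ) + c * j.2 + n - 1) r) •
    (LinearMap.mul ℂ JacobiAlgebra).compl₁₂ ((V ^ r) ∘ₗ incl i) ((V ^ (n - r)) ∘ₗ incl j)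

/-- The `n`-th Rankin-Cohen type bracket built from `V` and `c`: the bilinear extension of
`bracketHom`. -/
def bracket (V : Module.End ℂ JacobiAlgebra) (c : ℂ) (n : ℕ) :
    JacobiAlgebra →ₗ[ℂ] JacobiAlgebra →ₗ[ℂ] JacobiAlgebra :=
  extend fun i => (extend fun j => (bracketHom V c n i j).flip).flip

theorem bracket_incl (V : Module.End ℂ JacobiAlgebra) (c : ℂ) (n : ℕ) (i j : ℤ × ℕ)
    (f : component i) (g : component j) :
    bracket V c n (incl i f) (incl j g) = ∑ r ∈ Finset.range (n + 1),
      ((-1 : ℂ) ^ r * Ring.choose (((2 * i.1 : ℤ) : ℂ) + c * i.2 + n - 1) (n - r) *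
        Ring.choose (((2 * j.1 : ℤ) : ℂ) + c * j.2 + n - 1) r) •
      ((V ^ r) (incl i f) * (V ^ (n - r)) (incl j g)) := by
  simp [bracket, extend_incl, bracketHom, LinearMap.sum_apply]

/-- The product on `R⟦ħ⟧` that extends `f ⋆ g = ∑ μ_j(f, g) ħ^j`. -/
def starProduct {R : Type*} [CommRing R] [Algebra ℂ R] (μ : ℕ → R →ₗ[ℂ] R →ₗ[ℂ] R)
    (F G : PowerSeries R) : PowerSeries R :=
  PowerSeries.mk fun n => ∑ x ∈ Finset.HasAntidiagonal.antidiagonal n, ∑ y ∈ Finset.HasAntidiagonal.antidiagonal x.2,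
    μ x.1 (PowerSeries.coeff y.1 F) (PowerSeries.coeff y.2 G)

/-- `μ` is a formal deformation of the commutative algebra `R`. -/
structure IsFormalDeformation {R : Type*} [CommRing R] [Algebra ℂ R]
    (μ : ℕ → R →ₗ[ℂ] R →ₗ[ℂ] R) : Prop where
  zero : ∀ f g, μ 0 f g = f * g
  assoc : ∀ F G H : PowerSeries R,
    starProduct μ (starProduct μ F G) H = starProduct μ F (starProduct μ G H)

/-- Modular isomorphism: a linear bijection that preserves weight and index of homogeneous forms
and carries the one sequence of brackets to the other. -/
def ModularIsomorphic
    (μ ν : ℕ → JacobiAlgebra →ₗ[ℂ] JacobiAlgebra →ₗ[ℂ] JacobiAlgebra) : Prop :=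
  ∃ φ : JacobiAlgebra ≃ₗ[ℂ] JacobiAlgebra,
    (∀ i, ∀ x ∈ homogeneous i, φ x ∈ homogeneous i) ∧
      ∀ (j : ℕ) (f g : JacobiAlgebra), φ (μ j f g) = ν j (φ f) (φ g)

/-- The parameters `[1,b,c]`, `[0,1,c]` and `[0,0,c]` of the normal forms. -/
def IsNormal (a b : ℂ) : Prop := a = 1 ∨ (a = 0 ∧ b = 1) ∨ (a = 0 ∧ b = 0)

end WeakJacobi

end

/-! The heart of the matter is that the even weight algebra is the polynomial ring in `E₄`, `E₆`,
`A`, `B` (`polyEquiv`). A derivation is then given freely by its values on the four generators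
(`polyDerivation`, `jacobiDerivation`), and everything else is algebra in a bigraded polynomial
ring.

Polynomial structure. For fixed `τ`, a form of index `m` and even weight is an even theta function
of `z`, hence determined by its Fourier coefficients of index `0, …, m`
(`IsThetaFunction.eq_zero_of_even`). Since `A(τ,0) = 0`, `B(τ,0) = 12` and `A(τ,·) ≠ 0`, the `m + 1`
monomials `A^i B^(m-i)` are independent, so they form a basis
(`IsThetaFunction.exists_eq_sum_binaryMonomial`). By uniqueness the coefficients are modular in `τ`.
They are holomorphic, and bounded at the cusp, because they come from values at `m + 1` points by
inverting a Vandermonde matrix that also has an invertible limit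
(`IsWeakJacobiForm.exists_expansion`). It remains to know that `E₄`, `E₆` generate the modular forms
(`modularForm_induction`) and are independent (`eisenstein_independent`).

The forms `A` and `B`. In index one `Φ = h₀ θ₀ + h₁ θ₁`, and the behaviour of `h₀`, `h₁` at the cusp
is read off from `Φ` at `z = 0` and `z = 1/2`. The numerators of `A` and `B` tend to zero for every
`z`, so `h₀`, `h₁` are `O(q)` and stay bounded after division by `Δ`. The Taylor coefficients at `z
= 0` of the Jacobi-Eisenstein series are `E_k` and a multiple of its derivative; Ramanujan's
identities then give `A''(τ,0) = 2(2πi)²`, whence `A` is not zero and has limit `ζ + ζ⁻¹ - 2`.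

Associativity. Adjoin variables `t, y, z` and put `X = yD + z∂_t`, `Y = zE - tX`, where `D =
S_{a,b}` and `E = -W + y∂_y - z∂_z`, with `W` multiplying a form of weight `k` and index `m` by `k +
cm`. Because this modified weight is additive and `D` raises it by 2, `X` and `Y` commute. The
powers of `X⊗Y - Y⊗X` therefore give an associative Moyal product (`moyal_assoc`). On elements free
of `t, y, z` its `n`-th term is `n! (yz)^n` times the bracket (`moyal_lift`), and `yz` is killed by
`X` and `Y`, so it can be cancelled (`polyBracket_assoc`).

Normal forms. Multiplying `A` by `s` turns `(sa, b)` into `(a, sb)` (`modularIsomorphic_scale`).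
Conversely, the bidegrees of the generators have one-dimensional components, so a modular
isomorphism scales each generator. The brackets of order 0 and 1 of the generators then determine
the scalars on `E₄`, `E₆` and the parameters (`eq_of_modularIsomorphic`). -/

noncomputable section

namespace WeakJacobi

open Filter Topology
open scoped Manifold

/-! ### Theta functions of degree `2m` on the torus `ℂ / (ℤτ + ℤ)` -/

/-- `g` is an entire function with the periodicity of a Jacobi form of index `m` at `τ`. -/
structure IsThetaFunction (m : ℕ) (τ : ℂ) (g : ℂ → ℂ) : Prop where
  diff : Differentiable ℂ g
  add_one : ∀ z, g (z + 1) = g z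
  add_tau : ∀ z, g (z + τ) = exp (-(2 * Real.pi * I * m * (τ + 2 * z))) * g z

/-- The `r`-th Fourier coefficient of a `1`-periodic function. -/
def fiberCoeff (g : ℂ → ℂ) (r : ℤ) : ℂ :=
  ∫ x in (0 : ℝ)..1, g x * exp (-(2 * Real.pi * I * r * x))

/-- Cauchy's theorem on a rectangle of width one: the vertical sides cancel by periodicity. -/
theorem integral_add_im_of_periodic {F : ℂ → ℂ} (hF : Differentiable ℂ F)
    (hp : ∀ z, F (z + 1) = F z) (y : ℝ) :
    ∫ x in (0 : ℝ)..1, F (x + y * I) = ∫ x in (0 : ℝ)..1, F x := by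
  have h := Complex.integral_boundary_rect_eq_zero_of_differentiableOn F 0 (1 + y * I)
    hF.differentiableOn
  simp only [zero_re, add_re, one_re, mul_re, ofReal_re, Complex.I_re, mul_zero, ofReal_im,
    Complex.I_im, mul_one,
    sub_self, add_zero, zero_im, add_im, one_im, mul_im, zero_add, ofReal_zero, zero_mul,
    ofReal_one] at h
  have h2 : ∀ t : ℝ, F (1 + t * I) = F (t * I) := fun t => by rw [add_comm, hp]
  simp only [h2, add_sub_cancel_right] at h
  exact (sub_eq_zero.1 h).symm

theorem integral_add_of_periodic {F : ℂ → ℂ} (hF : Differentiable ℂ F)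
    (hp : ∀ z, F (z + 1) = F z) (w : ℂ) :
    ∫ x in (0 : ℝ)..1, F (x + w) = ∫ x in (0 : ℝ)..1, F x := by
  rw [← integral_add_im_of_periodic hF hp w.im]
  have hper : Function.Periodic (fun x : ℝ => F (x + w.im * I)) 1 := fun x => by
    simp only
    rw [← hp (x + w.im * I)]
    congr 1
    push_cast
    ring
  have h1 : ∀ x : ℝ, F (x + w) = (fun x : ℝ => F (x + w.im * I)) (x + w.re) := fun x => by
    simp only
    congr 1
    push_cast
    conv_lhs => rw [← re_add_im w]
    ring
  simp only [h1]
  rw [intervalIntegral.integral_comp_add_right (fun x : ℝ => F (x + w.im * I)) w.re]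
  have := hper.intervalIntegral_add_eq w.re 0
  simpa [add_comm] using this

theorem exp_two_pi_mul_int (n : ℤ) : exp (2 * Real.pi * I * n) = 1 := by
  rw [show 2 * (Real.pi : ℂ) * I * n = n * (2 * Real.pi * I) by ring]
  exact exp_int_mul_two_pi_mul_I n

section

variable {m : ℕ} {τ : ℂ} {g : ℂ → ℂ}

/-- Shift the path of integration by `τ` and apply the quasi-periodicity. Hence a coefficient is
determined, up to a nonzero factor, by its index modulo `2m`. -/
theorem IsThetaFunction.fiberCoeff_add (h : IsThetaFunction m τ g) (r : ℤ) :
    fiberCoeff g r = exp (-(2 * Real.pi * I * (m + r) * τ)) * fiberCoeff g (r + 2 * m) := by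
  have hd : Differentiable ℂ fun z => g z * exp (-(2 * Real.pi * I * r * z)) :=
    h.diff.mul (by fun_prop)
  have hp : ∀ z, g (z + 1) * exp (-(2 * Real.pi * I * r * (z + 1))) =
      g z * exp (-(2 * Real.pi * I * r * z)) := fun z => by
    rw [h.add_one, mul_add, neg_add, exp_add]
    have := exp_two_pi_mul_int (-r)
    rw [show -(2 * (Real.pi : ℂ) * I * r * 1) = 2 * Real.pi * I * (-r : ℤ) by push_cast; ring, this,
      mul_one]
  rw [fiberCoeff, ← integral_add_of_periodic hd hp τ, fiberCoeff,
    ← intervalIntegral.integral_const_mul]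
  congr 1
  ext x
  rw [h.add_tau, mul_comm (exp _) (g x), mul_assoc, ← exp_add, mul_left_comm, ← exp_add]
  congr 2
  push_cast
  ring

/-- Fourier uniqueness kills `g` on the real line; the identity theorem does the rest. -/
theorem eq_zero_of_fiberCoeff_eq_zero (hg : Differentiable ℂ g) (hp : ∀ z, g (z + 1) = g z)
    (h : ∀ r, fiberCoeff g r = 0) : g = 0 := by
  have hper : Function.Periodic (fun x : ℝ => g x) 1 := fun x => by simpa using hp x
  let f : C(AddCircle (1 : ℝ), ℂ) :=
    ⟨hper.lift, continuous_coinduced_dom.mpr (hg.continuous.comp continuous_ofReal)⟩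
  have hf : ∀ x : ℝ, f x = g x := fun x => hper.lift_coe x
  have hc : ∀ n, fourierCoeff f n = 0 := fun n => by
    rw [fourierCoeff_eq_intervalIntegral f n 0, zero_add, ← h n, fiberCoeff, div_one, one_smul]
    congr 1
    ext x
    rw [hf, fourier_coe_apply, smul_eq_mul, mul_comm]
    congr 2
    push_cast
    ring
  have hf0 : f = 0 := by
    have hs : Summable (fourierCoeff f) := by
      rw [show fourierCoeff f = fun _ => 0 from funext hc]
      exact summable_zero
    refine (hasSum_fourier_series_of_summable hs).unique ?_
    rw [show (fun i => fourierCoeff f i • fourier (T := 1) i) = fun _ => 0 from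
      funext fun i => by ext; simp [hc]]
    exact hasSum_zero
  have hg0 : ∀ x : ℝ, g x = 0 := fun x => by rw [← hf x, hf0]; rfl
  have han : AnalyticOnNhd ℂ g Set.univ := fun z _ => hg.analyticAt z
  have := han.eqOn_zero_of_preconnected_of_frequently_eq_zero isPreconnected_univ (z₀ := 0)
    (Set.mem_univ _) ?_
  · exact funext fun z => this (Set.mem_univ z)
  · have ht : Filter.Tendsto (fun n : ℕ => (((1 : ℝ) / ((n : ℝ) + 1) : ℝ) : ℂ)) Filter.atTop
        (nhdsWithin 0 {0}ᶜ) := by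
      refine tendsto_nhdsWithin_iff.2 ⟨?_, Filter.Eventually.of_forall fun n => ?_⟩
      · rw [← ofReal_zero]
        exact (continuous_ofReal.tendsto 0).comp tendsto_one_div_add_atTop_nhds_zero_nat
      · simp only [Set.mem_compl_iff, Set.mem_singleton_iff, ofReal_eq_zero]
        positivity
    exact ht.frequently (Filter.Frequently.of_forall fun n => hg0 _)

theorem exp_two_pi_mul_ne_one {τ : ℂ} (hτ : 0 < τ.im) {r : ℤ} (hr : r ≠ 0) :
    exp (-(2 * Real.pi * I * r * τ)) ≠ 1 := by
  intro h
  have h1 : Real.exp (-(2 * Real.pi * I * r * τ)).re = 1 := by rw [← norm_exp, h, norm_one]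
  rw [Real.exp_eq_one_iff] at h1
  have h2 : (-(2 * Real.pi * I * r * τ)).re = 2 * Real.pi * r * τ.im := by simp
  rw [h2] at h1
  have : (r : ℝ) ≠ 0 := by exact_mod_cast hr
  have := Real.pi_ne_zero
  simp_all [hτ.ne']

/-- Modulo `2m` and up to sign, every index has a representative in `0, …, m`. This bounds the space
of even theta functions by dimension `m + 1`. -/
theorem IsThetaFunction.eq_zero_of_even (hτ : 0 < τ.im) (h : IsThetaFunction m τ g)
    (heven : ∀ z, g (-z) = g z) (hc : ∀ r : ℕ, r ≤ m → fiberCoeff g r = 0) : g = 0 := by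
  have hneg : ∀ r : ℤ, fiberCoeff g (-r) = fiberCoeff g r := fun r => by
    have hd : Differentiable ℂ fun z => g z * exp (-(2 * Real.pi * I * r * z)) :=
      h.diff.mul (by fun_prop)
    have h1 : ∀ x : ℝ, g x * exp (-(2 * Real.pi * I * (-r : ℤ) * x)) =
        (fun x : ℝ => g x * exp (-(2 * Real.pi * I * r * x))) (-x) := fun x => by
      simp only [ofReal_neg, heven]
      congr 2
      push_cast
      ring
    rw [fiberCoeff]
    simp only [h1]
    rw [intervalIntegral.integral_comp_neg (fun x : ℝ => g x * exp (-(2 * Real.pi * I * r * x)))]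
    have hper : Function.Periodic (fun x : ℝ => g x * exp (-(2 * Real.pi * I * r * x))) 1 :=
      fun x => by
        simp only [ofReal_add, ofReal_one]
        rw [h.add_one, mul_add, neg_add, exp_add]
        have := exp_two_pi_mul_int (-r)
        rw [show -(2 * (Real.pi : ℂ) * I * r * 1) = 2 * Real.pi * I * (-r : ℤ) by
          push_cast; ring, this, mul_one]
    have := hper.intervalIntegral_add_eq (-1) 0
    simpa [fiberCoeff] using this
  have hnat : ∀ r : ℕ, fiberCoeff g r = 0 := fun r => by
    induction r using Nat.strong_induction_on with
    | _ r ih =>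
      by_cases hr : r ≤ m
      · exact hc r hr
      rcases Nat.eq_zero_or_pos m with rfl | hm
      -- In index zero the recursion relates a coefficient to itself, with a factor different from
      -- 1.
      · have h1 := h.fiberCoeff_add r
        simp only [Nat.cast_zero, zero_add, mul_zero, add_zero] at h1
        have h2 := exp_two_pi_mul_ne_one hτ (r := r) (by omega)
        have h3 : (exp (-(2 * Real.pi * I * (r : ℤ) * τ)) - 1) * fiberCoeff g r = 0 := by
          linear_combination -h1
        exact (mul_eq_zero.1 h3).resolve_left (sub_ne_zero.2 h2)
      · have h1 := h.fiberCoeff_add ((r : ℤ) - 2 * m)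
        rw [sub_add_cancel] at h1
        have h0 : fiberCoeff g ((r : ℤ) - 2 * m) = 0 := by
          rcases le_or_gt (2 * m) r with h2 | h2
          · have := ih (r - 2 * m) (by omega)
            rwa [Nat.cast_sub h2] at this
          · have := ih (2 * m - r) (by omega)
            rw [Nat.cast_sub h2.le, ← hneg] at this
            simpa using this
        rw [h0] at h1
        exact (mul_eq_zero.1 h1.symm).resolve_left (exp_ne_zero _)
  refine eq_zero_of_fiberCoeff_eq_zero h.diff h.add_one fun r => ?_
  obtain ⟨n, rfl | rfl⟩ := r.eq_nat_or_neg
  · exact hnat n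
  · rw [hneg]
    exact hnat n

theorem IsThetaFunction.eq_zero_of_index_one (h : IsThetaFunction 1 τ g)
    (h0 : fiberCoeff g 0 = 0) (h1 : fiberCoeff g 1 = 0) : g = 0 := by
  have key : ∀ r : ℤ, fiberCoeff g r = 0 ↔ fiberCoeff g (r + 2) = 0 := fun r => by
    rw [h.fiberCoeff_add r]
    simp [exp_ne_zero]
  have hev : ∀ (s : ℤ), fiberCoeff g s = 0 → ∀ n : ℤ, fiberCoeff g (s + 2 * n) = 0 := by
    intro s hs n
    induction n with
    | zero => simpa using hs
    | succ k ih =>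
      rw [show s + 2 * ((k : ℤ) + 1) = s + 2 * k + 2 by ring]
      exact (key _).1 ih
    | pred k ih =>
      refine (key _).2 ?_
      rw [show s + 2 * (-(k : ℤ) - 1) + 2 = s + 2 * -(k : ℤ) by ring]
      exact ih
  refine eq_zero_of_fiberCoeff_eq_zero h.diff h.add_one fun r => ?_
  rcases Int.even_or_odd' r with ⟨n, rfl | rfl⟩
  · simpa using hev 0 h0 n
  · rw [add_comm]
    exact hev 1 h1 n

end

/-! ### The theta series of index one -/

/-- The terms of the theta series of index one. -/
def thetaTerm (j l : ℤ) (τ z : ℂ) : ℂ :=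
  exp (2 * Real.pi * I * ((l ^ 2 + j * l) * τ + (2 * l + j) * z))

/-- The theta series `∑ q^{l² + jl} ζ^{2l + j}`. -/
def thetaSeries (j : ℤ) (τ z : ℂ) : ℂ := ∑' l, thetaTerm j l τ z

theorem thetaTerm_eq (j l : ℤ) (τ z : ℂ) :
    thetaTerm j l τ z =
      exp (2 * Real.pi * I * j * z) * jacobiTheta₂_term l (2 * z + j * τ) (2 * τ) := by
  rw [thetaTerm, jacobiTheta₂_term, ← exp_add]
  congr 1
  ring

/-- Convergence and joint holomorphy are inherited from `jacobiTheta₂`. The usual factor `q^(j²/4)`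
is left out, so only integral powers of `q` occur and theta coefficients of Jacobi forms are
1-periodic in `τ`. -/
theorem thetaSeries_eq (j : ℤ) (τ z : ℂ) :
    thetaSeries j τ z =
      exp (2 * Real.pi * I * j * z) * jacobiTheta₂ (2 * z + j * τ) (2 * τ) := by
  simp only [thetaSeries, thetaTerm_eq, jacobiTheta₂, tsum_mul_left]

theorem two_mul_im_pos {τ : ℂ} (hτ : 0 < τ.im) : 0 < (2 * τ).im := by simpa using hτ

theorem summable_thetaTerm (j : ℤ) {τ : ℂ} (hτ : 0 < τ.im) (z : ℂ) :
    Summable fun l => thetaTerm j l τ z := by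
  simp only [thetaTerm_eq]
  exact ((summable_jacobiTheta₂_term_iff _ _).2 (two_mul_im_pos hτ)).mul_left _

theorem hasSum_thetaSeries (j : ℤ) {τ : ℂ} (hτ : 0 < τ.im) (z : ℂ) :
    HasSum (fun l => thetaTerm j l τ z) (thetaSeries j τ z) :=
  (summable_thetaTerm j hτ z).hasSum

theorem differentiableAt_thetaSeries (j : ℤ) {w : ℂ × ℂ} (hw : 0 < w.1.im) :
    DifferentiableAt ℂ (fun w : ℂ × ℂ => thetaSeries j w.1 w.2) w := by
  simp only [thetaSeries_eq]
  have h := (hasFDerivAt_jacobiTheta₂ (2 * w.2 + j * w.1) (two_mul_im_pos hw)).differentiableAt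
  have h2 : DifferentiableAt ℂ (fun w : ℂ × ℂ => (2 * w.2 + j * w.1, 2 * w.1)) w := by fun_prop
  have h3 := DifferentiableAt.comp (g := fun p : ℂ × ℂ => jacobiTheta₂ p.1 p.2)
    (f := fun w : ℂ × ℂ => (2 * w.2 + j * w.1, 2 * w.1)) w h h2
  exact DifferentiableAt.mul (by fun_prop) h3

theorem thetaTerm_add_tau (j l : ℤ) (τ z : ℂ) :
    thetaTerm j l τ (z + τ) =
      exp (-(2 * Real.pi * I * (1 : ℕ) * (τ + 2 * z))) * thetaTerm j (l + 1) τ z := by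
  rw [thetaTerm, thetaTerm, ← exp_add]
  congr 1
  push_cast
  ring

theorem isThetaFunction_thetaSeries (j : ℤ) {τ : ℂ} (hτ : 0 < τ.im) :
    IsThetaFunction 1 τ (thetaSeries j τ) where
  diff z := (differentiableAt_thetaSeries j (w := (τ, z)) hτ).comp z
    (differentiableAt_const τ |>.prodMk differentiableAt_id)
  add_one z := by
    refine tsum_congr fun l => ?_
    rw [thetaTerm, thetaTerm]
    have := exp_two_pi_mul_int (2 * l + j)
    rw [show 2 * Real.pi * I * (((l : ℂ) ^ 2 + j * l) * τ + (2 * l + j) * (z + 1)) =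
      2 * Real.pi * I * ((l ^ 2 + j * l) * τ + (2 * l + j) * z) +
        2 * Real.pi * I * (2 * l + j : ℤ) by push_cast; ring, exp_add, this, mul_one]
  add_tau z := by
    rw [thetaSeries, thetaSeries, ← tsum_mul_left]
    simp only [thetaTerm_add_tau]
    exact (Equiv.addRight (1 : ℤ)).tsum_eq
      (fun l => exp (-(2 * Real.pi * I * (1 : ℕ) * (τ + 2 * z))) * thetaTerm j l τ z)

/-- `θ₀` has only even powers of `ζ` and `θ₁` only odd ones, so the translation by `1/2` separates
the two components of a form of index one. -/
theorem thetaSeries_zero_add_half (τ z : ℂ) :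
    thetaSeries 0 τ (z + 1 / 2) = thetaSeries 0 τ z := by
  refine tsum_congr fun l => ?_
  rw [thetaTerm, thetaTerm]
  have := exp_two_pi_mul_int l
  rw [show 2 * Real.pi * I * (((l : ℂ) ^ 2 + (0 : ℤ) * l) * τ + (2 * l + (0 : ℤ)) * (z + 1 / 2)) =
      2 * Real.pi * I * ((l ^ 2 + (0 : ℤ) * l) * τ + (2 * l + (0 : ℤ)) * z) +
        2 * Real.pi * I * l by push_cast; ring, exp_add, this, mul_one]

theorem thetaSeries_one_add_half (τ z : ℂ) :
    thetaSeries 1 τ (z + 1 / 2) = -thetaSeries 1 τ z := by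
  rw [thetaSeries, thetaSeries, ← tsum_neg]
  refine tsum_congr fun l => ?_
  rw [thetaTerm, thetaTerm]
  have := exp_two_pi_mul_int l
  rw [show 2 * Real.pi * I * (((l : ℂ) ^ 2 + (1 : ℤ) * l) * τ + (2 * l + (1 : ℤ)) * (z + 1 / 2)) =
      2 * Real.pi * I * ((l ^ 2 + (1 : ℤ) * l) * τ + (2 * l + (1 : ℤ)) * z) +
        2 * Real.pi * I * l + Real.pi * I by push_cast; ring, exp_add, exp_add, this, exp_pi_mul_I]
  ring

theorem integral_exp_two_pi_mul_int (n : ℤ) :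
    ∫ x in (0 : ℝ)..1, exp (2 * Real.pi * I * n * x) = if n = 0 then 1 else 0 := by
  split_ifs with h
  · simp [h]
  · have hn : (2 * Real.pi * I * n : ℂ) ≠ 0 := by simp [h, Real.pi_ne_zero]
    rw [integral_exp_mul_complex hn]
    simp [exp_two_pi_mul_int]

theorem fiberCoeff_thetaSeries (j r : ℤ) {τ : ℂ} (hτ : 0 < τ.im) :
    fiberCoeff (thetaSeries j τ) r =
      ∑' l : ℤ, if 2 * l + j = r then thetaTerm j l τ 0 else 0 := by
  have hx : ∀ (l : ℤ) (x : ℝ), thetaTerm j l τ x * exp (-(2 * Real.pi * I * r * x)) =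
      thetaTerm j l τ 0 * exp (2 * Real.pi * I * (2 * l + j - r : ℤ) * x) := fun l x => by
    rw [thetaTerm, thetaTerm, ← exp_add, ← exp_add]
    congr 1
    push_cast
    ring
  have hn : ∀ (l : ℤ) (x : ℝ), ‖exp (2 * Real.pi * I * (2 * l + j - r : ℤ) * x)‖ = 1 :=
    fun l x => by
      rw [show 2 * Real.pi * I * (2 * l + j - r : ℤ) * x =
        (2 * Real.pi * (2 * l + j - r : ℤ) * x : ℝ) * I by push_cast; ring]
      exact norm_exp_ofReal_mul_I _
  have h : HasSum (fun l => ∫ x in (0 : ℝ)..1, thetaTerm j l τ 0 *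
      exp (2 * Real.pi * I * (2 * l + j - r : ℤ) * x))
      (∫ x in (0 : ℝ)..1, thetaSeries j τ x * exp (-(2 * Real.pi * I * r * x))) := by
    refine intervalIntegral.hasSum_integral_of_dominated_convergence
      (fun l _ => ‖thetaTerm j l τ 0‖) (fun l => ?_) (fun l => ?_) ?_ ?_ ?_
    · exact Continuous.aestronglyMeasurable (by fun_prop)
    · refine Filter.Eventually.of_forall fun x _ => ?_
      rw [norm_mul, hn, mul_one]
    · exact Filter.Eventually.of_forall fun x _ => (summable_thetaTerm j hτ 0).norm
    · simp
    · refine Filter.Eventually.of_forall fun x _ => ?_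
      simp only [← hx]
      exact (hasSum_thetaSeries j hτ x).mul_right _
  rw [fiberCoeff, ← h.tsum_eq]
  refine tsum_congr fun l => ?_
  rw [intervalIntegral.integral_const_mul, integral_exp_two_pi_mul_int]
  simp only [sub_eq_zero, mul_ite, mul_one, mul_zero]

theorem fiberCoeff_thetaSeries_self (j : ℤ) {τ : ℂ} (hτ : 0 < τ.im) :
    fiberCoeff (thetaSeries j τ) j = 1 := by
  rw [fiberCoeff_thetaSeries j j hτ, tsum_eq_single 0]
  · simp [thetaTerm]
  · intro l hl
    rw [if_neg (by omega)]

theorem fiberCoeff_thetaSeries_of_odd {j r : ℤ} (h : Odd (r - j)) {τ : ℂ} (hτ : 0 < τ.im) :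
    fiberCoeff (thetaSeries j τ) r = 0 := by
  rw [fiberCoeff_thetaSeries j r hτ]
  convert tsum_zero with l
  rw [if_neg]
  rw [Int.odd_iff] at h
  omega

theorem exists_thetaSeries_ne_zero (j : ℤ) {τ : ℂ} (hτ : 0 < τ.im) :
    ∃ z, thetaSeries j τ z ≠ 0 := by
  by_contra! h
  have := fiberCoeff_thetaSeries_self j hτ
  simp [fiberCoeff, h] at this

theorem IsThetaFunction.eq_thetaSeries {τ : ℂ} {g : ℂ → ℂ} (h : IsThetaFunction 1 τ g)
    (hτ : 0 < τ.im) (z : ℂ) :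
    g z = fiberCoeff g 0 * thetaSeries 0 τ z + fiberCoeff g 1 * thetaSeries 1 τ z := by
  have h0 := isThetaFunction_thetaSeries 0 hτ
  have h1 := isThetaFunction_thetaSeries 1 hτ
  set a := fiberCoeff g 0
  set b := fiberCoeff g 1
  have hs : IsThetaFunction 1 τ
      (fun z => g z - (a * thetaSeries 0 τ z + b * thetaSeries 1 τ z)) := by
    refine ⟨h.diff.sub ((h0.diff.const_mul a).add (h1.diff.const_mul b)), fun z => ?_, fun z => ?_⟩
    · rw [h.add_one, h0.add_one, h1.add_one]
    · rw [h.add_tau, h0.add_tau, h1.add_tau]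
      ring
  have hc : ∀ r, fiberCoeff (fun z => g z - (a * thetaSeries 0 τ z + b * thetaSeries 1 τ z)) r =
      fiberCoeff g r - (a * fiberCoeff (thetaSeries 0 τ) r +
        b * fiberCoeff (thetaSeries 1 τ) r) := fun r => by
    have c := h.diff.continuous
    have c0 := h0.diff.continuous
    have c1 := h1.diff.continuous
    simp only [fiberCoeff]
    rw [← intervalIntegral.integral_const_mul, ← intervalIntegral.integral_const_mul,
      ← intervalIntegral.integral_add, ← intervalIntegral.integral_sub]
    · congr 1
      ext x
      ring
    all_goals exact Continuous.intervalIntegrable (by fun_prop) _ _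
  have := hs.eq_zero_of_index_one
    (by rw [hc, fiberCoeff_thetaSeries_self 0 hτ, fiberCoeff_thetaSeries_of_odd (by decide) hτ]
        simp [a])
    (by rw [hc, fiberCoeff_thetaSeries_self 1 hτ, fiberCoeff_thetaSeries_of_odd (by decide) hτ]
        simp [b])
  exact sub_eq_zero.1 (congrFun this z)

/-- This replaces the defining integral by a quotient of values, from which holomorphy and limits in
`τ` are immediate. -/
theorem IsThetaFunction.fiberCoeff_zero_eq {τ : ℂ} {g : ℂ → ℂ} (h : IsThetaFunction 1 τ g)
    (hτ : 0 < τ.im) {z : ℂ} (hz : thetaSeries 0 τ z ≠ 0) :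
    fiberCoeff g 0 = (g z + g (z + 1 / 2)) / (2 * thetaSeries 0 τ z) := by
  rw [eq_div_iff (mul_ne_zero two_ne_zero hz), h.eq_thetaSeries hτ z,
    h.eq_thetaSeries hτ (z + 1 / 2), thetaSeries_zero_add_half, thetaSeries_one_add_half]
  ring

theorem IsThetaFunction.fiberCoeff_one_eq {τ : ℂ} {g : ℂ → ℂ} (h : IsThetaFunction 1 τ g)
    (hτ : 0 < τ.im) {z : ℂ} (hz : thetaSeries 1 τ z ≠ 0) :
    fiberCoeff g 1 = (g z - g (z + 1 / 2)) / (2 * thetaSeries 1 τ z) := by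
  rw [eq_div_iff (mul_ne_zero two_ne_zero hz), h.eq_thetaSeries hτ z,
    h.eq_thetaSeries hτ (z + 1 / 2), thetaSeries_zero_add_half, thetaSeries_one_add_half]
  ring

/-! ### Uniform bounds and second derivatives of the theta series. -/

theorem norm_thetaTerm (j l : ℤ) (τ z : ℂ) :
    ‖thetaTerm j l τ z‖ =
      Real.exp (-(2 * Real.pi * ((l ^ 2 + j * l : ℤ) * τ.im + (2 * l + j : ℤ) * z.im))) := by
  rw [thetaTerm, norm_exp]
  congr 1
  rw [show 2 * (Real.pi : ℂ) * I * (((l : ℂ) ^ 2 + j * l) * τ + (2 * l + j) * z) =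
    ((2 * Real.pi : ℝ) : ℂ) * (I * (((l ^ 2 + j * l : ℤ) : ℝ) * τ + ((2 * l + j : ℤ) : ℝ) * z)) by
    push_cast; ring, re_ofReal_mul, I_mul_re, add_im, im_ofReal_mul, im_ofReal_mul]
  ring

/-- The factor `(1 + |2l + j|)²` absorbs what two derivatives in `z` produce, so one bound serves
the series, its derivatives and the holomorphy of `thetaSecond`. -/
theorem exists_summable_thetaTerm_bound (j : ℤ) {T : ℝ} (hT : 0 < T) (R : ℝ) :
    ∃ u : ℤ → ℝ, Summable u ∧ ∀ (l : ℤ) (τ z : ℂ), T ≤ τ.im → τ.im ≤ R → |z.im| ≤ R →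
      (1 + |(2 * l + j : ℝ)|) ^ 2 * ‖thetaTerm j l τ z‖ ≤ u l := by
  set S := 2 * R + |(j : ℝ)| * R
  have s0 := summable_pow_mul_jacobiTheta₂_term_bound S hT 0
  have s2 := summable_pow_mul_jacobiTheta₂_term_bound S hT 2
  refine ⟨_, ((s0.mul_left (2 * (1 + |(j : ℝ)|) ^ 2)).add (s2.mul_left 8)).mul_left
    (Real.exp (2 * Real.pi * (|(j : ℝ)| * R))), fun l τ z hτ hτR hz => ?_⟩
  have hR : 0 ≤ R := (abs_nonneg _).trans hz
  have h1 : ‖exp (2 * Real.pi * I * j * z)‖ ≤ Real.exp (2 * Real.pi * (|(j : ℝ)| * R)) := by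
    rw [norm_exp, Real.exp_le_exp]
    have : (2 * Real.pi * I * j * z).re = 2 * Real.pi * (-(j : ℝ) * z.im) := by
      rw [show 2 * (Real.pi : ℂ) * I * j * z = ((2 * Real.pi : ℝ) : ℂ) * (I * ((j : ℝ) * z)) by
        push_cast; ring, re_ofReal_mul, I_mul_re, im_ofReal_mul]
      ring
    rw [this]
    refine mul_le_mul_of_nonneg_left ?_ (by positivity)
    calc -(j : ℝ) * z.im ≤ |-(j : ℝ) * z.im| := le_abs_self _
      _ = |(j : ℝ)| * |z.im| := by rw [abs_mul, abs_neg]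
      _ ≤ _ := mul_le_mul_of_nonneg_left hz (abs_nonneg _)
  have h2 : ‖jacobiTheta₂_term l (2 * z + j * τ) (2 * τ)‖ ≤
      Real.exp (-Real.pi * (T * l ^ 2 - 2 * S * |l|)) := by
    refine norm_jacobiTheta₂_term_le hT ?_ ?_ l
    · have : (2 * z + j * τ).im = 2 * z.im + j * τ.im := by
        rw [show (2 : ℂ) * z + j * τ = ((2 : ℝ) : ℂ) * z + ((j : ℝ) : ℂ) * τ by push_cast; ring,
          add_im, im_ofReal_mul, im_ofReal_mul]
      rw [this]
      refine (abs_add_le _ _).trans (add_le_add ?_ ?_)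
      · rw [abs_mul, abs_two]
        linarith
      · rw [abs_mul, abs_of_pos (hT.trans_le hτ)]
        exact mul_le_mul_of_nonneg_left hτR (abs_nonneg _)
    · have : (2 * τ).im = 2 * τ.im := by
        rw [show (2 : ℂ) * τ = ((2 : ℝ) : ℂ) * τ by push_cast; ring, im_ofReal_mul]
      rw [this]
      linarith
  have h3 : (1 + |(2 * l + j : ℝ)|) ^ 2 ≤ 2 * (1 + |(j : ℝ)|) ^ 2 + 8 * |(l : ℝ)| ^ 2 := by
    have : |(2 * l + j : ℝ)| ≤ 2 * |(l : ℝ)| + |(j : ℝ)| := by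
      refine (abs_add_le _ _).trans (add_le_add ?_ le_rfl)
      rw [abs_mul, abs_two]
    have h4 : (1 + |(2 * l + j : ℝ)|) ^ 2 ≤ (1 + |(j : ℝ)| + 2 * |(l : ℝ)|) ^ 2 := by
      refine pow_le_pow_left₀ (by positivity) ?_ 2
      linarith
    nlinarith [sq_nonneg (1 + |(j : ℝ)| - 2 * |(l : ℝ)|)]
  rw [thetaTerm_eq, norm_mul]
  set E := Real.exp (-Real.pi * (T * l ^ 2 - 2 * S * |l|)) with hE
  calc _ ≤ (2 * (1 + |(j : ℝ)|) ^ 2 + 8 * |(l : ℝ)| ^ 2) *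
        (Real.exp (2 * Real.pi * (|(j : ℝ)| * R)) * E) := by
        refine mul_le_mul h3 (mul_le_mul h1 h2 (norm_nonneg _) (Real.exp_pos _).le)
          (by positivity) (by positivity)
    _ = _ := by
        rw [hE]
        push_cast
        ring

/-- The second derivative of the theta series at `z = 0`, as a series. -/
def thetaSecond (j : ℤ) (τ : ℂ) : ℂ :=
  ∑' l : ℤ, (2 * Real.pi * I * (2 * l + j)) ^ 2 * thetaTerm j l τ 0

theorem hasDerivAt_thetaTerm (j l : ℤ) (τ z : ℂ) :
    HasDerivAt (thetaTerm j l τ) (2 * Real.pi * I * (2 * l + j) * thetaTerm j l τ z) z := by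
  have h : HasDerivAt (fun z : ℂ => 2 * Real.pi * I * ((l ^ 2 + j * l) * τ + (2 * l + j) * z))
      (2 * Real.pi * I * (2 * l + j)) z := by
    have := (((hasDerivAt_id z).const_mul ((2 * l + j : ℂ))).const_add
      ((l ^ 2 + j * l : ℂ) * τ)).const_mul (2 * Real.pi * I)
    simpa using this
  refine h.cexp.congr_deriv ?_
  rw [thetaTerm, mul_comm]

theorem norm_two_pi_mul (x : ℝ) : ‖(2 * Real.pi * I * x : ℂ)‖ = 2 * Real.pi * |x| := by
  simp [abs_of_pos Real.pi_pos]

theorem two_pi_mul_cast (l j : ℤ) :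
    (2 * Real.pi * I * (2 * l + j) : ℂ) = 2 * Real.pi * I * ((2 * l + j : ℝ) : ℂ) := by
  push_cast
  ring

theorem deriv_thetaSeries (j : ℤ) {τ : ℂ} (hτ : 0 < τ.im) {z : ℂ} (hz : z ∈ Metric.ball 0 1) :
    deriv (thetaSeries j τ) z = ∑' l : ℤ, 2 * Real.pi * I * (2 * l + j) * thetaTerm j l τ z := by
  obtain ⟨u, hu, hb⟩ := exists_summable_thetaTerm_bound j hτ (max τ.im 1)
  have := hasSum_deriv_of_summable_norm (F := fun l => thetaTerm j l τ) hu
    (fun l => fun w _ => (hasDerivAt_thetaTerm j l τ w).differentiableAt.differentiableWithinAt)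
    Metric.isOpen_ball (fun l w hw => ?_) hz
  · exact (this.congr_fun fun l => ((hasDerivAt_thetaTerm j l τ z).deriv).symm).tsum_eq.symm
  · have hw1 : |w.im| ≤ max τ.im 1 := (abs_im_le_norm w).trans
      ((mem_ball_zero_iff.1 hw).le.trans (le_max_right _ _))
    refine le_trans ?_ (hb l τ w le_rfl (le_max_left _ _) hw1)
    refine le_mul_of_one_le_left (norm_nonneg _) (one_le_pow₀ ?_)
    linarith [abs_nonneg (2 * l + j : ℝ)]

theorem deriv_deriv_thetaSeries (j : ℤ) {τ : ℂ} (hτ : 0 < τ.im) :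
    deriv (deriv (thetaSeries j τ)) 0 = thetaSecond j τ := by
  obtain ⟨u, hu, hb⟩ := exists_summable_thetaTerm_bound j hτ (max τ.im 1)
  have h0 : (0 : ℂ) ∈ Metric.ball (0 : ℂ) 1 := Metric.mem_ball_self one_pos
  have he : deriv (thetaSeries j τ) =ᶠ[𝓝 0]
      fun z => ∑' l : ℤ, 2 * Real.pi * I * (2 * l + j) * thetaTerm j l τ z := by
    filter_upwards [Metric.isOpen_ball.mem_nhds h0] with z hz
    exact deriv_thetaSeries j hτ hz
  rw [he.deriv_eq]
  have hd : ∀ (l : ℤ) (w : ℂ), HasDerivAt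
      (fun z => 2 * Real.pi * I * (2 * l + j) * thetaTerm j l τ z)
      (2 * Real.pi * I * (2 * l + j) * (2 * Real.pi * I * (2 * l + j) * thetaTerm j l τ w)) w :=
    fun l w => (hasDerivAt_thetaTerm j l τ w).const_mul _
  have := hasSum_deriv_of_summable_norm
    (F := fun (l : ℤ) z => 2 * Real.pi * I * (2 * l + j) * thetaTerm j l τ z)
    (hu.mul_left (2 * Real.pi))
    (fun l => fun w _ => (hd l w).differentiableAt.differentiableWithinAt)
    Metric.isOpen_ball (fun l w hw => ?_) h0
  · rw [← (this.congr_fun fun l => ((hd l 0).deriv).symm).tsum_eq, thetaSecond]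
    exact tsum_congr fun l => by ring
  · have hw1 : |w.im| ≤ max τ.im 1 := (abs_im_le_norm w).trans
      ((mem_ball_zero_iff.1 hw).le.trans (le_max_right _ _))
    rw [norm_mul, two_pi_mul_cast, norm_two_pi_mul, mul_assoc]
    refine mul_le_mul_of_nonneg_left ?_ (by positivity)
    refine le_trans ?_ (hb l τ w le_rfl (le_max_left _ _) hw1)
    refine mul_le_mul_of_nonneg_right ?_ (norm_nonneg _)
    nlinarith [abs_nonneg (2 * l + j : ℝ)]

theorem differentiableOn_thetaSecond (j : ℤ) :
    DifferentiableOn ℂ (thetaSecond j) {w | 0 < w.im} := by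
  intro τ hτ
  have hτ' : 0 < τ.im := hτ
  obtain ⟨u, hu, hb⟩ := exists_summable_thetaTerm_bound j (half_pos hτ') (2 * τ.im)
  set U : Set ℂ := {w | τ.im / 2 < w.im ∧ w.im < 2 * τ.im}
  have hU : IsOpen U := (isOpen_lt continuous_const Complex.continuous_im).inter
    (isOpen_lt Complex.continuous_im continuous_const)
  have hmem : τ ∈ U := ⟨by linarith, by linarith⟩
  have := differentiableOn_tsum_of_summable_norm
    (F := fun (l : ℤ) τ => (2 * Real.pi * I * (2 * l + j)) ^ 2 * thetaTerm j l τ 0)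
    (hu.mul_left ((2 * Real.pi) ^ 2)) (fun l => ?_) hU (fun l w hw => ?_)
  · exact (this.differentiableAt (hU.mem_nhds hmem)).differentiableWithinAt
  · unfold thetaTerm
    fun_prop
  · rw [norm_mul, norm_pow, two_pi_mul_cast, norm_two_pi_mul, mul_pow, mul_assoc]
    refine mul_le_mul_of_nonneg_left ?_ (by positivity)
    refine le_trans ?_ (hb l w 0 hw.1.le hw.2.le (by simp [hτ'.le]))
    refine mul_le_mul_of_nonneg_right ?_ (norm_nonneg _)
    nlinarith [abs_nonneg (2 * l + j : ℝ), sq_abs (2 * l + j : ℝ)]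

/-! ### Limits of the theta series at the cusp. -/

theorem tendsto_tsum_thetaTerm {j : ℤ} (hj : ∀ l : ℤ, 0 ≤ l ^ 2 + j * l) (c : ℤ → ℂ) (z : ℂ)
    (hs : Summable fun l => ‖c l * thetaTerm j l I z‖) :
    Tendsto (fun τ : ℍ => ∑' l, c l * thetaTerm j l τ z) atImInfty
      (𝓝 (∑' l, c l * if l ^ 2 + j * l = 0 then thetaTerm j l I z else 0)) := by
  refine tendsto_tsum_of_dominated_convergence hs (fun l => ?_) ?_
  · refine Tendsto.const_mul _ ?_
    split_ifs with h
    · have : ∀ τ : ℍ, thetaTerm j l τ z = thetaTerm j l I z := fun τ => by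
        have h' : ((l : ℂ) ^ 2 + j * l) = 0 := by exact_mod_cast h
        rw [thetaTerm, thetaTerm, h', zero_mul, zero_mul]
      simp only [this]
      exact tendsto_const_nhds
    · have hpos : (0 : ℝ) < (l ^ 2 + j * l : ℤ) := by
        exact_mod_cast lt_of_le_of_ne (hj l) (Ne.symm h)
      rw [tendsto_zero_iff_norm_tendsto_zero]
      simp only [norm_thetaTerm]
      refine Real.tendsto_exp_atBot.comp ?_
      refine tendsto_neg_atTop_atBot.comp ?_
      refine Tendsto.const_mul_atTop (by positivity) ?_
      refine tendsto_atTop_add_const_right _ _ ?_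
      exact Tendsto.const_mul_atTop hpos tendsto_comap
  -- At fixed `z` the norm of each term decreases as `Im τ` grows, because `l² + jl ≥ 0`; its value
  -- at `I` is the dominating one.
  · filter_upwards [(tendsto_comap (f := UpperHalfPlane.im)).eventually (eventually_ge_atTop 1)]
      with τ hτ l
    rw [norm_mul, norm_mul]
    refine mul_le_mul_of_nonneg_left ?_ (norm_nonneg _)
    rw [norm_thetaTerm, norm_thetaTerm, Real.exp_le_exp, neg_le_neg_iff]
    refine mul_le_mul_of_nonneg_left ?_ (by positivity)
    have h0 : (0 : ℝ) ≤ (l ^ 2 + j * l : ℤ) := by exact_mod_cast hj l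
    have : (1 : ℝ) ≤ (τ : ℂ).im := hτ
    have := mul_le_mul_of_nonneg_left this h0
    simpa using this

theorem nonneg_zero (l : ℤ) : 0 ≤ l ^ 2 + 0 * l := by nlinarith [sq_nonneg l]

theorem nonneg_one (l : ℤ) : 0 ≤ l ^ 2 + 1 * l := by
  rcases le_or_gt 0 l with h | h
  · positivity
  · nlinarith

theorem I_im_pos : 0 < Complex.I.im := by simp

theorem tendsto_tsum_thetaTerm_zero (c : ℤ → ℂ) (z : ℂ)
    (hs : Summable fun l => ‖c l * thetaTerm 0 l I z‖) :
    Tendsto (fun τ : ℍ => ∑' l, c l * thetaTerm 0 l τ z) atImInfty (𝓝 (c 0)) := by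
  convert tendsto_tsum_thetaTerm nonneg_zero c z hs using 2
  rw [tsum_eq_single 0]
  · simp [thetaTerm]
  · intro l hl
    rw [if_neg (by simpa using hl), mul_zero]

theorem tendsto_tsum_thetaTerm_one (c : ℤ → ℂ) (z : ℂ)
    (hs : Summable fun l => ‖c l * thetaTerm 1 l I z‖) :
    Tendsto (fun τ : ℍ => ∑' l, c l * thetaTerm 1 l τ z) atImInfty
      (𝓝 (c 0 * exp (2 * Real.pi * I * z) + c (-1) * exp (-(2 * Real.pi * I * z)))) := by
  convert tendsto_tsum_thetaTerm nonneg_one c z hs using 2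
  -- The exponent `l² + l` vanishes exactly at `l = 0` and `l = -1`, which give `ζ` and `ζ⁻¹`.
  rw [tsum_eq_sum (s := {0, -1})]
  · rw [Finset.sum_insert (by decide), Finset.sum_singleton, if_pos (by norm_num),
      if_pos (by norm_num), thetaTerm, thetaTerm]
    congr 3
    · push_cast
      ring
    · push_cast
      ring
  · intro l hl
    rw [if_neg, mul_zero]
    intro h
    have : l * (l + 1) = 0 := by linarith
    rcases mul_eq_zero.1 this with h | h
    · simp [h] at hl
    · have : l = -1 := by omega
      simp [this] at hl

theorem summable_sq_mul_thetaTerm (j : ℤ) {τ : ℂ} (hτ : 0 < τ.im) :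
    Summable fun l : ℤ => ‖(2 * Real.pi * I * (2 * l + j)) ^ 2 * thetaTerm j l τ 0‖ := by
  obtain ⟨u, hu, hb⟩ := exists_summable_thetaTerm_bound j hτ τ.im
  refine Summable.of_nonneg_of_le (fun l => norm_nonneg _) (fun l => ?_)
    (hu.mul_left ((2 * Real.pi) ^ 2))
  rw [norm_mul, norm_pow, two_pi_mul_cast, norm_two_pi_mul, mul_pow, mul_assoc]
  refine mul_le_mul_of_nonneg_left ?_ (by positivity)
  refine le_trans ?_ (hb l τ 0 le_rfl le_rfl (by simp [hτ.le]))
  refine mul_le_mul_of_nonneg_right ?_ (norm_nonneg _)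
  nlinarith [abs_nonneg (2 * l + j : ℝ), sq_abs (2 * l + j : ℝ)]

theorem tendsto_thetaSeries_zero (z : ℂ) :
    Tendsto (fun τ : ℍ => thetaSeries 0 τ z) atImInfty (𝓝 1) := by
  have := tendsto_tsum_thetaTerm_zero (fun _ => 1) z
    (by simpa using (summable_thetaTerm 0 I_im_pos z).norm)
  simpa [thetaSeries] using this

theorem tendsto_thetaSeries_one (z : ℂ) :
    Tendsto (fun τ : ℍ => thetaSeries 1 τ z) atImInfty
      (𝓝 (exp (2 * Real.pi * I * z) + exp (-(2 * Real.pi * I * z)))) := by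
  have := tendsto_tsum_thetaTerm_one (fun _ => 1) z
    (by simpa using (summable_thetaTerm 1 I_im_pos z).norm)
  simpa [thetaSeries] using this

theorem tendsto_thetaSecond_zero :
    Tendsto (fun τ : ℍ => thetaSecond 0 τ) atImInfty (𝓝 0) := by
  have := tendsto_tsum_thetaTerm_zero _ 0 (summable_sq_mul_thetaTerm 0 I_im_pos)
  simpa [thetaSecond] using this

theorem tendsto_thetaSecond_one :
    Tendsto (fun τ : ℍ => thetaSecond 1 τ) atImInfty (𝓝 (2 * (2 * Real.pi * I) ^ 2)) := by
  have := tendsto_tsum_thetaTerm_one _ 0 (summable_sq_mul_thetaTerm 1 I_im_pos)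
  have e : (2 * Real.pi * I * (2 * ((0 : ℤ) : ℂ) + (1 : ℤ))) ^ 2 * exp (2 * Real.pi * I * 0) +
      (2 * Real.pi * I * (2 * ((-1 : ℤ) : ℂ) + (1 : ℤ))) ^ 2 * exp (-(2 * Real.pi * I * 0)) =
      2 * (2 * Real.pi * I) ^ 2 := by
    simp only [mul_zero, neg_zero, exp_zero]
    push_cast
    ring
  rw [e] at this
  exact this

/-! ### Theta coefficients of functions of index one -/

/-- The theta coefficients of a function of index one. -/
def thetaCoeff (j : ℤ) (Φ : ℍ × ℂ → ℂ) (τ : ℍ) : ℂ := fiberCoeff (fun z => Φ (τ, z)) j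

section

variable {Φ : ℍ × ℂ → ℂ}

theorem eq_thetaCoeff (hΦ : ∀ τ : ℍ, IsThetaFunction 1 τ fun z => Φ (τ, z)) (τ : ℍ) (z : ℂ) :
    Φ (τ, z) =
      thetaCoeff 0 Φ τ * thetaSeries 0 τ z + thetaCoeff 1 Φ τ * thetaSeries 1 τ z :=
  (hΦ τ).eq_thetaSeries τ.im_pos z

theorem thetaCoeff_zero_eq (hΦ : ∀ τ : ℍ, IsThetaFunction 1 τ fun z => Φ (τ, z)) {τ : ℍ} {z : ℂ}
    (hz : thetaSeries 0 τ z ≠ 0) :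
    thetaCoeff 0 Φ τ = (Φ (τ, z) + Φ (τ, z + 1 / 2)) / (2 * thetaSeries 0 τ z) :=
  (hΦ τ).fiberCoeff_zero_eq τ.im_pos hz

theorem thetaCoeff_one_eq (hΦ : ∀ τ : ℍ, IsThetaFunction 1 τ fun z => Φ (τ, z)) {τ : ℍ} {z : ℂ}
    (hz : thetaSeries 1 τ z ≠ 0) :
    thetaCoeff 1 Φ τ = (Φ (τ, z) - Φ (τ, z + 1 / 2)) / (2 * thetaSeries 1 τ z) :=
  (hΦ τ).fiberCoeff_one_eq τ.im_pos hz

theorem differentiableOn_thetaSeries_left (j : ℤ) (z : ℂ) :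
    DifferentiableOn ℂ (fun τ => thetaSeries j τ z) {w | 0 < w.im} := fun τ hτ =>
  (DifferentiableAt.comp (g := fun w : ℂ × ℂ => thetaSeries j w.1 w.2) (f := fun τ => (τ, z)) τ
    (differentiableAt_thetaSeries j (w := (τ, z)) hτ)
    (differentiableAt_id.prodMk (differentiableAt_const z))).differentiableWithinAt

theorem isOpen_im_pos : IsOpen {w : ℂ | 0 < w.im} := isOpen_lt continuous_const Complex.continuous_im

theorem differentiableOn_thetaCoeff_zero
    (hΦ : ∀ τ : ℍ, IsThetaFunction 1 τ fun z => Φ (τ, z))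
    (hd : ∀ z, DifferentiableOn ℂ (fun w => Φ (ofComplex w, z)) {w | 0 < w.im}) :
    DifferentiableOn ℂ (fun w => thetaCoeff 0 Φ (ofComplex w)) {w | 0 < w.im} := by
  intro w hw
  obtain ⟨z, hz⟩ := exists_thetaSeries_ne_zero 0 (τ := w) hw
  have hn := isOpen_im_pos.mem_nhds hw
  have ht := (differentiableOn_thetaSeries_left 0 z).differentiableAt hn
  have h := (((hd z).differentiableAt hn).add ((hd (z + 1 / 2)).differentiableAt hn)).div
    (ht.const_mul 2) (mul_ne_zero two_ne_zero hz)
  refine (h.congr_of_eventuallyEq ?_).differentiableWithinAt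
  filter_upwards [hn, ht.continuousAt.eventually_ne hz] with v hv hv'
  have hv2 : ((ofComplex v : ℍ) : ℂ) = v := ofComplex_apply_of_im_pos hv ▸ rfl
  have := thetaCoeff_zero_eq hΦ (τ := ofComplex v) (z := z) (by rwa [hv2])
  rw [hv2] at this
  exact this

theorem differentiableOn_thetaCoeff_one
    (hΦ : ∀ τ : ℍ, IsThetaFunction 1 τ fun z => Φ (τ, z))
    (hd : ∀ z, DifferentiableOn ℂ (fun w => Φ (ofComplex w, z)) {w | 0 < w.im}) :
    DifferentiableOn ℂ (fun w => thetaCoeff 1 Φ (ofComplex w)) {w | 0 < w.im} := by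
  intro w hw
  obtain ⟨z, hz⟩ := exists_thetaSeries_ne_zero 1 (τ := w) hw
  have hn := isOpen_im_pos.mem_nhds hw
  have ht := (differentiableOn_thetaSeries_left 1 z).differentiableAt hn
  have h := (((hd z).differentiableAt hn).sub ((hd (z + 1 / 2)).differentiableAt hn)).div
    (ht.const_mul 2) (mul_ne_zero two_ne_zero hz)
  refine (h.congr_of_eventuallyEq ?_).differentiableWithinAt
  filter_upwards [hn, ht.continuousAt.eventually_ne hz] with v hv hv'
  have hv2 : ((ofComplex v : ℍ) : ℂ) = v := ofComplex_apply_of_im_pos hv ▸ rfl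
  have := thetaCoeff_one_eq hΦ (τ := ofComplex v) (z := z) (by rwa [hv2])
  rw [hv2] at this
  exact this

/-- The point `z = 0` may be used for all `τ` near the cusp, since there `θ₀(τ,0)` tends to 1; in
the odd component `θ₁(τ,0)` tends to 2, whence the denominator 4. -/
theorem tendsto_thetaCoeff_zero (hΦ : ∀ τ : ℍ, IsThetaFunction 1 τ fun z => Φ (τ, z)) {a b : ℂ}
    (ha : Tendsto (fun τ => Φ (τ, 0)) atImInfty (𝓝 a))
    (hb : Tendsto (fun τ => Φ (τ, 1 / 2)) atImInfty (𝓝 b)) :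
    Tendsto (thetaCoeff 0 Φ) atImInfty (𝓝 ((a + b) / 2)) := by
  have ht := tendsto_thetaSeries_zero 0
  have h := (ha.add hb).div (ht.const_mul 2) (by norm_num)
  rw [mul_one] at h
  refine h.congr' ?_
  filter_upwards [ht.eventually_ne one_ne_zero] with τ hτ
  simpa using (thetaCoeff_zero_eq hΦ hτ).symm

theorem tendsto_thetaCoeff_one (hΦ : ∀ τ : ℍ, IsThetaFunction 1 τ fun z => Φ (τ, z)) {a b : ℂ}
    (ha : Tendsto (fun τ => Φ (τ, 0)) atImInfty (𝓝 a))
    (hb : Tendsto (fun τ => Φ (τ, 1 / 2)) atImInfty (𝓝 b)) :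
    Tendsto (thetaCoeff 1 Φ) atImInfty (𝓝 ((a - b) / 4)) := by
  have ht := tendsto_thetaSeries_one 0
  simp only [mul_zero, neg_zero, exp_zero] at ht
  have h := (ha.sub hb).div (ht.const_mul 2) (by norm_num)
  rw [show (2 : ℂ) * (1 + 1) = 4 by norm_num] at h
  refine h.congr' ?_
  filter_upwards [ht.eventually_ne (by norm_num : (1 + 1 : ℂ) ≠ 0)] with τ hτ
  simpa using (thetaCoeff_one_eq hΦ hτ).symm

theorem deriv_deriv_eq_thetaCoeff (hΦ : ∀ τ : ℍ, IsThetaFunction 1 τ fun z => Φ (τ, z)) (τ : ℍ) :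
    deriv (deriv fun z => Φ (τ, z)) 0 =
      thetaCoeff 0 Φ τ * thetaSecond 0 τ + thetaCoeff 1 Φ τ * thetaSecond 1 τ := by
  have h0 := (isThetaFunction_thetaSeries 0 τ.im_pos).diff
  have h1 := (isThetaFunction_thetaSeries 1 τ.im_pos).diff
  rw [show (fun z => Φ (τ, z)) = fun z => thetaCoeff 0 Φ τ * thetaSeries 0 τ z +
    thetaCoeff 1 Φ τ * thetaSeries 1 τ z from funext (eq_thetaCoeff hΦ τ)]
  have e : (deriv fun z => thetaCoeff 0 Φ τ * thetaSeries 0 τ z +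
      thetaCoeff 1 Φ τ * thetaSeries 1 τ z) = fun z =>
      thetaCoeff 0 Φ τ * deriv (thetaSeries 0 τ) z +
        thetaCoeff 1 Φ τ * deriv (thetaSeries 1 τ) z := by
    funext z
    exact (((h0 z).hasDerivAt.const_mul _).add ((h1 z).hasDerivAt.const_mul _)).deriv
  have d0 : Differentiable ℂ (deriv (thetaSeries 0 τ)) := fun z =>
    (h0.differentiableOn.deriv isOpen_univ).differentiableAt Filter.univ_mem
  have d1 : Differentiable ℂ (deriv (thetaSeries 1 τ)) := fun z =>
    (h1.differentiableOn.deriv isOpen_univ).differentiableAt Filter.univ_mem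
  rw [e, ← deriv_deriv_thetaSeries 0 τ.im_pos, ← deriv_deriv_thetaSeries 1 τ.im_pos]
  exact (((d0 0).hasDerivAt.const_mul _).add ((d1 0).hasDerivAt.const_mul _)).deriv

end

/-! ### Jacobi-Eisenstein series of index one -/

/-- The terms of the Jacobi-Eisenstein series of index one, for a matrix `(a, b; c, d)`. -/
def jacobiTerm (k a b c d l : ℤ) (τ z : ℂ) : ℂ :=
  (c * τ + d) ^ (-k) * exp (2 * Real.pi * I * (l ^ 2 * ((a * τ + b) / (c * τ + d)) +
    2 * l * z / (c * τ + d) - c * z ^ 2 / (c * τ + d)))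

theorem linear_ne_zero {a b c d : ℤ} (h : a * d - b * c = 1) {τ : ℂ} (hτ : 0 < τ.im) :
    (c * τ + d : ℂ) ≠ 0 := by
  intro h0
  have him := congrArg Complex.im h0
  simp only [add_im, mul_im, intCast_re, intCast_im, zero_mul, add_zero, zero_im,
    mul_eq_zero, Int.cast_eq_zero, hτ.ne', or_false] at him
  have hre := congrArg Complex.re h0
  simp only [him, Int.cast_zero, zero_mul, zero_add, intCast_re, zero_re, Int.cast_eq_zero] at hre
  simp [him, hre] at h

/-! ### Convergence of the Jacobi-Eisenstein series. -/

theorem moebius_im {a b c d : ℤ} (h : a * d - b * c = 1) (τ : ℂ) :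
    ((a * τ + b) / (c * τ + d) : ℂ).im = τ.im / ‖(c * τ + d : ℂ)‖ ^ 2 := by
  have h' : (a * d - b * c : ℝ) = 1 := by exact_mod_cast h
  rw [div_im, ← normSq_eq_norm_sq]
  simp only [add_im, mul_im, add_re, mul_re, intCast_re, intCast_im, zero_mul, add_zero, sub_zero]
  rw [← sub_div]
  congr 1
  linear_combination τ.im * h'

/-- With `y = Im τ` and `s = |cτ + d|`, half of the decay `l² y / s²` absorbs the linear term by
completing a square, at the cost `2|z|²/y`. As `|c| y ≤ s`, the quadratic term costs another
`|z|²/y`; the factor `2π` makes this `6π|z|²/y`. -/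
theorem norm_jacobiTerm_le {a b c d : ℤ} (h : a * d - b * c = 1) (k l : ℤ) {τ : ℂ}
    (hτ : 0 < τ.im) (z : ℂ) :
    ‖jacobiTerm k a b c d l τ z‖ ≤ ‖(c * τ + d : ℂ)‖ ^ (-k) *
      (Real.exp (6 * Real.pi * (‖z‖ ^ 2 / τ.im)) *
        Real.exp (-(Real.pi * τ.im * (l ^ 2 / ‖(c * τ + d : ℂ)‖ ^ 2)))) := by
  have hj := linear_ne_zero h hτ
  set j : ℂ := c * τ + d with hjdef
  set s := ‖j‖
  set y := τ.im
  have hs : 0 < s := norm_pos_iff.2 hj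
  rw [jacobiTerm, norm_mul, norm_zpow]
  refine mul_le_mul_of_nonneg_left ?_ (by positivity)
  rw [norm_exp, ← Real.exp_add, Real.exp_le_exp]
  set X : ℂ := l ^ 2 * ((a * τ + b) / j) + 2 * l * z / j - c * z ^ 2 / j
  have hre : (2 * Real.pi * I * X).re = -(2 * Real.pi * X.im) := by
    rw [show 2 * (Real.pi : ℂ) * I * X = ((2 * Real.pi : ℝ) : ℂ) * (I * X) by push_cast; ring,
      re_ofReal_mul, I_mul_re]
    ring
  have hX : X.im = l ^ 2 * (y / s ^ 2) + (2 * l * z / j).im - (c * z ^ 2 / j).im := by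
    rw [sub_im, add_im, ← moebius_im h τ]
    congr 2
    rw [show ((l : ℂ) ^ 2) = ((l ^ 2 : ℝ) : ℂ) by push_cast; rfl, im_ofReal_mul]
  have h1 : -(2 * |(l : ℝ)| * ‖z‖ / s) ≤ (2 * l * z / j).im := by
    refine (neg_le_neg ?_).trans (neg_le_of_abs_le (abs_im_le_norm _))
    simp [s]
  have h2 : (c * z ^ 2 / j).im ≤ ‖z‖ ^ 2 / y := by
    refine (le_abs_self _).trans ((abs_im_le_norm _).trans ?_)
    rw [norm_div, norm_mul, norm_pow, norm_intCast, div_le_div_iff₀ hs hτ]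
    have : |(c : ℝ)| * y ≤ s := by
      have := abs_im_le_norm j
      rw [hjdef] at this
      simp only [add_im, mul_im, intCast_re, intCast_im, zero_mul, add_zero, abs_mul] at this
      rwa [abs_of_pos hτ] at this
    calc |(c : ℝ)| * ‖z‖ ^ 2 * y = ‖z‖ ^ 2 * (|(c : ℝ)| * y) := by ring
      _ ≤ _ := mul_le_mul_of_nonneg_left this (by positivity)
  have h3 : 2 * |(l : ℝ)| * ‖z‖ / s ≤ y * (l ^ 2 / s ^ 2) / 2 + 2 * (‖z‖ ^ 2 / y) := by
    have : y * (l ^ 2 / s ^ 2) / 2 + 2 * (‖z‖ ^ 2 / y) - 2 * |(l : ℝ)| * ‖z‖ / s =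
        (y * |(l : ℝ)| / s - 2 * ‖z‖) ^ 2 / (2 * y) := by
      rw [← sq_abs (l : ℝ)]
      field_simp
      ring
    have h4 : 0 ≤ (y * |(l : ℝ)| / s - 2 * ‖z‖) ^ 2 / (2 * y) := by positivity
    linarith
  rw [hre, hX]
  have h5 : (l : ℝ) ^ 2 * (y / s ^ 2) = y * (l ^ 2 / s ^ 2) := by ring
  have h6 : Real.pi * (-(2 * (y * (l ^ 2 / s ^ 2) + (2 * l * z / j).im - (c * z ^ 2 / j).im))) ≤
      Real.pi * (6 * (‖z‖ ^ 2 / y) - y * (l ^ 2 / s ^ 2)) :=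
    mul_le_mul_of_nonneg_left (by linarith) Real.pi_pos.le
  rw [h5]
  linarith

/-- With `x` proportional to `l²/s²`, the exponent `3/4` yields `|l|^(-3/2) s^(3/2)`: summable over
`l`, while `s^(3/2 - k)` with `k ≥ 4` is still summable over `(c, d)`. -/
theorem exp_neg_le_rpow {x : ℝ} (hx : 0 < x) : Real.exp (-x) ≤ x ^ (-(3 / 4) : ℝ) := by
  rw [Real.exp_neg, Real.rpow_neg hx.le]
  refine inv_anti₀ (by positivity) ?_
  rcases le_or_gt x 1 with h | h
  · exact (Real.rpow_le_one hx.le h (by norm_num)).trans (Real.one_le_exp hx.le)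
  · calc x ^ (3 / 4 : ℝ) ≤ x ^ (1 : ℝ) := Real.rpow_le_rpow_of_exponent_le h.le (by norm_num)
      _ = x := Real.rpow_one x
      _ ≤ Real.exp x := by linarith [Real.add_one_le_exp x]

/-- The indices of the Jacobi-Eisenstein series. -/
abbrev JacobiIndex : Type := {v : ℤ × ℤ // IsCoprime v.1 v.2} × ℤ

/-- The terms of the Jacobi-Eisenstein series, with the choice of a matrix made by Bézout
coefficients. -/
def eisensteinTerm (k : ℤ) (x : JacobiIndex) (τ z : ℂ) : ℂ :=
  jacobiTerm k (Int.gcdB x.1.1.1 x.1.1.2) (-Int.gcdA x.1.1.1 x.1.1.2) x.1.1.1 x.1.1.2 x.2 τ z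

theorem bezout_det {c d : ℤ} (h : IsCoprime c d) :
    Int.gcdB c d * d - -Int.gcdA c d * c = 1 := by
  have := Int.gcd_eq_gcd_ab c d
  rw [Int.isCoprime_iff_gcd_eq_one.1 h] at this
  push_cast at this
  linarith

theorem jacobiEisenstein_eq (k : ℤ) (p : ℍ × ℂ) :
    jacobiEisenstein k 1 p = 1 / 2 * ∑' x : JacobiIndex, eisensteinTerm k x p.1 p.2 := by
  simp [jacobiEisenstein, eisensteinTerm, jacobiTerm]

theorem one_le_norm_of_isCoprime {c d : ℤ} (h : IsCoprime c d) : 1 ≤ ‖![c, d]‖ := by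
  rw [EisensteinSeries.norm_eq_max_natAbs]
  by_contra! hlt
  have h0 : max c.natAbs d.natAbs = 0 := by
    have : ((max c.natAbs d.natAbs : ℕ) : ℝ) < 1 := by simpa using hlt
    exact Nat.lt_one_iff.1 (by exact_mod_cast this)
  have hc : c = 0 := by omega
  have hd : d = 0 := by omega
  rw [hc, hd, Int.isCoprime_iff_gcd_eq_one] at h
  exact absurd h (by decide)

theorem norm_rpow_linear_le {A B : ℝ} (hB : 0 < B) {τ : ℍ} (hτ : τ ∈ verticalStrip A B)
    {c d : ℤ} (h : IsCoprime c d) {κ : ℝ} (hκ : 5 / 2 ≤ κ) :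
    ‖(c * τ + d : ℂ)‖ ^ (-κ) ≤
      EisensteinSeries.r ⟨⟨A, B⟩, hB⟩ ^ (-κ) * ‖![c, d]‖ ^ (-(5 / 2) : ℝ) := by
  have := EisensteinSeries.summand_bound_of_mem_verticalStrip (k := κ) (by linarith) ![c, d] hB hτ
  refine (by simpa using this : _ ≤ _).trans (mul_le_mul_of_nonneg_left ?_ ?_)
  · exact Real.rpow_le_rpow_of_exponent_le (one_le_norm_of_isCoprime h) (by linarith)
  · exact Real.rpow_nonneg (EisensteinSeries.r_pos _).le _

theorem exists_eisensteinTerm_bound {k : ℤ} (hk : 4 ≤ k) (A : ℝ) {B : ℝ} (hB : 0 < B) (Z : ℝ) :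
    ∃ u : JacobiIndex → ℝ, Summable u ∧ ∀ x, ∀ τ : ℍ, τ ∈ verticalStrip A B → ∀ z : ℂ, ‖z‖ ≤ Z →
      ‖eisensteinTerm k x τ z‖ ≤ u x := by
  set ρ := EisensteinSeries.r ⟨⟨A, B⟩, hB⟩
  have hρ : 0 < ρ := EisensteinSeries.r_pos _
  have hkR : (4 : ℝ) ≤ k := by exact_mod_cast hk
  set κ := (k : ℝ)
  set K : ℝ := Real.exp (6 * Real.pi * (Z ^ 2 / B))
  set C : ℝ := ρ ^ (-κ) + (Real.pi * B) ^ (-(3 / 4) : ℝ) * ρ ^ (-(κ - 3 / 2))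
  -- The real power `0 ^ (-3/2)` is 0, so the second summand supplies the bound 1 at `l = 0`.
  let b : ℤ → ℝ := fun l => |(l : ℝ)| ^ (-(3 / 2) : ℝ) + if l = 0 then 1 else 0
  have hb0 : ∀ l, 0 ≤ b l := fun l => by positivity
  have hb : Summable b := (Real.summable_abs_int_rpow (by norm_num)).add
    (summable_of_ne_finset_zero (s := {0}) fun l hl => by simp at hl; simp [hl])
  have hn : Summable fun v : {v : ℤ × ℤ // IsCoprime v.1 v.2} =>
      ‖![v.1.1, v.1.2]‖ ^ (-(5 / 2) : ℝ) := by
    refine (EisensteinSeries.summable_one_div_norm_rpow (k := 5 / 2) (by norm_num)).comp_injective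
      (i := fun v : {v : ℤ × ℤ // IsCoprime v.1 v.2} => ![v.1.1, v.1.2]) ?_
    rintro ⟨⟨c, d⟩, _⟩ ⟨⟨c', d'⟩, _⟩ hv
    simpa [Matrix.vecCons_inj] using hv
  refine ⟨fun x => K * C * (‖![x.1.1.1, x.1.1.2]‖ ^ (-(5 / 2) : ℝ) * b x.2),
    (hn.mul_of_nonneg hb (fun v => by positivity) hb0).mul_left _, ?_⟩
  rintro ⟨⟨⟨c, d⟩, hcd⟩, l⟩ τ hτ z hz
  have hBτ : B ≤ (τ : ℂ).im := hτ.2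
  have hcd' : IsCoprime c d := hcd
  have hj := linear_ne_zero (bezout_det hcd') τ.im_pos
  have hbd := norm_jacobiTerm_le (bezout_det hcd') k l τ.im_pos z
  set s := ‖(c * τ + d : ℂ)‖ with hsdef
  have hs : 0 < s := norm_pos_iff.2 hj
  set N := ‖![c, d]‖ ^ (-(5 / 2) : ℝ)
  have hN : 0 ≤ N := by positivity
  have hZ : Real.exp (6 * Real.pi * (‖z‖ ^ 2 / (τ : ℂ).im)) ≤ K := by
    refine Real.exp_le_exp.2 (mul_le_mul_of_nonneg_left ?_ (by positivity))
    exact div_le_div₀ (by positivity) (pow_le_pow_left₀ (norm_nonneg _) hz 2) hB hBτ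
  have key : s ^ (-k) * Real.exp (-(Real.pi * (τ : ℂ).im * (l ^ 2 / s ^ 2))) ≤ C * (N * b l) := by
    have hsk : s ^ (-k) = s ^ (-κ) := by
      rw [← Real.rpow_intCast]
      push_cast
      rfl
    by_cases hl : l = 0
    · subst hl
      have h1 := norm_rpow_linear_le hB hτ hcd' (κ := κ) (by linarith)
      have hb1 : b 0 = 1 := by simp [b]
      rw [hb1, mul_one, hsk]
      simp only [Int.cast_zero, ne_eq, OfNat.ofNat_ne_zero, not_false_eq_true, zero_pow, zero_div,
        mul_zero, neg_zero, Real.exp_zero, mul_one]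
      refine h1.trans (mul_le_mul_of_nonneg_right ?_ hN)
      exact le_add_of_nonneg_right (by positivity)
    · have hl' : 0 < |(l : ℝ)| := abs_pos.2 (by exact_mod_cast hl)
      have hb1 : b l = |(l : ℝ)| ^ (-(3 / 2) : ℝ) := by simp [b, hl]
      have h1 := norm_rpow_linear_le hB hτ hcd' (κ := κ - 3 / 2) (by linarith)
      have hx : 0 < Real.pi * B * (|(l : ℝ)| ^ 2 / s ^ 2) := by positivity
      have h2 : Real.exp (-(Real.pi * (τ : ℂ).im * (l ^ 2 / s ^ 2))) ≤
          (Real.pi * B) ^ (-(3 / 4) : ℝ) * (|(l : ℝ)| ^ (-(3 / 2) : ℝ) * s ^ (3 / 2 : ℝ)) := by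
        calc _ ≤ Real.exp (-(Real.pi * B * (|(l : ℝ)| ^ 2 / s ^ 2))) := by
              rw [sq_abs, Real.exp_le_exp, neg_le_neg_iff]
              gcongr
          _ ≤ _ := exp_neg_le_rpow hx
          _ = _ := by
              have e : ((2 : ℕ) : ℝ) * -(3 / 4) = -(3 / 2) := by norm_num
              rw [Real.mul_rpow (by positivity) (by positivity), ← div_pow,
                ← Real.rpow_natCast, ← Real.rpow_mul (by positivity), e,
                Real.div_rpow hl'.le hs.le, Real.rpow_neg hs.le (3 / 2), div_inv_eq_mul]
      calc _ ≤ s ^ (-κ) * ((Real.pi * B) ^ (-(3 / 4) : ℝ) *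
            (|(l : ℝ)| ^ (-(3 / 2) : ℝ) * s ^ (3 / 2 : ℝ))) := by
            rw [hsk]
            exact mul_le_mul_of_nonneg_left h2 (by positivity)
        _ = (Real.pi * B) ^ (-(3 / 4) : ℝ) * (s ^ (-(κ - 3 / 2)) * |(l : ℝ)| ^ (-(3 / 2) : ℝ)) := by
            rw [show -(κ - 3 / 2) = -κ + 3 / 2 by ring, Real.rpow_add hs]
            ring
        _ ≤ (Real.pi * B) ^ (-(3 / 4) : ℝ) *
            ((ρ ^ (-(κ - 3 / 2)) * N) * |(l : ℝ)| ^ (-(3 / 2) : ℝ)) := by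
            refine mul_le_mul_of_nonneg_left (mul_le_mul_of_nonneg_right h1 ?_) ?_ <;> positivity
        _ = (Real.pi * B) ^ (-(3 / 4) : ℝ) * ρ ^ (-(κ - 3 / 2)) * (N * b l) := by
            rw [hb1]
            ring
        _ ≤ _ := by
            refine mul_le_mul_of_nonneg_right ?_ (mul_nonneg hN (hb0 l))
            exact le_add_of_nonneg_left (by positivity)
  calc ‖eisensteinTerm k (⟨(c, d), hcd⟩, l) τ z‖ ≤ _ := hbd
    _ = Real.exp (6 * Real.pi * (‖z‖ ^ 2 / (τ : ℂ).im)) *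
        (s ^ (-k) * Real.exp (-(Real.pi * (τ : ℂ).im * (l ^ 2 / s ^ 2)))) := by ring
    _ ≤ K * (C * (N * b l)) := mul_le_mul hZ key (by positivity) (by positivity)
    _ = _ := by ring

/-! ### Transformation laws of the Jacobi-Eisenstein series. -/

theorem exp_eq_of_sub_int {x y : ℂ} (n : ℤ) (h : x = y + n) :
    exp (2 * Real.pi * I * x) = exp (2 * Real.pi * I * y) := by
  rw [h, mul_add, exp_add, exp_two_pi_mul_int, mul_one]

/-- Two choices of `(a, b)` differ by a multiple of `(c, d)`, which moves `(aτ + b)/(cτ + d)` by an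
integer. -/
theorem jacobiTerm_congr {a b a' b' c d : ℤ} (h : a * d - b * c = 1) (h' : a' * d - b' * c = 1)
    (k l : ℤ) {τ : ℂ} (hτ : 0 < τ.im) (z : ℂ) :
    jacobiTerm k a' b' c d l τ z = jacobiTerm k a b c d l τ z := by
  have hj := linear_ne_zero h hτ
  have hC : (a * d - b * c : ℂ) = 1 := by exact_mod_cast h
  have hC' : (a' * d - b' * c : ℂ) = 1 := by exact_mod_cast h'
  rw [jacobiTerm, jacobiTerm]
  congr 1
  refine exp_eq_of_sub_int (l ^ 2 * (b' * a - a' * b)) ?_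
  simp only [div_eq_mul_inv]
  have hij := mul_inv_cancel₀ hj
  set i := (c * τ + d : ℂ)⁻¹
  push_cast
  linear_combination (l ^ 2 * i) * ((-a' * τ - b') * hC + (a * τ + b) * hC') +
    l ^ 2 * (b' * a - a' * b) * hij

/-- The lattice acts on the summands by translating `l`; the remaining difference of exponents is an
integer. -/
theorem jacobiTerm_lattice {a b c d : ℤ} (h : a * d - b * c = 1) (k l L U : ℤ) {τ : ℂ}
    (hτ : 0 < τ.im) (z : ℂ) :
    exp (2 * Real.pi * I * (L ^ 2 * τ + 2 * L * z)) * jacobiTerm k a b c d l τ (z + L * τ + U) =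
      jacobiTerm k a b c d (l + (L * d - U * c)) τ z := by
  have hj := linear_ne_zero h hτ
  have hC : (a * d - b * c : ℂ) = 1 := by exact_mod_cast h
  rw [jacobiTerm, jacobiTerm, mul_left_comm, ← exp_add, ← mul_add]
  congr 1
  refine exp_eq_of_sub_int (2 * l * (-L * b + U * a) +
    (-a * c * U ^ 2 - b * d * L ^ 2 + 2 * b * c * L * U)) ?_
  simp only [div_eq_mul_inv]
  have hij := mul_inv_cancel₀ hj
  set i := (c * τ + d : ℂ)⁻¹
  push_cast
  linear_combination (-(2 * l * (L * τ + U) + τ * (L ^ 2 * d - 2 * c * L * U) - c * U ^ 2) * i) * hC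
    - (L ^ 2 * τ + 2 * L * z - (2 * l * (-L * b + U * a) +
      (-a * c * U ^ 2 - b * d * L ^ 2 + 2 * b * c * L * U))) * hij

/-- The slash action multiplies the matrix of a summand on the right: this is the cocycle relation
for `cτ + d` together with the one for the Gaussian factor. -/
theorem jacobiTerm_slash {a b c d a' b' c' d' : ℤ} (h : a * d - b * c = 1)
    (h' : a' * d' - b' * c' = 1) (k l : ℤ) {τ : ℂ} (hτ : 0 < τ.im) (z : ℂ) :
    (c' * τ + d') ^ (-k) * exp (-(2 * Real.pi * I * (c' * z ^ 2) / (c' * τ + d'))) *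
      jacobiTerm k a b c d l ((a' * τ + b') / (c' * τ + d')) (z / (c' * τ + d')) =
    jacobiTerm k (a * a' + b * c') (a * b' + b * d') (c * a' + d * c') (c * b' + d * d') l τ z := by
  have hC : (a * d - b * c : ℂ) = 1 := by exact_mod_cast h
  have hC' : (a' * d' - b' * c' : ℂ) = 1 := by exact_mod_cast h'
  have hdet : (a * a' + b * c') * (c * b' + d * d') - (a * b' + b * d') * (c * a' + d * c') = 1 := by
    linear_combination (a' * d' - b' * c') * h + h'
  have hj := linear_ne_zero h' hτ
  have hJ := linear_ne_zero hdet hτ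
  rw [jacobiTerm, jacobiTerm]
  push_cast at hJ ⊢
  set j : ℂ := c' * τ + d' with hjdef
  set J : ℂ := (c * a' + d * c') * τ + (c * b' + d * d') with hJdef
  have e1 : (c * ((a' * τ + b') / j) + d : ℂ) = J / j := by
    rw [eq_div_iff hj, add_mul, mul_assoc, div_mul_cancel₀ _ hj]
    ring
  have e2 : (a * ((a' * τ + b') / j) + b : ℂ) =
      ((a * a' + b * c') * τ + (a * b' + b * d')) / j := by
    rw [eq_div_iff hj, add_mul, mul_assoc, div_mul_cancel₀ _ hj]
    ring
  rw [e1, e2, div_div_div_cancel_right₀ hj]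
  rw [mul_mul_mul_comm, ← mul_zpow, mul_div_cancel₀ _ hj, ← exp_add]
  congr 2
  have e3 : 2 * l * (z / j) / (J / j) = 2 * l * z / J := by
    field_simp
  have e4 : c * (z / j) ^ 2 / (J / j) + c' * z ^ 2 / j = (c * a' + d * c') * z ^ 2 / J := by
    have : (c + c' * J : ℂ) = (c * a' + d * c') * j := by
      rw [hJdef, hjdef]
      linear_combination (-c : ℂ) * hC'
    rw [show c * (z / j) ^ 2 / (J / j) + c' * z ^ 2 / j = (c + c' * J) * z ^ 2 / (j * J) by
      field_simp, this]
    field_simp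
  rw [e3, ← e4]
  ring

theorem eisensteinTerm_eq (k : ℤ) {a b c d : ℤ} (hcd : IsCoprime c d) (h : a * d - b * c = 1)
    (l : ℤ) {τ : ℂ} (hτ : 0 < τ.im) (z : ℂ) :
    eisensteinTerm k (⟨(c, d), hcd⟩, l) τ z = jacobiTerm k a b c d l τ z :=
  jacobiTerm_congr h (bezout_det hcd) k l hτ z

theorem differentiable_eisensteinTerm (k : ℤ) (x : JacobiIndex) (τ : ℂ) :
    Differentiable ℂ (eisensteinTerm k x τ) := by
  unfold eisensteinTerm jacobiTerm
  fun_prop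

theorem differentiableAt_eisensteinTerm_left (k : ℤ) (x : JacobiIndex) {τ : ℂ} (hτ : 0 < τ.im)
    (z : ℂ) : DifferentiableAt ℂ (fun τ => eisensteinTerm k x τ z) τ := by
  have hj := linear_ne_zero (bezout_det x.1.2) hτ
  unfold eisensteinTerm jacobiTerm
  have h1 : DifferentiableAt ℂ (fun τ : ℂ => (x.1.1.1 * τ + x.1.1.2 : ℂ)) τ := by fun_prop
  refine (h1.zpow (Or.inl hj)).mul (DifferentiableAt.cexp (DifferentiableAt.const_mul ?_ _))
  refine (((DifferentiableAt.div ?_ h1 hj).const_mul _).add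
    (DifferentiableAt.div ?_ h1 hj)).sub (DifferentiableAt.div ?_ h1 hj) <;> fun_prop

theorem jacobiEisenstein_lattice (k L U : ℤ) (τ : ℍ) (z : ℂ) :
    exp (2 * Real.pi * I * (L ^ 2 * τ + 2 * L * z)) *
      jacobiEisenstein k 1 (τ, z + L * τ + U) = jacobiEisenstein k 1 (τ, z) := by
  rw [jacobiEisenstein_eq, jacobiEisenstein_eq, mul_left_comm, ← tsum_mul_left]
  congr 1
  let e : JacobiIndex ≃ JacobiIndex := (Equiv.refl _).prodShear
    fun v => Equiv.addRight (L * v.1.2 - U * v.1.1)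
  have key : ∀ x : JacobiIndex, exp (2 * Real.pi * I * (L ^ 2 * τ + 2 * L * z)) *
      eisensteinTerm k x τ (z + L * τ + U) = eisensteinTerm k (e x) τ z := fun x =>
    jacobiTerm_lattice (bezout_det x.1.2) k x.2 L U τ.im_pos z
  rw [tsum_congr key]
  exact e.tsum_eq fun x => eisensteinTerm k x τ z

theorem isThetaFunction_jacobiEisenstein {k : ℤ} (hk : 4 ≤ k) (τ : ℍ) :
    IsThetaFunction 1 τ fun z => jacobiEisenstein k 1 (τ, z) := by
  refine ⟨fun z => ?_, fun z => ?_, fun z => ?_⟩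
  · obtain ⟨u, hu, hb⟩ := exists_eisensteinTerm_bound hk |τ.re| τ.im_pos (‖z‖ + 1)
    have hmem : z ∈ Metric.ball (0 : ℂ) (‖z‖ + 1) := by simp
    have := differentiableOn_tsum_of_summable_norm (F := fun x => eisensteinTerm k x τ) hu
      (fun x => (differentiable_eisensteinTerm k x τ).differentiableOn) Metric.isOpen_ball
      (fun x w hw => hb x τ ⟨le_rfl, le_rfl⟩ w (mem_ball_zero_iff.1 hw).le)
    simp only [jacobiEisenstein_eq]
    exact (this.differentiableAt (Metric.isOpen_ball.mem_nhds hmem)).const_mul _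
  · have := jacobiEisenstein_lattice k 0 1 τ z
    simpa using this
  · have := jacobiEisenstein_lattice k 1 0 τ z
    simp only [Int.cast_one, one_pow, one_mul, mul_one, Int.cast_zero, add_zero] at this
    rw [← this, ← mul_assoc, ← exp_add, Nat.cast_one, mul_one, neg_add_cancel, exp_zero, one_mul]

theorem differentiableOn_jacobiEisenstein {k : ℤ} (hk : 4 ≤ k) (z : ℂ) :
    DifferentiableOn ℂ (fun w => jacobiEisenstein k 1 (ofComplex w, z)) {w | 0 < w.im} := by
  intro τ hτ
  have hτ' : 0 < τ.im := hτ
  obtain ⟨u, hu, hb⟩ := exists_eisensteinTerm_bound hk (|τ.re| + 1) (half_pos hτ') ‖z‖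
  set U : Set ℂ := {w | |w.re| < |τ.re| + 1 ∧ τ.im / 2 < w.im}
  have hU : IsOpen U := (isOpen_lt (Complex.continuous_re.abs) continuous_const).inter
    (isOpen_lt continuous_const Complex.continuous_im)
  have hmem : τ ∈ U := ⟨by linarith, by linarith⟩
  have hpos : ∀ w ∈ U, 0 < w.im := fun w hw => (half_pos hτ').trans hw.2
  have := differentiableOn_tsum_of_summable_norm (F := fun x τ => eisensteinTerm k x τ z) hu
    (fun x w hw => (differentiableAt_eisensteinTerm_left k x (hpos w hw) z).differentiableWithinAt)
    hU (fun x w hw => hb x ⟨w, hpos w hw⟩ ⟨hw.1.le, hw.2.le⟩ z le_rfl)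
  have h2 := ((this.differentiableAt (hU.mem_nhds hmem)).const_mul (1 / 2 : ℂ))
  refine (h2.congr_of_eventuallyEq ?_).differentiableWithinAt
  filter_upwards [hU.mem_nhds hmem] with w hw
  rw [jacobiEisenstein_eq, ofComplex_apply_of_im_pos (hpos w hw)]

theorem det_eq_one (γ : SL(2, ℤ)) : γ 0 0 * γ 1 1 - γ 0 1 * γ 1 0 = 1 := by
  rw [← Matrix.det_fin_two]
  exact γ.det_coe

theorem coe_smul_eq (γ : SL(2, ℤ)) (τ : ℍ) :
    ((γ • τ : ℍ) : ℂ) = (γ 0 0 * τ + γ 0 1) / (γ 1 0 * τ + γ 1 1) := by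
  rw [UpperHalfPlane.coe_specialLinearGroup_apply]
  simp

theorem isCoprime_mul_right {a b c d c' d' : ℤ} (h : a * d - b * c = 1) (hv : IsCoprime c' d') :
    IsCoprime (c' * a + d' * c) (c' * b + d' * d) := by
  obtain ⟨x, y, hxy⟩ := hv
  exact ⟨x * d - y * b, y * a - x * c, by linear_combination (x * c' + y * d') * h + hxy⟩

/-- The permutation of coprime pairs given by an element of `SL(2, ℤ)`. -/
def coprimeEquiv (γ : SL(2, ℤ)) :
    {v : ℤ × ℤ // IsCoprime v.1 v.2} ≃ {v : ℤ × ℤ // IsCoprime v.1 v.2} where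
  toFun v := ⟨(v.1.1 * γ 0 0 + v.1.2 * γ 1 0, v.1.1 * γ 0 1 + v.1.2 * γ 1 1),
    isCoprime_mul_right (det_eq_one γ) v.2⟩
  invFun v := ⟨(v.1.1 * γ 1 1 + v.1.2 * -γ 1 0, v.1.1 * -γ 0 1 + v.1.2 * γ 0 0),
    isCoprime_mul_right (by linear_combination det_eq_one γ) v.2⟩
  left_inv v := by
    have := det_eq_one γ
    ext
    · simp only
      linear_combination v.1.1 * this
    · simp only
      linear_combination v.1.2 * this
  right_inv v := by
    have := det_eq_one γ
    ext
    · simp only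
      linear_combination v.1.1 * this
    · simp only
      linear_combination v.1.2 * this

/-- Right multiplication permutes the coprime pairs. The product matrix need not be the Bézout
choice for the new pair, but `eisensteinTerm_eq` makes this immaterial. -/
theorem modularSlash_jacobiEisenstein (k : ℤ) (γ : SL(2, ℤ)) :
    modularSlash k 1 γ (jacobiEisenstein k 1) = jacobiEisenstein k 1 := by
  ext ⟨τ, z⟩
  rw [modularSlash, jacobiEisenstein_eq, jacobiEisenstein_eq, mul_left_comm, ← tsum_mul_left]
  congr 1
  refine (tsum_congr fun x => ?_).trans
    (Equiv.tsum_eq ((coprimeEquiv γ).prodCongr (Equiv.refl ℤ)) fun x => eisensteinTerm k x τ z)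
  have h := jacobiTerm_slash (bezout_det x.1.2) (det_eq_one γ) k x.2 τ.im_pos z
  rw [Nat.cast_one, mul_one, coe_smul_eq]
  refine h.trans ?_
  refine (eisensteinTerm_eq k (isCoprime_mul_right (det_eq_one γ) x.1.2) ?_ x.2 τ.im_pos z).symm
  linear_combination (γ 0 0 * γ 1 1 - γ 0 1 * γ 1 0) * bezout_det x.1.2 + det_eq_one γ

section

open Derivative
open MvPolynomial (IsWeightedHomogeneous)

/-! ### The behaviour of the Jacobi-Eisenstein series at infinity -/

theorem tendsto_im_atImInfty : Tendsto UpperHalfPlane.im atImInfty atTop := tendsto_comap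

/-- If `c = 0`, then `|d| = 1` and the terms with `l ≠ 0` decay exponentially. If `c ≠ 0`, then `|cτ
+ d| ≥ Im τ` gives decay of order `k`. -/
theorem tendsto_jacobiTerm_zero {a b c d : ℤ} (h : a * d - b * c = 1) {k l : ℤ} (hk : 0 < k)
    (hcl : c ≠ 0 ∨ l ≠ 0) (z : ℂ) :
    Tendsto (fun τ : ℍ => jacobiTerm k a b c d l τ z) atImInfty (𝓝 0) := by
  set K := Real.exp (6 * Real.pi * ‖z‖ ^ 2)
  have hK : ∀ τ : ℍ, 1 ≤ τ.im → Real.exp (6 * Real.pi * (‖z‖ ^ 2 / (τ : ℂ).im)) ≤ K := fun τ hτ => by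
    refine Real.exp_le_exp.2 (mul_le_mul_of_nonneg_left ?_ (by positivity))
    exact div_le_self (by positivity) hτ
  by_cases hc : c = 0
  · have hl : l ≠ 0 := hcl.resolve_left (not_not.2 hc)
    have hd : |(d : ℝ)| = 1 := by
      rw [hc, mul_zero, sub_zero] at h
      have : |d| = 1 := by
        rcases Int.isUnit_iff.1 (IsUnit.of_mul_eq_one_right a h) with h | h <;> simp [h]
      exact_mod_cast this
    have hlim : Tendsto (fun τ : ℍ => K * Real.exp (-(Real.pi * τ.im))) atImInfty (𝓝 0) := by
      rw [← mul_zero K]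
      refine (Real.tendsto_exp_atBot.comp (tendsto_neg_atTop_atBot.comp ?_)).const_mul K
      exact tendsto_im_atImInfty.const_mul_atTop Real.pi_pos
    refine squeeze_zero_norm' ?_ hlim
    filter_upwards [tendsto_im_atImInfty.eventually_ge_atTop 1] with τ hτ
    refine (norm_jacobiTerm_le h k l τ.im_pos z).trans ?_
    rw [hc]
    simp only [Int.cast_zero, zero_mul, zero_add, norm_intCast, hd, one_zpow, one_mul, one_pow,
      div_one]
    refine mul_le_mul (hK τ hτ) (Real.exp_le_exp.2 (neg_le_neg ?_)) (Real.exp_pos _).le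
      (Real.exp_pos _).le
    have hl1 : (1 : ℝ) ≤ (l : ℝ) ^ 2 := by
      exact_mod_cast (one_le_sq_iff_one_le_abs l).2 (Int.one_le_abs hl)
    exact le_mul_of_one_le_right (mul_pos Real.pi_pos τ.im_pos).le hl1
  · have hlim : Tendsto (fun τ : ℍ => τ.im ^ (-k) * K) atImInfty (𝓝 0) := by
      rw [← zero_mul K]
      exact ((tendsto_zpow_atTop_zero (neg_lt_zero.2 hk)).comp tendsto_im_atImInfty).mul_const K
    refine squeeze_zero_norm' ?_ hlim
    filter_upwards [tendsto_im_atImInfty.eventually_ge_atTop 1] with τ hτ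
    refine (norm_jacobiTerm_le h k l τ.im_pos z).trans ?_
    have hs : τ.im ≤ ‖(c * τ + d : ℂ)‖ := by
      refine le_trans ?_ (abs_im_le_norm _)
      simp only [add_im, mul_im, intCast_re, intCast_im, zero_mul, add_zero, abs_mul, coe_im,
        abs_of_pos τ.im_pos]
      refine le_mul_of_one_le_left τ.im_pos.le ?_
      exact_mod_cast Int.one_le_abs hc
    refine mul_le_mul ?_ ?_ (by positivity) (by have := τ.im_pos; positivity)
    · rw [zpow_neg, zpow_neg]
      exact inv_anti₀ (zpow_pos τ.im_pos _) (zpow_le_zpow_left₀ hk.le τ.im_pos.le hs)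
    · refine (mul_le_of_le_one_right (Real.exp_pos _).le ?_).trans (hK τ hτ)
      rw [Real.exp_le_one_iff, neg_nonpos]
      have := τ.im_pos
      rw [coe_im]
      positivity

/-- The summable bound for the Eisenstein terms is uniform only on vertical strips; periodicity
reduces the limit to such a strip. -/
theorem tendsto_atImInfty_of_periodic {α : Type*} {f : ℍ → α} {l : Filter α}
    (hper : ∀ (n : ℤ) (τ : ℍ), f ((n : ℝ) +ᵥ τ) = f τ)
    (h : Tendsto f (atImInfty ⊓ 𝓟 {τ | |τ.re| ≤ 1}) l) : Tendsto f atImInfty l := by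
  intro s hs
  have h1 := h hs
  rw [Filter.mem_map, mem_inf_principal, atImInfty_mem] at h1
  obtain ⟨A, hA⟩ := h1
  rw [Filter.mem_map, atImInfty_mem]
  refine ⟨A, fun τ hτ => ?_⟩
  have h2 := hA (((-⌊τ.re⌋ : ℤ) : ℝ) +ᵥ τ) (by simpa using hτ)
  have h3 : (((-⌊τ.re⌋ : ℤ) : ℝ) +ᵥ τ) ∈ {τ : ℍ | |τ.re| ≤ 1} := by
    simp only [Set.mem_ofPred_eq, UpperHalfPlane.vadd_re]
    push_cast
    rw [neg_add_eq_sub, Int.self_sub_floor, abs_of_nonneg (Int.fract_nonneg _)]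
    exact (Int.fract_lt_one _).le
  have h4 := h2 h3
  simp only [Set.mem_preimage, hper] at h4
  exact h4

theorem modularSlash_T_zpow (k : ℤ) (m : ℕ) (n : ℤ) (Φ : ℍ × ℂ → ℂ) (τ : ℍ) (z : ℂ) :
    modularSlash k m (ModularGroup.T ^ n) Φ (τ, z) = Φ ((n : ℝ) +ᵥ τ, z) := by
  rw [modularSlash, UpperHalfPlane.modular_T_zpow_smul]
  simp [ModularGroup.coe_T_zpow]

theorem tendsto_eisensteinTerm {k : ℤ} (hk : 0 < k) (hk2 : Even k) (x : JacobiIndex) (z : ℂ) :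
    Tendsto (fun τ : ℍ => eisensteinTerm k x τ z) atImInfty
      (𝓝 (if x.1.1.1 = 0 ∧ x.2 = 0 then 1 else 0)) := by
  obtain ⟨⟨⟨c, d⟩, hcd⟩, l⟩ := x
  have hcd' : IsCoprime c d := hcd
  split_ifs with h
  · obtain ⟨hc, hl⟩ := h
    dsimp only at hc hl
    subst hc hl
    refine tendsto_const_nhds.congr fun τ => ?_
    have hd : d = 1 ∨ d = -1 := Int.isUnit_iff.1 (isCoprime_zero_left.1 hcd')
    rcases hd with rfl | rfl <;> simp [eisensteinTerm, jacobiTerm, hk2.neg_one_zpow, zpow_neg]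
  · exact tendsto_jacobiTerm_zero (bezout_det hcd') hk (by simp only at h; tauto) z

/-- Only `(c, d) = (0, ±1)` with `l = 0` survive; the total 2 cancels the factor `1/2` of the
series. -/
theorem tsum_ite_jacobiIndex :
    ∑' x : JacobiIndex, (if x.1.1.1 = 0 ∧ x.2 = 0 then (1 : ℂ) else 0) = 2 := by
  let x₁ : JacobiIndex := (⟨(0, 1), isCoprime_one_right⟩, 0)
  let x₂ : JacobiIndex := (⟨(0, -1), isCoprime_one_right.neg_right⟩, 0)
  have h12 : x₁ ≠ x₂ := by simp [x₁, x₂]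
  rw [tsum_eq_sum (s := {x₁, x₂})]
  · rw [Finset.sum_pair h12]
    norm_num [x₁, x₂]
  · rintro ⟨⟨⟨c, d⟩, hcd⟩, l⟩ hx
    have hcd' : IsCoprime c d := hcd
    refine if_neg ?_
    rintro ⟨hc, hl⟩
    dsimp only at hc hl
    subst hc hl
    rcases Int.isUnit_iff.1 (isCoprime_zero_left.1 hcd') with rfl | rfl <;> simp [x₁, x₂] at hx

theorem tendsto_jacobiEisenstein {k : ℤ} (hk : 4 ≤ k) (hk2 : Even k) (z : ℂ) :
    Tendsto (fun τ => jacobiEisenstein k 1 (τ, z)) atImInfty (𝓝 1) := by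
  refine tendsto_atImInfty_of_periodic (fun n τ => ?_) ?_
  · rw [← modularSlash_T_zpow k 1 n (jacobiEisenstein k 1), modularSlash_jacobiEisenstein]
  · obtain ⟨u, hu, hb⟩ := exists_eisensteinTerm_bound hk 1 one_pos ‖z‖
    have := tendsto_tsum_of_dominated_convergence (𝓕 := atImInfty ⊓ 𝓟 {τ : ℍ | |τ.re| ≤ 1})
      (f := fun (τ : ℍ) x => eisensteinTerm k x τ z) hu
      (fun x => (tendsto_eisensteinTerm (by omega) hk2 x z).mono_left inf_le_left) ?_
    · rw [tsum_ite_jacobiIndex] at this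
      have h2 := this.const_mul (1 / 2 : ℂ)
      norm_num at h2
      simp only [jacobiEisenstein_eq]
      norm_num
      exact h2
    · filter_upwards [mem_inf_of_left (tendsto_im_atImInfty.eventually_ge_atTop 1),
        mem_inf_of_right (mem_principal_self _)] with τ h1 h2 x
      exact hb x τ ⟨h2, h1⟩ z le_rfl

/-! ### Modular forms of level one -/

/-- `SL(2, ℤ)` moves every cusp to infinity, so invariance leaves one growth condition. -/
theorem exists_modularForm {k : ℤ} {f : ℍ → ℂ} (hf : ∀ γ : SL(2, ℤ), f ∣[k] γ = f) (hd : MDiff f)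
    (hb : IsBoundedAtImInfty f) : ∃ F : ModularForm 𝒮ℒ k, ⇑F = f :=
  ⟨{ toFun := f
     slash_action_eq' := fun _ ⟨γ, hγ⟩ => hγ ▸ hf γ
     holo' := hd
     bdd_at_cusps' := fun {c} hc => by
      rw [Subgroup.IsArithmetic.isCusp_iff_isCusp_SL2Z] at hc
      rw [OnePoint.isBoundedAt_iff_forall_SL2Z hc]
      intro γ _
      rw [hf γ]
      exact hb }, rfl⟩

theorem slash_eq {k : ℤ} (f : ModularForm 𝒮ℒ k) (γ : SL(2, ℤ)) : ⇑f ∣[k] γ = ⇑f :=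
  SlashInvariantForm.slash_action_eqn f (γ : GL (Fin 2) ℝ) ⟨γ, rfl⟩

theorem isBoundedAtImInfty_coe {k : ℤ} (f : ModularForm 𝒮ℒ k) : IsBoundedAtImInfty f :=
  ModularFormClass.bdd_at_infty f

theorem tendsto_modularForm {k : ℤ} (f : ModularForm 𝒮ℒ k) :
    Tendsto f atImInfty (𝓝 ((qExpansion 1 f).coeff 0)) := by
  have hper := SlashInvariantFormClass.periodic_comp_ofComplex f one_mem_strictPeriods_SL
  have han := ModularFormClass.analyticAt_cuspFunction_zero f one_pos one_mem_strictPeriods_SL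
  rw [qExpansion_coeff_zero one_pos han hper, ← cuspFunction_apply_zero one_pos han hper]
  refine (han.continuousAt.tendsto.comp (qParam_tendsto_atImInfty one_pos)).congr fun τ => ?_
  exact eq_cuspFunction τ one_ne_zero hper

theorem tendsto_eisenstein {k : ℕ} (hk : 3 ≤ k) (hk2 : Even k) :
    Tendsto (ModularForm.E hk) atImInfty (𝓝 1) := by
  have := tendsto_modularForm (ModularForm.E hk)
  rwa [EisensteinSeries.E_qExpansion_coeff_zero hk hk2] at this

/-- There are no nonzero cusp forms of weight below 12. This identifies forms of small weight by
their limits at the cusp. -/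
theorem eq_zero_of_tendsto_zero {k : ℤ} (hk : k < 12) {f : ModularForm 𝒮ℒ k}
    (h : Tendsto f atImInfty (𝓝 0)) : f = 0 := by
  have h0 := tendsto_nhds_unique (tendsto_modularForm f) h
  have h1 := rank_zero_iff_forall_zero.1 (CuspForm.rank_eq_zero_of_weight_lt_twelve hk)
    (ModularForm.toCuspForm f h0)
  ext τ
  have := DFunLike.congr_fun h1 τ
  simpa using this

/-- The normalized derivative is `q d/dq` on the cusp function, hence vanishes at `q = 0`. -/
theorem tendsto_normalizedDeriv {f : ℍ → ℂ} (hper : Function.Periodic (f ∘ ofComplex) (1 : ℝ))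
    (hd : MDiff f) (hb : IsBoundedAtImInfty f) :
    Tendsto (normalizedDerivOfComplex f) atImInfty (𝓝 0) := by
  set F := cuspFunction 1 f
  have hF : ∀ q : ℂ, ‖q‖ < 1 → DifferentiableAt ℂ F q := fun q hq =>
    differentiableAt_cuspFunction one_pos hper hd hb hq
  have han : AnalyticAt ℂ F 0 := analyticAt_cuspFunction_zero one_pos hper hd hb
  have hq := qParam_tendsto_atImInfty one_pos
  have key : ∀ τ : ℍ, normalizedDerivOfComplex f τ =
      Function.Periodic.qParam 1 τ * deriv F (Function.Periodic.qParam 1 τ) := fun τ => by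
    have hlt : ‖Function.Periodic.qParam 1 (τ : ℂ)‖ < 1 :=
      Function.Periodic.norm_qParam_lt_one one_pos τ.im_pos
    have hqd : HasDerivAt (Function.Periodic.qParam 1)
        (2 * Real.pi * I * Function.Periodic.qParam 1 τ) (τ : ℂ) := by
      have h1 : HasDerivAt (fun w : ℂ => 2 * Real.pi * I * w / (1 : ℝ)) (2 * Real.pi * I) τ := by
        simpa using (hasDerivAt_id (τ : ℂ)).const_mul (2 * Real.pi * I)
      refine h1.cexp.congr_deriv ?_
      rw [Function.Periodic.qParam, mul_comm]
    have h2 : f ∘ ofComplex = F ∘ Function.Periodic.qParam 1 := by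
      funext w
      exact (Function.Periodic.eq_cuspFunction one_ne_zero hper w).symm
    rw [normalizedDerivOfComplex, h2, ((hF _ hlt).hasDerivAt.comp _ hqd).deriv]
    have := two_pi_I_ne_zero
    field_simp
  simp only [funext key]
  have h3 := hq.mul (han.deriv.continuousAt.tendsto.comp hq)
  rwa [zero_mul] at h3

/-- `f - c₀` is `q` times a bounded function. This form needs no modularity, so it applies to `E₂`.
-/
theorem tendsto_of_hasSum_qParam {f : ℍ → ℂ} {c : ℕ → ℂ}
    (h : ∀ τ : ℍ, HasSum (fun m => c m • Function.Periodic.qParam 1 (τ : ℂ) ^ m) (f τ)) :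
    Tendsto f atImInfty (𝓝 (c 0)) := by
  set q : ℍ → ℂ := fun τ => Function.Periodic.qParam 1 (τ : ℂ)
  have hq0 : ∀ τ, q τ ≠ 0 := fun τ => Function.Periodic.qParam_ne_zero _
  have hb : IsBoundedAtImInfty fun τ => (f τ - c 0) / q τ := by
    refine isBoundedAtImInfty_of_hasSum_qExpansion (c := fun m => c (m + 1)) one_pos fun τ => ?_
    have h1 := ((hasSum_nat_add_iff' 1).2 (h τ)).div_const (q τ)
    simp only [Finset.range_one, Finset.sum_singleton, pow_zero, smul_eq_mul, mul_one] at h1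
    refine h1.congr_fun fun m => ?_
    rw [pow_succ, ← mul_assoc]
    exact (mul_div_cancel_right₀ _ (hq0 τ)).symm
  have h2 := hb.mul_isLittleO ((Asymptotics.isLittleO_one_iff ℝ).2
    (qParam_tendsto_atImInfty one_pos))
  have h3 : Tendsto (fun τ => (f τ - c 0) / q τ * q τ) atImInfty (𝓝 0) := by
    refine (Asymptotics.isLittleO_one_iff ℝ).1 (h2.congr_right fun _ => ?_)
    simp
  simp only [div_mul_cancel₀ _ (hq0 _)] at h3
  simpa using h3.add_const (c 0)

theorem tendsto_E2 : Tendsto EisensteinSeries.E2 atImInfty (𝓝 1) := by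
  refine tendsto_of_hasSum_qParam (c := fun m : ℕ => if m = 0 then 1 else
    -24 * (ArithmeticFunction.sigma 1 m : ℂ)) fun τ => ?_
  simpa only [Function.Periodic.qParam, ofReal_one, div_one] using
    EisensteinSeries.hasSum_qExpansion_E2 (z := τ)

theorem tendsto_normalizedDeriv_modularForm {k : ℤ} (f : ModularForm 𝒮ℒ k) :
    Tendsto (normalizedDerivOfComplex f) atImInfty (𝓝 0) :=
  tendsto_normalizedDeriv (SlashInvariantFormClass.periodic_comp_ofComplex f
    one_mem_strictPeriods_SL) (ModularFormClass.holo f) (isBoundedAtImInfty_coe f)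

theorem tendsto_serreDerivative {k : ℤ} (f : ModularForm 𝒮ℒ k) (s : ℂ) :
    Tendsto (serreDerivative s f) atImInfty (𝓝 (-(s / 12 * (qExpansion 1 f).coeff 0))) := by
  have := (tendsto_normalizedDeriv_modularForm f).sub
    (((tendsto_E2.const_mul (s * 12⁻¹))).mul (tendsto_modularForm f))
  rw [mul_one, zero_sub, ← div_eq_mul_inv] at this
  exact this

theorem exists_serre {k : ℤ} (f : ModularForm 𝒮ℒ k) :
    ∃ F : ModularForm 𝒮ℒ (k + 2), ⇑F = serreDerivative (k : ℂ) f :=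
  exists_modularForm
    (fun γ => serreDerivative_slash_invariant (ModularFormClass.holo f) (slash_eq f γ))
    (serreDerivative_mdifferentiable _ (ModularFormClass.holo f))
    ((tendsto_serreDerivative f k).isBigO_one ℝ)

theorem eq_of_tendsto {k k' : ℤ} (hk : k < 12) (hkk : k = k') (f : ModularForm 𝒮ℒ k)
    (g : ModularForm 𝒮ℒ k')
    {a : ℂ} (hf : Tendsto f atImInfty (𝓝 a)) (hg : Tendsto g atImInfty (𝓝 a)) : ⇑f = ⇑g := by
  subst hkk
  have h := eq_zero_of_tendsto_zero hk (f := f - g) (by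
    have := hf.sub hg
    rwa [sub_self] at this)
  rw [sub_eq_zero.1 h]

theorem tendsto_E₄ : Tendsto ModularForm.E₄ atImInfty (𝓝 1) := tendsto_eisenstein _ ⟨2, rfl⟩

theorem tendsto_E₆ : Tendsto ModularForm.E₆ atImInfty (𝓝 1) := tendsto_eisenstein _ ⟨3, rfl⟩

/-- Ramanujan's identity: both sides are modular of weight 6 with the same constant term `-4/12`. -/
theorem serreDerivative_E₄ (τ : ℍ) :
    serreDerivative 4 ModularForm.E₄ τ = -(1 / 3) * ModularForm.E₆ τ := by
  obtain ⟨F, hF⟩ := exists_serre ModularForm.E₄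
  have h1 := tendsto_serreDerivative ModularForm.E₄ 4
  rw [EisensteinSeries.E_qExpansion_coeff_zero _ ⟨2, rfl⟩] at h1
  push_cast at hF
  rw [← hF] at h1
  have h2 : Tendsto (⇑((-(1 / 3) : ℂ) • ModularForm.E₆)) atImInfty (𝓝 (-(4 / 12 * 1))) := by
    rw [show (-(4 / 12 * 1) : ℂ) = -(1 / 3) * 1 by norm_num]
    exact tendsto_E₆.const_mul _
  have := congrFun (eq_of_tendsto (by norm_num) (by norm_num) F _ h1 h2) τ
  rwa [hF] at this

theorem serreDerivative_E₆ (τ : ℍ) :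
    serreDerivative 6 ModularForm.E₆ τ = -(1 / 2) * ModularForm.E₄ τ ^ 2 := by
  obtain ⟨F, hF⟩ := exists_serre ModularForm.E₆
  have h1 := tendsto_serreDerivative ModularForm.E₆ 6
  rw [EisensteinSeries.E_qExpansion_coeff_zero _ ⟨3, rfl⟩] at h1
  push_cast at hF
  rw [← hF] at h1
  have h2 : Tendsto (⇑((-(1 / 2) : ℂ) • ModularForm.E₄.pow 2)) atImInfty (𝓝 (-(6 / 12 * 1))) := by
    rw [show (-(6 / 12 * 1) : ℂ) = -(1 / 2) * 1 ^ 2 by norm_num]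
    exact (tendsto_E₄.pow 2).const_mul _
  have := congrFun (eq_of_tendsto (by norm_num) (by norm_num) F _ h1 h2) τ
  rwa [hF] at this

theorem discr_eq (τ : ℍ) : discr τ = ModularForm.discriminant τ :=
  (ModularForm.discriminant_eq_E₄_cube_sub_E₆_sq τ).symm

theorem discr_ne_zero (τ : ℍ) : discr τ ≠ 0 := by
  rw [discr_eq]
  exact ModularForm.discriminant_ne_zero τ

/-! ### Taylor coefficients of the Jacobi-Eisenstein series -/

theorem deriv_deriv_gaussian_mul {G : ℂ → ℂ} (hG : Differentiable ℂ G) (C α i : ℂ) :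
    deriv (deriv fun z => C * exp (-(α * z ^ 2)) * G (z * i)) 0 =
      C * (i ^ 2 * deriv (deriv G) 0 - 2 * α * G 0) := by
  have hG' : Differentiable ℂ (deriv G) := fun z =>
    (hG.differentiableOn.deriv isOpen_univ).differentiableAt Filter.univ_mem
  have hE : ∀ z : ℂ, HasDerivAt (fun z => C * exp (-(α * z ^ 2)))
      (C * (exp (-(α * z ^ 2)) * -(2 * α * z))) z := fun z => by
    have h1 : HasDerivAt (fun z : ℂ => -(α * z ^ 2)) (-(2 * α * z)) z := by
      have := ((hasDerivAt_pow 2 z).const_mul α).neg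
      refine this.congr_deriv ?_
      push_cast
      ring
    exact h1.cexp.const_mul C
  have hi : ∀ z : ℂ, HasDerivAt (fun z : ℂ => z * i) i z := fun z => by
    simpa using (hasDerivAt_id z).mul_const i
  have e : deriv (fun z => C * exp (-(α * z ^ 2)) * G (z * i)) = fun z =>
      C * exp (-(α * z ^ 2)) * ((-(2 * α) * z) * G (z * i) + deriv G (z * i) * i) := by
    funext z
    refine ((hE z).mul ((hG (z * i)).hasDerivAt.comp z (hi z))).deriv.trans ?_
    simp only [Function.comp_apply]
    ring
  rw [e]
  have h2 : HasDerivAt (fun z : ℂ => -(2 * α) * z) (-(2 * α)) 0 := by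
    simpa using (hasDerivAt_id (0 : ℂ)).const_mul (-(2 * α))
  have h3 := (hE 0).mul ((h2.mul ((hG (0 * i)).hasDerivAt.comp 0 (hi 0))).add
    (((hG' (0 * i)).hasDerivAt.comp 0 (hi 0)).mul_const i))
  refine h3.deriv.trans ?_
  simp
  left
  ring

/-- The second derivative in the elliptic variable at zero. -/
def secondTaylor (Φ : ℍ × ℂ → ℂ) (τ : ℍ) : ℂ := deriv (deriv fun z => Φ (τ, z)) 0

section

variable {k : ℤ} {Φ : ℍ × ℂ → ℂ}

theorem slash_zero (hm : ∀ γ, modularSlash k 1 γ Φ = Φ) (γ : SL(2, ℤ)) :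
    (fun τ => Φ (τ, 0)) ∣[k] γ = fun τ => Φ (τ, 0) := by
  ext τ
  have := congrFun (hm γ) (τ, 0)
  rw [ModularForm.SL_slash_apply, ModularGroup.denom_apply]
  simp only [modularSlash] at this
  rw [← this]
  simp [mul_comm]

/-- Differentiate the transformation law twice at `z = 0`: the Gaussian factor contributes the
quasi-modular correction, a multiple of the value at zero. -/
theorem secondTaylor_slash (hm : ∀ γ, modularSlash k 1 γ Φ = Φ)
    (hd : ∀ τ, Differentiable ℂ fun z => Φ (τ, z)) (γ : SL(2, ℤ)) (τ : ℍ) :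
    (secondTaylor Φ ∣[k + 2] γ) τ =
      secondTaylor Φ τ + 2 * (2 * Real.pi * I) * (γ 1 0 / denom γ τ) * Φ (τ, 0) := by
  have hj := denom_ne_zero γ τ
  have h0 := congrFun (slash_zero hm γ) τ
  rw [ModularForm.SL_slash_apply] at h0 ⊢
  rw [ModularGroup.denom_apply] at *
  set j : ℂ := γ 1 0 * τ + γ 1 1
  have e : (fun z => Φ (τ, z)) = fun z =>
      j ^ (-k) * exp (-(2 * Real.pi * I * γ 1 0 / j * z ^ 2)) * Φ (γ • τ, z * j⁻¹) := by
    funext z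
    conv_lhs => rw [← hm γ]
    simp only [modularSlash, div_eq_mul_inv]
    congr 4
    push_cast
    ring
  conv_rhs => rw [secondTaylor, e, deriv_deriv_gaussian_mul (hd (γ • τ))]
  rw [← h0, neg_add, zpow_add₀ hj, secondTaylor, zpow_neg j 2, zpow_ofNat]
  field_simp
  ring

end

theorem jacobiEisenstein_zero {κ : ℤ} {k : ℕ} (hκ : κ = k) (hk : 4 ≤ k)
    (hk' : k < 12) (hk2 : Even k) (τ : ℍ) :
    jacobiEisenstein κ 1 (τ, 0) = ModularForm.E (show 3 ≤ k by omega) τ := by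
  subst hκ
  have hkz : (4 : ℤ) ≤ k := by exact_mod_cast hk
  have hlim := tendsto_jacobiEisenstein hkz (by exact_mod_cast hk2) 0
  obtain ⟨F, hF⟩ := exists_modularForm (k := k) (f := fun τ => jacobiEisenstein k 1 (τ, 0))
    (slash_zero (modularSlash_jacobiEisenstein k))
    (UpperHalfPlane.mdifferentiable_iff.2 (differentiableOn_jacobiEisenstein hkz 0))
    (hlim.isBigO_one ℝ)
  rw [← hF] at hlim
  have := eq_of_tendsto (by exact_mod_cast hk') rfl F _ hlim
    (tendsto_eisenstein (show 3 ≤ k by omega) hk2)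
  rw [← this, hF]

/-- The second Taylor coefficient and `E_k'` have proportional quasi-modular corrections, so a
combination is modular of weight `k + 2 < 12`; it tends to zero at the cusp, hence vanishes.
Holomorphy and the limit of the Taylor coefficient come from the theta decomposition. -/
theorem secondTaylor_jacobiEisenstein {κ : ℤ} {k : ℕ} (hκ : κ = k) (hk : 4 ≤ k) (hk' : k < 10)
    (hk2 : Even k) (τ : ℍ) :
    secondTaylor (jacobiEisenstein κ 1) τ = 2 * (2 * Real.pi * I) ^ 2 / k *
      normalizedDerivOfComplex (ModularForm.E (show 3 ≤ k by omega)) τ := by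
  subst hκ
  have hkz : (4 : ℤ) ≤ k := by exact_mod_cast hk
  have hk0 : (k : ℂ) ≠ 0 := by
    have : k ≠ 0 := by omega
    exact_mod_cast this
  set E := ModularForm.E (show 3 ≤ k by omega)
  have hE : (fun τ => jacobiEisenstein k 1 (τ, 0)) = E :=
    funext (jacobiEisenstein_zero rfl hk (by omega) hk2)
  have hΦ := fun τ => isThetaFunction_jacobiEisenstein hkz τ
  have hd := fun z => differentiableOn_jacobiEisenstein hkz z
  have hlim := fun z => tendsto_jacobiEisenstein hkz (by exact_mod_cast hk2) z
  have hsum : secondTaylor (jacobiEisenstein k 1) = fun τ =>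
      thetaCoeff 0 (jacobiEisenstein k 1) τ * thetaSecond 0 τ +
        thetaCoeff 1 (jacobiEisenstein k 1) τ * thetaSecond 1 τ :=
    funext fun τ => deriv_deriv_eq_thetaCoeff hΦ τ
  have hholo : MDiff (secondTaylor (jacobiEisenstein k 1)) := by
    rw [UpperHalfPlane.mdifferentiable_iff, hsum]
    refine (((differentiableOn_thetaCoeff_zero hΦ hd).mul (differentiableOn_thetaSecond 0)).add
      ((differentiableOn_thetaCoeff_one hΦ hd).mul (differentiableOn_thetaSecond 1))).congr ?_
    intro w hw
    have : ((ofComplex w : ℍ) : ℂ) = w := ofComplex_apply_of_im_pos hw ▸ rfl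
    simp [this]
  have hlim2 : Tendsto (secondTaylor (jacobiEisenstein k 1)) atImInfty (𝓝 0) := by
    rw [hsum]
    have := ((tendsto_thetaCoeff_zero hΦ (hlim 0) (hlim (1 / 2))).mul tendsto_thetaSecond_zero).add
      ((tendsto_thetaCoeff_one hΦ (hlim 0) (hlim (1 / 2))).mul tendsto_thetaSecond_one)
    simpa using this
  -- This value makes the correction `s k / (2πi)` of `s` times the derivative equal to `2(2πi)`,
  -- that of the Taylor coefficient.
  set s : ℂ := 2 * (2 * Real.pi * I) ^ 2 / k with hs
  have hlim3 := hlim2.sub ((tendsto_normalizedDeriv_modularForm E).const_mul s)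
  rw [mul_zero, sub_zero] at hlim3
  have hslash : ∀ γ : SL(2, ℤ), (secondTaylor (jacobiEisenstein k 1) -
      s • normalizedDerivOfComplex E) ∣[(k + 2 : ℤ)] γ =
      secondTaylor (jacobiEisenstein k 1) - s • normalizedDerivOfComplex E := fun γ => by
    ext τ
    have h1 := secondTaylor_slash (modularSlash_jacobiEisenstein k) (fun τ => (hΦ τ).diff) γ τ
    have h2 := congrFun (normalizedDerivOfComplex_SL_slash (k := k) (ModularFormClass.holo E)
      (γ := γ)) τ
    rw [slash_eq E γ] at h2
    rw [sub_eq_add_neg, SlashAction.add_slash, SlashAction.neg_slash, ModularForm.SL_smul_slash]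
    simp only [Pi.add_apply, Pi.neg_apply, Pi.smul_apply, Pi.sub_apply, smul_eq_mul] at h2 ⊢
    rw [h1, jacobiEisenstein_zero rfl hk (by omega) hk2, sub_eq_iff_eq_add.1 h2.symm]
    have hs' : s * (k * (2 * Real.pi * I)⁻¹) = 2 * (2 * Real.pi * I) := by
      rw [hs]
      have := two_pi_I_ne_zero
      field_simp
    push_cast
    linear_combination (-(γ 1 0 / denom γ τ) * E τ) * hs'
  obtain ⟨F, hF⟩ := exists_modularForm hslash
    (hholo.sub ((normalizedDerivOfComplex_mdifferentiable (ModularFormClass.holo E)).const_smul s))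
    (hlim3.isBigO_one ℝ)
  have h0 := eq_zero_of_tendsto_zero (f := F) (by omega) (by rw [hF]; exact hlim3)
  have h1 := congrFun hF τ
  rw [h0] at h1
  simp only [zero_apply, Pi.sub_apply, Pi.smul_apply, smul_eq_mul] at h1
  exact sub_eq_zero.1 h1.symm

/-! ### A criterion for weak Jacobi forms of index one -/

theorem periodic_comp_ofComplex {f : ℍ → ℂ} (h : ∀ τ, f ((1 : ℝ) +ᵥ τ) = f τ) :
    Function.Periodic (f ∘ ofComplex) (1 : ℝ) := by
  intro w
  by_cases! hw : 0 < im w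
  · have : 0 < im (w + (1 : ℝ)) := by simp [hw]
    simp only [Function.comp_apply, ofComplex_apply_of_im_pos this, ofComplex_apply_of_im_pos hw]
    rw [← h ⟨w, hw⟩]
    congr 1
    ext
    simp [add_comm]
  · have : im (w + (1 : ℝ)) ≤ 0 := by simpa using hw
    simp only [Function.comp_apply, ofComplex_apply_of_im_nonpos this,
      ofComplex_apply_of_im_nonpos hw]

theorem exists_tendsto {f : ℍ → ℂ} (h : ∀ τ, f ((1 : ℝ) +ᵥ τ) = f τ) (hd : MDiff f)
    (hb : IsBoundedAtImInfty f) : ∃ a, Tendsto f atImInfty (𝓝 a) := by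
  have hper := periodic_comp_ofComplex h
  have han := analyticAt_cuspFunction_zero one_pos hper hd hb
  exact ⟨_, (han.continuousAt.tendsto.comp (qParam_tendsto_atImInfty one_pos)).congr fun τ =>
    eq_cuspFunction τ one_ne_zero hper⟩

/-- The exponents of the products of powers of `q` with the terms of the theta series. -/
def thetaIndex (j : ℤ) (x : ℕ × ℤ) : ℕ × ℤ := (x.1 + (x.2 ^ 2 + j * x.2).toNat, 2 * x.2 + j)

theorem thetaIndex_injective (j : ℤ) : Function.Injective (thetaIndex j) := by
  rintro ⟨n, l⟩ ⟨n', l'⟩ h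
  simp only [thetaIndex, Prod.mk.injEq] at h
  obtain ⟨h1, h2⟩ := h
  have hl : l = l' := by omega
  subst hl
  simpa using h1

/-- The term `q^(l² + jl) ζ^(2l + j)` has `r² - 4n = j² ≤ 1`, and multiplication by a power series
in `q` only increases `n`. -/
theorem exists_fourier_thetaSeries {j : ℤ} (hj : ∀ l : ℤ, 0 ≤ l ^ 2 + j * l) (hj2 : j ^ 2 ≤ 1)
    {h : ℍ → ℂ} (hper : ∀ τ, h ((1 : ℝ) +ᵥ τ) = h τ) (hd : MDiff h) (hb : IsBoundedAtImInfty h) :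
    ∃ c : ℕ × ℤ → ℂ, (∀ (n : ℕ) (r : ℤ), 4 * (n : ℤ) + 1 < r ^ 2 → c (n, r) = 0) ∧
      ∀ p : ℍ × ℂ, HasSum (fun x => c x * fourierMode x p) (h p.1 * thetaSeries j p.1 p.2) := by
  set a := fun n => (qExpansion 1 h).coeff n
  refine ⟨Function.extend (thetaIndex j) (fun x => a x.1) 0, fun n r hr => ?_, fun p => ?_⟩
  · rw [Function.extend_apply', Pi.zero_apply]
    rintro ⟨⟨n', l⟩, hx⟩
    simp only [thetaIndex, Prod.mk.injEq] at hx
    obtain ⟨h1, h2⟩ := hx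
    have h3 : ((l ^ 2 + j * l).toNat : ℤ) = l ^ 2 + j * l := Int.toNat_of_nonneg (hj l)
    have h4 : (n : ℤ) = n' + (l ^ 2 + j * l) := by
      rw [← h3]
      exact_mod_cast h1.symm
    rw [← h2, h4] at hr
    nlinarith
  · have h1 := hasSum_qExpansion one_pos (periodic_comp_ofComplex hper) hd hb p.1
    have h2 := hasSum_thetaSeries j p.1.im_pos p.2
    have h3 := h1.mul h2 (summable_mul_of_summable_norm (f := fun m => a m •
      Function.Periodic.qParam 1 (p.1 : ℂ) ^ m) (g := fun l => thetaTerm j l p.1 p.2)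
      h1.summable.norm h2.summable.norm)
    refine ((thetaIndex_injective j).hasSum_iff fun x hx => ?_).1 (h3.congr_fun fun x => ?_)
    · rw [Function.extend_apply' _ _ _ (by rintro ⟨y, hy⟩; exact hx ⟨y, hy⟩)]
      simp
    · obtain ⟨n, l⟩ := x
      rw [Function.comp_apply, (thetaIndex_injective j).extend_apply, smul_eq_mul, mul_assoc]
      congr 1
      rw [thetaTerm, Function.Periodic.qParam, ← exp_nat_mul, ← exp_add, fourierMode, thetaIndex]
      have h3 : ((l ^ 2 + j * l).toNat : ℂ) = l ^ 2 + j * l := by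
        exact_mod_cast congrArg (Int.cast (R := ℂ)) (Int.toNat_of_nonneg (hj l))
      congr 1
      push_cast
      rw [h3]
      ring

theorem isThetaFunction_of_lattice {m : ℕ} {Φ : ℍ × ℂ → ℂ} {τ : ℍ}
    (hl : ∀ l u, latticeSlash m l u Φ = Φ) (hd : Differentiable ℂ fun z => Φ (τ, z)) :
    IsThetaFunction m τ fun z => Φ (τ, z) where
  diff := hd
  add_one z := by simpa [latticeSlash] using congrFun (hl 0 1) (τ, z)
  add_tau z := by
    have := congrFun (hl 1 0) (τ, z)
    simp only [latticeSlash, Int.cast_one, one_pow, one_mul, mul_one, Int.cast_zero,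
      add_zero] at this
    rw [← this, ← mul_assoc, ← exp_add, neg_add_cancel, exp_zero, one_mul]

theorem vadd_eq_of_modular {k : ℤ} {m : ℕ} {Φ : ℍ × ℂ → ℂ} (hm : ∀ γ, modularSlash k m γ Φ = Φ)
    (n : ℤ) (τ : ℍ) (z : ℂ) : Φ ((n : ℝ) +ᵥ τ, z) = Φ (τ, z) := by
  rw [← modularSlash_T_zpow k m n Φ, hm]

theorem thetaCoeff_vadd {k : ℤ} {m : ℕ} {Φ : ℍ × ℂ → ℂ} (hm : ∀ γ, modularSlash k m γ Φ = Φ)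
    (j : ℤ) (τ : ℍ) : thetaCoeff j Φ ((1 : ℝ) +ᵥ τ) = thetaCoeff j Φ τ := by
  have := vadd_eq_of_modular hm 1 τ
  rw [Int.cast_one] at this
  simp only [thetaCoeff, this]

theorem mdifferentiable_thetaCoeff_zero {Φ : ℍ × ℂ → ℂ}
    (hΦ : ∀ τ : ℍ, IsThetaFunction 1 τ fun z => Φ (τ, z))
    (hd : ∀ z, DifferentiableOn ℂ (fun w => Φ (ofComplex w, z)) {w | 0 < w.im}) :
    MDiff (thetaCoeff 0 Φ) :=
  UpperHalfPlane.mdifferentiable_iff.2 (differentiableOn_thetaCoeff_zero hΦ hd)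

theorem mdifferentiable_thetaCoeff_one {Φ : ℍ × ℂ → ℂ}
    (hΦ : ∀ τ : ℍ, IsThetaFunction 1 τ fun z => Φ (τ, z))
    (hd : ∀ z, DifferentiableOn ℂ (fun w => Φ (ofComplex w, z)) {w | 0 < w.im}) :
    MDiff (thetaCoeff 1 Φ) :=
  UpperHalfPlane.mdifferentiable_iff.2 (differentiableOn_thetaCoeff_one hΦ hd)

theorem isWeakJacobiForm_of_thetaCoeff {k : ℤ} {Φ : ℍ × ℂ → ℂ}
    (hm : ∀ γ, modularSlash k 1 γ Φ = Φ) (hl : ∀ l u, latticeSlash 1 l u Φ = Φ)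
    (hent : ∀ τ : ℍ, Differentiable ℂ fun z => Φ (τ, z))
    (hd : ∀ z, DifferentiableOn ℂ (fun w => Φ (ofComplex w, z)) {w | 0 < w.im})
    (h0 : IsBoundedAtImInfty (thetaCoeff 0 Φ)) (h1 : IsBoundedAtImInfty (thetaCoeff 1 Φ)) :
    IsWeakJacobiForm k 1 Φ where
  modular := hm
  lattice := hl
  holo := by
    have hΦ := fun τ => isThetaFunction_of_lattice hl (hent τ)
    have hj : ∀ j, DifferentiableOn ℂ (fun w : ℂ × ℂ => thetaSeries j w.1 w.2) {w | 0 < w.1.im} :=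
      fun j w hw => (differentiableAt_thetaSeries j hw).differentiableWithinAt
    have hmaps : Set.MapsTo Prod.fst {w : ℂ × ℂ | 0 < w.1.im} {w : ℂ | 0 < w.im} := fun w hw => hw
    refine ((((differentiableOn_thetaCoeff_zero hΦ hd).comp differentiableOn_fst hmaps).mul
      (hj 0)).add (((differentiableOn_thetaCoeff_one hΦ hd).comp differentiableOn_fst hmaps).mul
      (hj 1))).congr fun w hw => ?_
    have : ((ofComplex w.1 : ℍ) : ℂ) = w.1 := ofComplex_apply_of_im_pos hw ▸ rfl
    rw [eq_thetaCoeff hΦ, this]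
    rfl
  fourier := by
    have hΦ := fun τ => isThetaFunction_of_lattice hl (hent τ)
    obtain ⟨c, hc, hs⟩ := exists_fourier_thetaSeries nonneg_zero (by norm_num)
      (thetaCoeff_vadd hm 0) (mdifferentiable_thetaCoeff_zero hΦ hd) h0
    obtain ⟨c', hc', hs'⟩ := exists_fourier_thetaSeries nonneg_one (by norm_num)
      (thetaCoeff_vadd hm 1) (mdifferentiable_thetaCoeff_one hΦ hd) h1
    refine ⟨c + c', fun n r hr => ?_, fun p => ?_⟩
    · have hr' : 4 * (n : ℤ) + 1 < r ^ 2 := by simpa using hr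
      simp [hc n r hr', hc' n r hr']
    · have := (hs p).add (hs' p)
      rw [← eq_thetaCoeff hΦ] at this
      simpa [add_mul] using this

/-! ### Quotients of forms of index one by the discriminant -/

/-- A periodic holomorphic function with limit zero is `O(q)`, and `q` is `O(Δ)`. -/
theorem isBoundedAtImInfty_div_discr {f : ℍ → ℂ} (h : ∀ τ, f ((1 : ℝ) +ᵥ τ) = f τ) (hd : MDiff f)
    (hz : Tendsto f atImInfty (𝓝 0)) : IsBoundedAtImInfty fun τ => f τ / discr τ := by
  have h1 := exp_decay_sub_atImInfty one_pos (periodic_comp_ofComplex h) hd (hz.isBigO_one ℝ)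
  have hz' : IsZeroAtImInfty f := hz
  rw [hz'.valueAtInfty_eq_zero] at h1
  simp only [sub_zero, div_one] at h1
  have h2 := (h1.trans ModularForm.exp_isBigO_discriminant)
  simp only [discr_eq]
  exact (Asymptotics.div_isBoundedUnder_of_isBigO h2).isBigO_one ℝ

theorem differentiable_comb {f g : ℂ → ℂ} (hf : Differentiable ℂ f) (hg : Differentiable ℂ g)
    (a b c : ℂ) : Differentiable ℂ fun z => (a * f z + b * g z) / c :=
  ((hf.const_mul a).add (hg.const_mul b)).div_const c

theorem deriv_comb {f g : ℂ → ℂ} (hf : Differentiable ℂ f) (hg : Differentiable ℂ g) (a b c : ℂ) :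
    (deriv fun z => (a * f z + b * g z) / c) = fun z => (a * deriv f z + b * deriv g z) / c :=
  funext fun z => ((((hf z).hasDerivAt.const_mul a).add ((hg z).hasDerivAt.const_mul b)).div_const
    c).deriv

theorem differentiable_deriv {f : ℂ → ℂ} (hf : Differentiable ℂ f) : Differentiable ℂ (deriv f) :=
  fun _ => (hf.differentiableOn.deriv isOpen_univ).differentiableAt Filter.univ_mem

/-- The quotient of a combination of the Jacobi-Eisenstein series by the discriminant. -/
def indexOneForm (u v : ℍ → ℂ) (p : ℍ × ℂ) : ℂ :=
  (u p.1 * jacobiEisenstein 4 1 p + v p.1 * jacobiEisenstein 6 1 p) / discr p.1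

theorem thetaCoeff_div (j : ℤ) (Φ : ℍ × ℂ → ℂ) (g : ℍ → ℂ) :
    thetaCoeff j (fun p => Φ p / g p.1) = fun τ => thetaCoeff j Φ τ / g τ := by
  funext τ
  rw [thetaCoeff, thetaCoeff, fiberCoeff, fiberCoeff, ← intervalIntegral.integral_div]
  refine intervalIntegral.integral_congr fun x _ => ?_
  simp only
  ring

theorem smul_eq_of_slash {k : ℤ} {f : ℍ → ℂ} {γ : SL(2, ℤ)} (h : f ∣[k] γ = f) (τ : ℍ) :
    f (γ • τ) = ((γ 1 0 : ℂ) * τ + (γ 1 1 : ℂ)) ^ k * f τ := by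
  have h1 := congrFun h τ
  have hj := denom_ne_zero γ τ
  rw [ModularForm.SL_slash_apply] at h1
  rw [ModularGroup.denom_apply] at *
  rw [← h1, mul_left_comm, zpow_neg, mul_inv_cancel₀ (zpow_ne_zero _ hj), mul_one]

theorem discr_slash (γ : SL(2, ℤ)) : discr ∣[(12 : ℤ)] γ = discr := by
  rw [funext discr_eq]
  exact SlashInvariantForm.slash_action_eqn CuspForm.discriminant (γ : GL (Fin 2) ℝ) ⟨γ, rfl⟩

theorem mdifferentiable_discr : MDiff discr := by
  rw [funext discr_eq]
  exact CuspForm.discriminant.holo'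

section

variable {k k₁ k₂ : ℤ} (u : ModularForm 𝒮ℒ k₁) (v : ModularForm 𝒮ℒ k₂)

theorem modularSlash_indexOneForm (h₁ : k₁ = k + 8) (h₂ : k₂ = k + 6) (γ : SL(2, ℤ)) :
    modularSlash k 1 γ (indexOneForm u v) = indexOneForm u v := by
  ext ⟨τ, z⟩
  have h4 := congrFun (modularSlash_jacobiEisenstein 4 γ) (τ, z)
  have h6 := congrFun (modularSlash_jacobiEisenstein 6 γ) (τ, z)
  have hj := denom_ne_zero γ τ
  rw [ModularGroup.denom_apply] at hj
  have hΔ := discr_ne_zero τ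
  simp only [modularSlash] at h4 h6 ⊢
  simp only [indexOneForm, smul_eq_of_slash (slash_eq u γ), smul_eq_of_slash (slash_eq v γ),
    smul_eq_of_slash (discr_slash γ)]
  rw [← h4, ← h6]
  subst h₁ h₂
  set j : ℂ := (γ 1 0 : ℂ) * τ + (γ 1 1 : ℂ)
  rw [zpow_add₀ hj, zpow_add₀ hj, zpow_neg, zpow_neg, zpow_neg]
  have hJ := zpow_ne_zero k hj
  set J := j ^ k
  simp only [zpow_ofNat]
  field_simp

theorem latticeSlash_indexOneForm (l m : ℤ) :
    latticeSlash 1 l m (indexOneForm u v) = indexOneForm u v := by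
  ext ⟨τ, z⟩
  have h4 := jacobiEisenstein_lattice 4 l m τ z
  have h6 := jacobiEisenstein_lattice 6 l m τ z
  simp only [latticeSlash, indexOneForm, Nat.cast_one, mul_one]
  rw [← h4, ← h6]
  ring

theorem differentiable_indexOneForm (τ : ℍ) :
    Differentiable ℂ fun z => indexOneForm u v (τ, z) :=
  differentiable_comb (isThetaFunction_jacobiEisenstein (le_refl 4) τ).diff
    (isThetaFunction_jacobiEisenstein (show (4 : ℤ) ≤ 6 by norm_num) τ).diff (u τ) (v τ) (discr τ)

theorem differentiableOn_modularForm : DifferentiableOn ℂ (fun w => u (ofComplex w)) {w | 0 < w.im} :=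
  UpperHalfPlane.mdifferentiable_iff.1 (ModularFormClass.holo u)

theorem differentiableOn_indexOneForm (z : ℂ) :
    DifferentiableOn ℂ (fun w => indexOneForm u v (ofComplex w, z)) {w | 0 < w.im} :=
  (((differentiableOn_modularForm u).mul (differentiableOn_jacobiEisenstein le_rfl z)).add
    ((differentiableOn_modularForm v).mul (differentiableOn_jacobiEisenstein (by norm_num) z))).div
    (UpperHalfPlane.mdifferentiable_iff.1 mdifferentiable_discr) fun _ _ => discr_ne_zero _

theorem isThetaFunction_indexOneForm (τ : ℍ) :
    IsThetaFunction 1 τ fun z => indexOneForm u v (τ, z) :=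
  isThetaFunction_of_lattice (latticeSlash_indexOneForm u v) (differentiable_indexOneForm u v τ)

/-- `E_{4,1}` and `E_{6,1}` both tend to 1 for every `z`, so opposite limits of `u` and `v` make the
numerator, and with it its theta coefficients, vanish at the cusp; the zero of `Δ` is then
compensated. -/
theorem isBoundedAtImInfty_thetaCoeff_indexOneForm {a : ℂ}
    (hu : Tendsto u atImInfty (𝓝 a)) (hv : Tendsto v atImInfty (𝓝 (-a))) :
    IsBoundedAtImInfty (thetaCoeff 0 (indexOneForm u v)) ∧
      IsBoundedAtImInfty (thetaCoeff 1 (indexOneForm u v)) := by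
  set Ψ : ℍ × ℂ → ℂ := fun p => u p.1 * jacobiEisenstein 4 1 p + v p.1 * jacobiEisenstein 6 1 p
  have hΨ : ∀ τ : ℍ, IsThetaFunction 1 τ fun z => Ψ (τ, z) := fun τ => by
    have h4 := isThetaFunction_jacobiEisenstein (le_refl 4) τ
    have h6 := isThetaFunction_jacobiEisenstein (show (4 : ℤ) ≤ 6 by norm_num) τ
    refine ⟨by simpa using differentiable_comb h4.diff h6.diff (u τ) (v τ) 1, fun z => ?_,
      fun z => ?_⟩
    · simp only [Ψ, h4.add_one z, h6.add_one z]
    · simp only [Ψ, h4.add_tau z, h6.add_tau z]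
      ring
  have hd : ∀ z, DifferentiableOn ℂ (fun w => Ψ (ofComplex w, z)) {w | 0 < w.im} := fun z =>
    ((differentiableOn_modularForm u).mul (differentiableOn_jacobiEisenstein le_rfl z)).add
      ((differentiableOn_modularForm v).mul (differentiableOn_jacobiEisenstein (by norm_num) z))
  have hlim : ∀ z, Tendsto (fun τ => Ψ (τ, z)) atImInfty (𝓝 0) := fun z => by
    have := (hu.mul (tendsto_jacobiEisenstein le_rfl (by decide) z)).add
      (hv.mul (tendsto_jacobiEisenstein (show (4 : ℤ) ≤ 6 by norm_num) (by decide) z))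
    simpa using this
  have hT : ∀ (j : ℤ) (τ : ℍ), thetaCoeff j Ψ ((1 : ℝ) +ᵥ τ) = thetaCoeff j Ψ τ := fun j τ => by
    have h1 := vadd_eq_of_modular (modularSlash_jacobiEisenstein 4) 1 τ
    have h2 := vadd_eq_of_modular (modularSlash_jacobiEisenstein 6) 1 τ
    have h3 := SlashInvariantForm.vAdd_apply_of_mem_strictPeriods u τ one_mem_strictPeriods_SL
    have h4 := SlashInvariantForm.vAdd_apply_of_mem_strictPeriods v τ one_mem_strictPeriods_SL
    rw [Int.cast_one] at h1 h2
    simp only [thetaCoeff, Ψ, h1, h2, h3, h4]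
  have e : ∀ j, thetaCoeff j (indexOneForm u v) = fun τ => thetaCoeff j Ψ τ / discr τ :=
    fun j => thetaCoeff_div j Ψ discr
  rw [e, e]
  constructor
  · refine isBoundedAtImInfty_div_discr (hT 0) (mdifferentiable_thetaCoeff_zero hΨ hd) ?_
    simpa using tendsto_thetaCoeff_zero hΨ (hlim 0) (hlim (1 / 2))
  · refine isBoundedAtImInfty_div_discr (hT 1) (mdifferentiable_thetaCoeff_one hΨ hd) ?_
    simpa using tendsto_thetaCoeff_one hΨ (hlim 0) (hlim (1 / 2))

theorem isWeakJacobiForm_indexOneForm (h₁ : k₁ = k + 8) (h₂ : k₂ = k + 6) {a : ℂ}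
    (hu : Tendsto u atImInfty (𝓝 a)) (hv : Tendsto v atImInfty (𝓝 (-a))) :
    IsWeakJacobiForm k 1 (indexOneForm u v) :=
  isWeakJacobiForm_of_thetaCoeff (modularSlash_indexOneForm u v h₁ h₂)
    (latticeSlash_indexOneForm u v) (differentiable_indexOneForm u v)
    (differentiableOn_indexOneForm u v)
    (isBoundedAtImInfty_thetaCoeff_indexOneForm u v hu hv).1
    (isBoundedAtImInfty_thetaCoeff_indexOneForm u v hu hv).2

/-- The limit is `a₀ + a₁(ζ + ζ⁻¹)` with the limits of the two theta coefficients as constants. Only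
`a₁` is seen by the second derivative at zero. -/
theorem exists_tendsto_indexOneForm (h₁ : k₁ = k + 8) (h₂ : k₂ = k + 6) {a : ℂ}
    (hu : Tendsto u atImInfty (𝓝 a)) (hv : Tendsto v atImInfty (𝓝 (-a))) :
    ∃ a₀ a₁ : ℂ, (∀ z, Tendsto (fun τ => indexOneForm u v (τ, z)) atImInfty
        (𝓝 (a₀ + a₁ * (exp (2 * Real.pi * I * z) + exp (-(2 * Real.pi * I * z)))))) ∧
      Tendsto (secondTaylor (indexOneForm u v)) atImInfty
        (𝓝 (a₁ * (2 * (2 * Real.pi * I) ^ 2))) := by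
  have hΦ := isThetaFunction_indexOneForm u v
  have hd := differentiableOn_indexOneForm u v
  have hm := modularSlash_indexOneForm u v h₁ h₂
  obtain ⟨b0, b1⟩ := isBoundedAtImInfty_thetaCoeff_indexOneForm u v hu hv
  obtain ⟨a₀, ha₀⟩ := exists_tendsto (thetaCoeff_vadd hm 0) (mdifferentiable_thetaCoeff_zero hΦ hd) b0
  obtain ⟨a₁, ha₁⟩ := exists_tendsto (thetaCoeff_vadd hm 1) (mdifferentiable_thetaCoeff_one hΦ hd) b1
  refine ⟨a₀, a₁, fun z => ?_, ?_⟩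
  · have := (ha₀.mul (tendsto_thetaSeries_zero z)).add (ha₁.mul (tendsto_thetaSeries_one z))
    rw [mul_one] at this
    exact this.congr fun τ => (eq_thetaCoeff hΦ τ z).symm
  · have := (ha₀.mul tendsto_thetaSecond_zero).add (ha₁.mul tendsto_thetaSecond_one)
    rw [mul_zero, zero_add] at this
    exact this.congr fun τ => (deriv_deriv_eq_thetaCoeff hΦ τ).symm

end

/-! ### The forms `A` and `B` -/

theorem formA_eq : formA =
    indexOneForm ⇑((1 / 144 : ℂ) • ModularForm.E₆) ⇑((-(1 / 144) : ℂ) • ModularForm.E₄) := by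
  ext p
  simp only [formA, indexOneForm, FunLike.coe_smul, Pi.smul_apply, smul_eq_mul]
  ring

theorem formB_eq : formB = indexOneForm ⇑((1 / 144 : ℂ) • ModularForm.E₄.pow 2)
    ⇑((-(1 / 144) : ℂ) • ModularForm.E₆) := by
  ext p
  simp only [formB, indexOneForm, FunLike.coe_smul, Pi.smul_apply, smul_eq_mul,
    ModularForm.coe_pow, Pi.pow_apply]
  ring

theorem tendsto_smul_E₄ (a : ℂ) : Tendsto (⇑(a • ModularForm.E₄)) atImInfty (𝓝 a) := by
  have := tendsto_E₄.const_mul a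
  rwa [mul_one] at this

theorem tendsto_smul_E₆ (a : ℂ) : Tendsto (⇑(a • ModularForm.E₆)) atImInfty (𝓝 a) := by
  have := tendsto_E₆.const_mul a
  rwa [mul_one] at this

theorem tendsto_smul_E₄_sq (a : ℂ) :
    Tendsto (⇑(a • ModularForm.E₄.pow 2)) atImInfty (𝓝 a) := by
  have := (tendsto_E₄.pow 2).const_mul a
  rwa [one_pow, mul_one] at this

theorem isWeakJacobiForm_formA : IsWeakJacobiForm (-2) 1 formA := by
  rw [formA_eq]
  exact isWeakJacobiForm_indexOneForm _ _ (by norm_num) (by norm_num) (tendsto_smul_E₆ _)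
    (tendsto_smul_E₄ _)

theorem isWeakJacobiForm_formB : IsWeakJacobiForm 0 1 formB := by
  rw [formB_eq]
  exact isWeakJacobiForm_indexOneForm _ _ (by norm_num) (by norm_num) (tendsto_smul_E₄_sq _)
    (tendsto_smul_E₆ _)

theorem jacobiEisenstein_four_zero (τ : ℍ) : jacobiEisenstein 4 1 (τ, 0) = ModularForm.E₄ τ :=
  jacobiEisenstein_zero (k := 4) rfl le_rfl (by norm_num) (by decide) τ

theorem jacobiEisenstein_six_zero (τ : ℍ) : jacobiEisenstein 6 1 (τ, 0) = ModularForm.E₆ τ :=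
  jacobiEisenstein_zero (k := 6) rfl (by norm_num) (by norm_num) (by decide) τ

theorem formA_zero (τ : ℍ) : formA (τ, 0) = 0 := by
  simp only [formA, jacobiEisenstein_four_zero, jacobiEisenstein_six_zero]
  ring

theorem formB_zero (τ : ℍ) : formB (τ, 0) = 12 := by
  have h := discr_ne_zero τ
  simp only [formB, jacobiEisenstein_four_zero, jacobiEisenstein_six_zero]
  rw [div_eq_iff h, discr]
  ring

/-- On inserting the derivatives of `E₄` and `E₆` the terms with `E₂` cancel, and what remains is a
multiple of `E₄³ - E₆²`. -/
theorem secondTaylor_formA (τ : ℍ) : secondTaylor formA τ = 2 * (2 * Real.pi * I) ^ 2 := by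
  have h4 := secondTaylor_jacobiEisenstein (κ := 4) (k := 4) rfl le_rfl (by norm_num)
    (by decide) τ
  have h6 := secondTaylor_jacobiEisenstein (κ := 6) (k := 6) rfl (by norm_num) (by norm_num)
    (by decide) τ
  have s4 := serreDerivative_E₄ τ
  have s6 := serreDerivative_E₆ τ
  rw [serreDerivative_apply] at s4 s6
  have e4 := (isThetaFunction_jacobiEisenstein (le_refl 4) τ).diff
  have e6 := (isThetaFunction_jacobiEisenstein (show (4 : ℤ) ≤ 6 by norm_num) τ).diff
  have h1 : (fun z => formA (τ, z)) = fun z => (ModularForm.E₆ τ * jacobiEisenstein 4 1 (τ, z) +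
      -ModularForm.E₄ τ * jacobiEisenstein 6 1 (τ, z)) / (144 * discr τ) := by
    funext z
    rw [formA, div_div, neg_mul, sub_eq_add_neg]
  have h2 : secondTaylor formA τ = (ModularForm.E₆ τ * secondTaylor (jacobiEisenstein 4 1) τ +
      -ModularForm.E₄ τ * secondTaylor (jacobiEisenstein 6 1) τ) / (144 * discr τ) := by
    rw [secondTaylor, h1, deriv_comb e4 e6,
      deriv_comb (differentiable_deriv e4) (differentiable_deriv e6)]
    rfl
  rw [h2, h4, h6, div_eq_iff (mul_ne_zero (by norm_num) (discr_ne_zero τ)), discr]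
  push_cast
  linear_combination (2 * (2 * Real.pi * I) ^ 2) * (ModularForm.E₆ τ / 4 * s4 -
    ModularForm.E₄ τ / 6 * s6)

/-- The two unknown constants of the limit are fixed by the value and the second derivative at `z =
0`. -/
theorem tendsto_formA (z : ℂ) : Tendsto (fun τ => formA (τ, z)) atImInfty
    (𝓝 (exp (2 * Real.pi * I * z) + exp (-(2 * Real.pi * I * z)) - 2)) := by
  obtain ⟨a₀, a₁, h, h2⟩ := exists_tendsto_indexOneForm (k := -2) ((1 / 144 : ℂ) • ModularForm.E₆)
    ((-(1 / 144) : ℂ) • ModularForm.E₄) (by norm_num) (by norm_num) (tendsto_smul_E₆ _)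
    (tendsto_smul_E₄ _)
  rw [← formA_eq] at h h2
  have h0 := h 0
  simp only [formA_zero, mul_zero, neg_zero, exp_zero] at h0
  simp only [funext secondTaylor_formA] at h2
  have e1 := tendsto_nhds_unique h2 tendsto_const_nhds
  have e0 := tendsto_nhds_unique h0 tendsto_const_nhds
  have ha1 : a₁ = 1 := by
    have : (2 * (2 * Real.pi * I) ^ 2 : ℂ) ≠ 0 := 
      mul_ne_zero two_ne_zero (pow_ne_zero 2 two_pi_I_ne_zero)
    exact mul_right_cancel₀ this (by rw [e1, one_mul])
  have ha0 : a₀ = -2 := by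
    rw [ha1] at e0
    linear_combination e0
  have := h z
  rw [ha0, ha1] at this
  convert this using 2
  ring

/-- The relation `b₀ + 2b₁ = 12` says that the limit is nonzero at `z = 0`; the constants themselves
are not required. -/
theorem exists_tendsto_formB : ∃ b₀ b₁ : ℂ, b₀ + b₁ * 2 = 12 ∧
    ∀ z, Tendsto (fun τ => formB (τ, z)) atImInfty
      (𝓝 (b₀ + b₁ * (exp (2 * Real.pi * I * z) + exp (-(2 * Real.pi * I * z))))) := by
  obtain ⟨b₀, b₁, h, h2⟩ := exists_tendsto_indexOneForm (k := 0)
    ((1 / 144 : ℂ) • ModularForm.E₄.pow 2) ((-(1 / 144) : ℂ) • ModularForm.E₆)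
    (by norm_num) (by norm_num) (tendsto_smul_E₄_sq _) (tendsto_smul_E₆ _)
  rw [← formB_eq] at h
  refine ⟨b₀, b₁, ?_, h⟩
  have h0 := h 0
  simp only [formB_zero, mul_zero, neg_zero, exp_zero] at h0
  have := tendsto_nhds_unique h0 tendsto_const_nhds
  linear_combination this

/-! ### Expansions of theta functions in two generators -/

/-- The determinant is nonzero once the ratios `α/β` at the points are distinct. If `α/β` took
finitely many values, continuity at 0 would force `α = 0` near 0, hence everywhere. -/
theorem exists_points {α β : ℂ → ℂ} (hα : Differentiable ℂ α) (hβ : Differentiable ℂ β)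
    (h0 : α 0 = 0) (hβ0 : β 0 ≠ 0) (hne : ∃ z, α z ≠ 0) (N : ℕ) :
    ∃ z : Fin N → ℂ, (Matrix.projVandermonde (α ∘ z) (β ∘ z)).det ≠ 0 := by
  set R : Set ℂ := (fun z => α z / β z) '' {z | β z ≠ 0}
  have hinf : R.Infinite := fun hfin => by
    have hcont : ContinuousAt (fun z => α z / β z) 0 :=
      hα.continuous.continuousAt.div hβ.continuous.continuousAt hβ0
    have h1 : ∀ᶠ z in 𝓝 (0 : ℂ), β z ≠ 0 := hβ.continuous.continuousAt.eventually_ne hβ0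
    have h2 : ∀ᶠ z in 𝓝 (0 : ℂ), α z / β z ∈ (R \ {0})ᶜ :=
      hcont ((hfin.subset Set.sdiff_subset).isClosed.isOpen_compl.mem_nhds (by simp [h0]))
    have h3 : ∀ᶠ z in 𝓝 (0 : ℂ), α z = 0 := by
      filter_upwards [h1, h2] with z hz1 hz2
      by_contra hz3
      exact hz2 ⟨⟨z, hz1, rfl⟩, div_ne_zero hz3 hz1⟩
    obtain ⟨z, hz⟩ := hne
    exact hz (congrFun (AnalyticOnNhd.eq_of_eventuallyEq (g := fun _ => (0 : ℂ))
      (fun w _ => hα.analyticAt w) (fun w _ => analyticAt_const) h3) z)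
  have hmem : ∀ i : Fin N, ∃ z, β z ≠ 0 ∧ α z / β z = hinf.natEmbedding R i := fun i =>
    (hinf.natEmbedding R i).2
  choose z hz1 hz2 using hmem
  refine ⟨z, ?_⟩
  rw [Matrix.det_projVandermonde]
  refine Finset.prod_ne_zero_iff.2 fun i _ => Finset.prod_ne_zero_iff.2 fun j hj h => ?_
  have h4 : (hinf.natEmbedding R i : ℂ) = hinf.natEmbedding R j := by
    rw [← hz2 i, ← hz2 j, div_eq_div_iff (hz1 i) (hz1 j)]
    simp only [Function.comp_apply] at h
    linear_combination -h
  exact (Finset.mem_Ioi.1 hj).ne (Fin.ext ((hinf.natEmbedding R).injective (Subtype.ext h4)))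

/-- The monomials of degree `m` in two functions. -/
def binaryMonomial (α β : ℂ → ℂ) (m : ℕ) (i : Fin (m + 1)) (z : ℂ) : ℂ :=
  α z ^ (i : ℕ) * β z ^ (m - i)

theorem binaryMonomial_eq_projVandermonde (α β : ℂ → ℂ) {m : ℕ} (z : Fin (m + 1) → ℂ)
    (i j : Fin (m + 1)) :
    binaryMonomial α β m i (z j) = Matrix.projVandermonde (α ∘ z) (β ∘ z) j i := by
  rw [Matrix.projVandermonde_apply, binaryMonomial, Fin.val_rev]
  simp

/-- The explicit formula transfers regularity from the values of `g` to its coefficients, besides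
giving uniqueness. -/
theorem eq_of_sum_binaryMonomial {α β : ℂ → ℂ} {m : ℕ} {z : Fin (m + 1) → ℂ}
    (hz : (Matrix.projVandermonde (α ∘ z) (β ∘ z)).det ≠ 0) {c : Fin (m + 1) → ℂ} {g : ℂ → ℂ}
    (h : ∀ w, g w = ∑ i, c i * binaryMonomial α β m i w) :
    c = (Matrix.projVandermonde (α ∘ z) (β ∘ z))⁻¹.mulVec (g ∘ z) := by
  have h1 : (Matrix.projVandermonde (α ∘ z) (β ∘ z)).mulVec c = g ∘ z := by
    funext j
    rw [Function.comp_apply, h, Matrix.mulVec, dotProduct]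
    refine Finset.sum_congr rfl fun i _ => ?_
    rw [binaryMonomial_eq_projVandermonde, mul_comm]
  rw [← h1, Matrix.mulVec_mulVec, Matrix.nonsing_inv_mul _ (isUnit_iff_ne_zero.2 hz),
    Matrix.one_mulVec]

theorem fiberCoeff_sum {ι : Type*} (s : Finset ι) {g : ι → ℂ → ℂ} (hg : ∀ i, Continuous (g i))
    (c : ι → ℂ) (r : ℤ) :
    fiberCoeff (fun z => ∑ i ∈ s, c i * g i z) r = ∑ i ∈ s, c i * fiberCoeff (g i) r := by
  simp only [fiberCoeff, Finset.sum_mul]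
  rw [intervalIntegral.integral_finsetSum]
  · refine Finset.sum_congr rfl fun i _ => ?_
    rw [← intervalIntegral.integral_const_mul]
    simp only [mul_assoc]
  · intro i _
    have := hg i
    exact Continuous.intervalIntegrable (by fun_prop) _ _

theorem fiberCoeff_sub {g h : ℂ → ℂ} (hg : Continuous g) (hh : Continuous h) (r : ℤ) :
    fiberCoeff (fun z => g z - h z) r = fiberCoeff g r - fiberCoeff h r := by
  simp only [fiberCoeff, sub_mul]
  exact intervalIntegral.integral_sub (Continuous.intervalIntegrable (by fun_prop) _ _)
    (Continuous.intervalIntegrable (by fun_prop) _ _)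

section

variable {τ : ℂ} {m n : ℕ} {f g : ℂ → ℂ}

theorem IsThetaFunction.one : IsThetaFunction 0 τ fun _ => 1 where
  diff := differentiable_const _
  add_one _ := rfl
  add_tau z := by simp

theorem IsThetaFunction.mul (hf : IsThetaFunction m τ f) (hg : IsThetaFunction n τ g) :
    IsThetaFunction (m + n) τ fun z => f z * g z where
  diff := hf.diff.mul hg.diff
  add_one z := by rw [hf.add_one, hg.add_one]
  add_tau z := by
    rw [hf.add_tau, hg.add_tau, mul_mul_mul_comm, ← exp_add]
    congr 2
    push_cast
    ring

theorem IsThetaFunction.pow (hf : IsThetaFunction 1 τ f) :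
    ∀ n : ℕ, IsThetaFunction n τ fun z => f z ^ n
  | 0 => by simpa using IsThetaFunction.one
  | n + 1 => by simpa only [pow_succ] using (IsThetaFunction.pow hf n).mul hf

theorem IsThetaFunction.binaryMonomial (hf : IsThetaFunction 1 τ f) (hg : IsThetaFunction 1 τ g)
    (i : Fin (m + 1)) : IsThetaFunction m τ (binaryMonomial f g m i) := by
  have := (hf.pow i).mul (hg.pow (m - i))
  rwa [Nat.add_sub_of_le (Nat.lt_succ_iff.1 i.2)] at this

theorem IsThetaFunction.sum {ι : Type*} {s : Finset ι} {g : ι → ℂ → ℂ}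
    (hg : ∀ i, IsThetaFunction m τ (g i)) (c : ι → ℂ) :
    IsThetaFunction m τ fun z => ∑ i ∈ s, c i * g i z where
  diff := by
    have := fun i => (hg i).diff
    fun_prop
  add_one z := by simp only [(hg _).add_one]
  add_tau z := by
    simp only [(hg _).add_tau, Finset.mul_sum]
    exact Finset.sum_congr rfl fun i _ => by ring

theorem IsThetaFunction.sub (hf : IsThetaFunction m τ f) (hg : IsThetaFunction m τ g) :
    IsThetaFunction m τ fun z => f z - g z where
  diff := hf.diff.sub hg.diff
  add_one z := by rw [hf.add_one, hg.add_one]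
  add_tau z := by rw [hf.add_tau, hg.add_tau, mul_sub]

/-- A dimension count: the map from coefficients of monomials to the Fourier coefficients of index
`0, …, m` is injective between spaces of dimension `m + 1`, hence surjective. -/
theorem IsThetaFunction.exists_eq_sum_binaryMonomial (hτ : 0 < τ.im) {α β : ℂ → ℂ}
    (hα : IsThetaFunction 1 τ α) (hβ : IsThetaFunction 1 τ β) (hαe : ∀ z, α (-z) = α z)
    (hβe : ∀ z, β (-z) = β z) (h0 : α 0 = 0) (hβ0 : β 0 ≠ 0) (hne : ∃ z, α z ≠ 0)
    (hg : IsThetaFunction m τ g) (hge : ∀ z, g (-z) = g z) :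
    ∃ c : Fin (m + 1) → ℂ, ∀ z, g z = ∑ i, c i * WeakJacobi.binaryMonomial α β m i z := by
  obtain ⟨z, hz⟩ := exists_points hα.diff hβ.diff h0 hβ0 hne (m + 1)
  have hmon := fun i => IsThetaFunction.binaryMonomial (m := m) hα hβ i
  have hmonc := fun i => (hmon i).diff.continuous
  have hmone : ∀ i z, WeakJacobi.binaryMonomial α β m i (-z) =
      WeakJacobi.binaryMonomial α β m i z := fun i z => by
    rw [WeakJacobi.binaryMonomial, hαe, hβe, WeakJacobi.binaryMonomial]
  let T : (Fin (m + 1) → ℂ) →ₗ[ℂ] (Fin (m + 1) → ℂ) :=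
    Matrix.mulVecLin (Matrix.of fun r i => fiberCoeff (WeakJacobi.binaryMonomial α β m i) (r : ℕ))
  have hT : ∀ (c : Fin (m + 1) → ℂ) (r : Fin (m + 1)), T c r =
      fiberCoeff (fun z => ∑ i, c i * WeakJacobi.binaryMonomial α β m i z) (r : ℕ) := fun c r => by
    rw [fiberCoeff_sum _ hmonc, Matrix.mulVecLin_apply, Matrix.mulVec, dotProduct]
    exact Finset.sum_congr rfl fun i _ => by rw [Matrix.of_apply, mul_comm]
  have hinj : Function.Injective T := by
    rw [injective_iff_map_eq_zero]
    intro c hc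
    have h1 : (fun z => ∑ i, c i * WeakJacobi.binaryMonomial α β m i z) = 0 := by
      refine (IsThetaFunction.sum hmon c).eq_zero_of_even hτ ?_ fun r hr => ?_
      · intro z
        simp only [hmone]
      · exact (hT c ⟨r, Nat.lt_succ_iff.2 hr⟩).symm.trans (congrFun hc _)
    have h2 := eq_of_sum_binaryMonomial hz (c := c) (g := 0) fun w => (congrFun h1 w).symm
    rw [h2]
    exact Matrix.mulVec_zero _
  obtain ⟨c, hc⟩ := LinearMap.injective_iff_surjective.1 hinj
    fun r => fiberCoeff g ((r : ℕ) : ℤ)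
  refine ⟨c, fun z => sub_eq_zero.1 ?_⟩
  have hs := IsThetaFunction.sum (s := Finset.univ) hmon c
  refine congrFun ((hg.sub hs).eq_zero_of_even hτ (fun z => ?_) fun r hr => ?_) z
  · simp only [hge, hmone]
  · rw [fiberCoeff_sub hg.diff.continuous hs.diff.continuous, sub_eq_zero]
    exact (congrFun hc ⟨r, Nat.lt_succ_iff.2 hr⟩).symm.trans (hT c ⟨r, Nat.lt_succ_iff.2 hr⟩)

end

/-! ### Inverses of families of matrices -/

section

variable {n : Type*} [Fintype n] [DecidableEq n]

theorem differentiableAt_matrix_det {M : ℂ → Matrix n n ℂ} {x : ℂ}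
    (h : ∀ i j, DifferentiableAt ℂ (fun w => M w i j) x) :
    DifferentiableAt ℂ (fun w => (M w).det) x := by
  simp only [Matrix.det_apply]
  fun_prop

theorem differentiableAt_matrix_inv {M : ℂ → Matrix n n ℂ} {x : ℂ}
    (h : ∀ i j, DifferentiableAt ℂ (fun w => M w i j) x) (hx : (M x).det ≠ 0) (i j : n) :
    DifferentiableAt ℂ (fun w => (M w)⁻¹ i j) x := by
  simp only [Matrix.inv_def, Matrix.smul_apply, Ring.inverse_eq_inv', smul_eq_mul,
    Matrix.adjugate_apply]
  refine ((differentiableAt_matrix_det h).inv hx).mul (differentiableAt_matrix_det fun k l => ?_)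
  simp only [Matrix.updateRow_apply]
  split_ifs
  · exact differentiableAt_const _
  · exact h k l

theorem tendsto_matrix_inv {ι : Type*} {l : Filter ι} {M : ι → Matrix n n ℂ} {N : Matrix n n ℂ}
    (h : ∀ i j, Tendsto (fun w => M w i j) l (𝓝 (N i j))) (hN : N.det ≠ 0) (i j : n) :
    Tendsto (fun w => (M w)⁻¹ i j) l (𝓝 (N⁻¹ i j)) := by
  have hM : Tendsto M l (𝓝 N) := tendsto_pi_nhds.2 fun i => tendsto_pi_nhds.2 fun j => h i j
  simp only [Matrix.inv_def, Matrix.smul_apply, Ring.inverse_eq_inv', smul_eq_mul]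
  have h1 := ((continuous_id.matrix_det).tendsto N).comp hM
  have h2 := ((continuous_id.matrix_adjugate).tendsto N).comp hM
  exact (h1.inv₀ hN).mul ((tendsto_pi_nhds.1 ((tendsto_pi_nhds.1 h2) i)) j)

end

/-! ### The structure of weak Jacobi forms of even weight -/

namespace IsWeakJacobiForm

variable {k : ℤ} {m : ℕ} {Φ : ℍ × ℂ → ℂ}

theorem differentiable_right (h : IsWeakJacobiForm k m Φ) (τ : ℍ) :
    Differentiable ℂ fun z => Φ (τ, z) := fun z => by
  have h1 : DifferentiableAt ℂ (fun w : ℂ × ℂ => Φ (ofComplex w.1, w.2)) ((τ : ℂ), z) :=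
    h.holo.differentiableAt ((isOpen_im_pos.preimage continuous_fst).mem_nhds τ.im_pos)
  have h2 := DifferentiableAt.comp (f := fun z : ℂ => ((τ : ℂ), z)) z h1
    ((differentiableAt_const _).prodMk differentiableAt_id)
  refine h2.congr_of_eventuallyEq (Eventually.of_forall fun w => ?_)
  simp

theorem differentiableOn_left (h : IsWeakJacobiForm k m Φ) (z : ℂ) :
    DifferentiableOn ℂ (fun w => Φ (ofComplex w, z)) {w | 0 < w.im} :=
  h.holo.comp (f := fun w : ℂ => (w, z)) (by fun_prop) fun _ hw => hw

theorem isThetaFunction (h : IsWeakJacobiForm k m Φ) (τ : ℍ) :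
    IsThetaFunction m τ fun z => Φ (τ, z) :=
  isThetaFunction_of_lattice h.lattice (h.differentiable_right τ)

theorem even (hk : Even k) (h : IsWeakJacobiForm k m Φ) (τ : ℍ) (z : ℂ) :
    Φ (τ, -z) = Φ (τ, z) := by
  have := congrFun (h.modular (-1)) (τ, z)
  simpa [modularSlash, hk.neg_one_zpow, zpow_neg, div_neg] using this

/-- Because `n ≥ 0`, the norm of each Fourier term decreases as `Im τ` grows, so for `Im τ ≥ 1` the
series at `τ = i` dominates. -/
theorem isBoundedAtImInfty (h : IsWeakJacobiForm k m Φ) (z : ℂ) :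
    IsBoundedAtImInfty fun τ => Φ (τ, z) := by
  obtain ⟨c, -, hs⟩ := h.fourier
  rw [isBoundedAtImInfty_iff]
  refine ⟨∑' x, ‖c x * fourierMode x (UpperHalfPlane.I, z)‖, 1, fun τ hτ => ?_⟩
  have hnorm : ∀ (x : ℕ × ℤ) (τ : ℍ), ‖fourierMode x (τ, z)‖ =
      Real.exp (-(2 * Real.pi * (x.1 * τ.im + x.2 * z.im))) := fun x τ => by
    rw [fourierMode, norm_exp]
    congr 1
    rw [show 2 * (Real.pi : ℂ) * I * ((x.1 : ℂ) * ((τ, z) : ℍ × ℂ).1 + (x.2 : ℂ) * z) =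
      ((2 * Real.pi : ℝ) : ℂ) * (I * (((x.1 : ℝ) : ℂ) * τ + ((x.2 : ℝ) : ℂ) * z)) by
      push_cast; ring, re_ofReal_mul, I_mul_re, add_im, im_ofReal_mul, im_ofReal_mul, coe_im]
    ring
  have hle : ∀ x, ‖c x * fourierMode x (τ, z)‖ ≤
      ‖c x * fourierMode x (UpperHalfPlane.I, z)‖ := fun x => by
    rw [norm_mul, norm_mul, hnorm, hnorm]
    refine mul_le_mul_of_nonneg_left (Real.exp_le_exp.2 (neg_le_neg ?_)) (norm_nonneg _)
    have : (x.1 : ℝ) * UpperHalfPlane.I.im ≤ x.1 * τ.im :=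
      mul_le_mul_of_nonneg_left (by simpa using hτ) (Nat.cast_nonneg _)
    have hpi := Real.pi_pos
    gcongr
  rw [← (hs (τ, z)).tsum_eq]
  have hsum := (hs (UpperHalfPlane.I, z)).summable.norm
  exact (norm_tsum_le_tsum_norm (hsum.of_nonneg_of_le (fun _ => norm_nonneg _) hle)).trans
    ((hsum.of_nonneg_of_le (fun _ => norm_nonneg _) hle).tsum_le_tsum hle hsum)

theorem apply_smul (h : IsWeakJacobiForm k m Φ) (γ : SL(2, ℤ)) (τ : ℍ) (z : ℂ) :
    Φ (γ • τ, z / ((γ 1 0 : ℂ) * τ + (γ 1 1 : ℂ))) = ((γ 1 0 : ℂ) * τ + (γ 1 1 : ℂ)) ^ k *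
      exp (2 * Real.pi * I * (γ 1 0 * z ^ 2) / ((γ 1 0 : ℂ) * τ + (γ 1 1 : ℂ))) ^ m * Φ (τ, z) := by
  have hj := denom_ne_zero γ τ
  rw [ModularGroup.denom_apply] at hj
  have := congrFun (h.modular γ) (τ, z)
  rw [← this, modularSlash, zpow_neg]
  have hJ := zpow_ne_zero k hj
  have e : exp (-(2 * Real.pi * I * m * (γ 1 0 * z ^ 2) / ((γ 1 0 : ℂ) * τ + (γ 1 1 : ℂ)))) =
      (exp (2 * Real.pi * I * (γ 1 0 * z ^ 2) / ((γ 1 0 : ℂ) * τ + (γ 1 1 : ℂ))) ^ m)⁻¹ := by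
    rw [exp_neg, ← exp_nat_mul]
    congr 2
    ring
  simp only [e]
  have hE := pow_ne_zero m (exp_ne_zero
    (2 * Real.pi * I * (γ 1 0 * z ^ 2) / ((γ 1 0 : ℂ) * τ + (γ 1 1 : ℂ))))
  field_simp

end IsWeakJacobiForm

theorem exists_formA_ne_zero (τ : ℍ) : ∃ z, formA (τ, z) ≠ 0 := by
  by_contra! h
  have h1 := secondTaylor_formA τ
  rw [secondTaylor, funext h] at h1
  simp only [deriv_const'] at h1
  exact mul_ne_zero two_ne_zero (pow_ne_zero 2 two_pi_I_ne_zero) h1.symm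

/-- The monomials of degree `m` in the forms `A` and `B`. -/
def formMonomial (m : ℕ) (i : Fin (m + 1)) (p : ℍ × ℂ) : ℂ := formA p ^ (i : ℕ) * formB p ^ (m - i)

/-- The values of the monomials in `A` and `B` at given points. -/
def valueMatrix (m : ℕ) (z : Fin (m + 1) → ℂ) (τ : ℍ) : Matrix (Fin (m + 1)) (Fin (m + 1)) ℂ :=
  Matrix.projVandermonde ((fun z => formA (τ, z)) ∘ z) ((fun z => formB (τ, z)) ∘ z)

theorem exists_valueMatrix_det_ne_zero (m : ℕ) (τ : ℍ) : ∃ z, (valueMatrix m z τ).det ≠ 0 :=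
  exists_points (isWeakJacobiForm_formA.differentiable_right τ)
    (isWeakJacobiForm_formB.differentiable_right τ) (formA_zero τ)
    (by rw [formB_zero]; norm_num) (exists_formA_ne_zero τ) (m + 1)

/-- The points are chosen for the limit functions of `A` and `B`, so that the Vandermonde matrix
stays invertible at the cusp. -/
theorem exists_tendsto_valueMatrix (m : ℕ) : ∃ (z : Fin (m + 1) → ℂ)
    (N : Matrix (Fin (m + 1)) (Fin (m + 1)) ℂ), N.det ≠ 0 ∧
      ∀ i j, Tendsto (fun τ => valueMatrix m z τ i j) atImInfty (𝓝 (N i j)) := by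
  obtain ⟨b₀, b₁, hb, hB⟩ := exists_tendsto_formB
  set α : ℂ → ℂ := fun z => exp (2 * Real.pi * I * z) + exp (-(2 * Real.pi * I * z)) - 2
  set β : ℂ → ℂ := fun z =>
    b₀ + b₁ * (exp (2 * Real.pi * I * z) + exp (-(2 * Real.pi * I * z)))
  obtain ⟨z, hz⟩ := exists_points (α := α) (β := β) (by fun_prop) (by fun_prop)
    (by simp only [α, mul_zero, neg_zero, exp_zero]; norm_num)
    (by
      simp only [β, mul_zero, neg_zero, exp_zero]
      rw [show (1 : ℂ) + 1 = 2 by norm_num, hb]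
      norm_num)
    ⟨1 / 2, by
      have : (2 * Real.pi * I * (1 / 2) : ℂ) = Real.pi * I := by ring
      simp only [α, this, exp_neg, exp_pi_mul_I]
      norm_num⟩ (m + 1)
  refine ⟨z, Matrix.projVandermonde (α ∘ z) (β ∘ z), hz, fun i j => ?_⟩
  simp only [valueMatrix, Matrix.projVandermonde_apply, Function.comp_apply]
  exact ((tendsto_formA (z i)).pow _).mul ((hB (z i)).pow _)

theorem eq_of_sum_formMonomial {m : ℕ} {z : Fin (m + 1) → ℂ} {τ : ℍ}
    (hz : (valueMatrix m z τ).det ≠ 0) {c : Fin (m + 1) → ℂ} {Φ : ℍ × ℂ → ℂ}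
    (h : ∀ w, Φ (τ, w) = ∑ i, c i * formMonomial m i (τ, w)) (i : Fin (m + 1)) :
    c i = ∑ j, (valueMatrix m z τ)⁻¹ i j * Φ (τ, z j) :=
  congrFun (eq_of_sum_binaryMonomial (g := fun w => Φ (τ, w)) hz h) i

theorem formMonomial_coeff_unique {m : ℕ} {τ : ℍ} {c c' : Fin (m + 1) → ℂ}
    (h : ∀ w, ∑ i, c i * formMonomial m i (τ, w) = ∑ i, c' i * formMonomial m i (τ, w)) :
    c = c' := by
  obtain ⟨z, hz⟩ := exists_valueMatrix_det_ne_zero m τ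
  funext i
  rw [eq_of_sum_formMonomial (Φ := fun p => ∑ i, c i * formMonomial m i p) hz (fun w => rfl),
    eq_of_sum_formMonomial (Φ := fun p => ∑ i, c i * formMonomial m i p) hz h]

theorem formMonomial_smul {m : ℕ} (i : Fin (m + 1)) (γ : SL(2, ℤ)) (τ : ℍ) (z : ℂ) :
    formMonomial m i (γ • τ, z / ((γ 1 0 : ℂ) * τ + (γ 1 1 : ℂ))) =
      ((γ 1 0 : ℂ) * τ + (γ 1 1 : ℂ)) ^ (-2 * (i : ℤ)) *
      exp (2 * Real.pi * I * (γ 1 0 * z ^ 2) / ((γ 1 0 : ℂ) * τ + (γ 1 1 : ℂ))) ^ m *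
        formMonomial m i (τ, z) := by
  have hA := isWeakJacobiForm_formA.apply_smul γ τ z
  have hB := isWeakJacobiForm_formB.apply_smul γ τ z
  rw [pow_one] at hA hB
  rw [zpow_zero, one_mul] at hB
  rw [formMonomial, hA, hB, formMonomial, zpow_mul, zpow_natCast]
  set e := exp (2 * Real.pi * I * (γ 1 0 * z ^ 2) / ((γ 1 0 : ℂ) * τ + (γ 1 1 : ℂ)))
  have : e ^ m = e ^ (i : ℕ) * e ^ (m - i) := by
    rw [← pow_add, Nat.add_sub_of_le (Nat.lt_succ_iff.1 i.2)]
  rw [this, mul_pow, mul_pow, mul_pow]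
  ring

/-- For each `τ` the expansion exists by the dimension count; uniqueness of its coefficients gives
their modularity, and inversion of the value matrix their holomorphy and boundedness. -/
theorem IsWeakJacobiForm.exists_expansion {k : ℤ} (hk : Even k) {m : ℕ} {Φ : ℍ × ℂ → ℂ}
    (h : IsWeakJacobiForm k m Φ) : ∃ f : (i : Fin (m + 1)) → ModularForm 𝒮ℒ (k + 2 * (i : ℤ)),
      ∀ p, Φ p = ∑ i, f i p.1 * formMonomial m i p := by
  have hex : ∀ τ : ℍ, ∃ c : Fin (m + 1) → ℂ,
      ∀ z, Φ (τ, z) = ∑ i, c i * formMonomial m i (τ, z) := fun τ =>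
    IsThetaFunction.exists_eq_sum_binaryMonomial τ.im_pos
      (isWeakJacobiForm_formA.isThetaFunction τ) (isWeakJacobiForm_formB.isThetaFunction τ)
      (isWeakJacobiForm_formA.even (by decide) τ) (isWeakJacobiForm_formB.even (by decide) τ)
      (formA_zero τ) (by rw [formB_zero]; norm_num) (exists_formA_ne_zero τ) (h.isThetaFunction τ)
      (h.even hk τ)
  choose c hc using hex
  have hF : ∀ i : Fin (m + 1), ∃ F : ModularForm 𝒮ℒ (k + 2 * (i : ℤ)), ⇑F = fun τ => c τ i := fun i => by
    refine exists_modularForm (fun γ => ?_) ?_ ?_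
    · ext τ
      have hj := denom_ne_zero γ τ
      rw [ModularForm.SL_slash_apply]
      rw [ModularGroup.denom_apply] at *
      -- Expanding the transformation law of `Φ` gives two expansions in the monomials at the same
      -- `τ`; their coefficients must agree.
      have key : (fun i : Fin (m + 1) => c (γ • τ) i *
          ((γ 1 0 : ℂ) * τ + (γ 1 1 : ℂ)) ^ (-2 * (i : ℤ))) =
          fun i => ((γ 1 0 : ℂ) * τ + (γ 1 1 : ℂ)) ^ k * c τ i := by
        refine formMonomial_coeff_unique (τ := τ) fun z => ?_
        have h1 := h.apply_smul γ τ z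
        rw [hc, hc] at h1
        simp only [formMonomial_smul] at h1
        have hE := pow_ne_zero m (exp_ne_zero
          (2 * Real.pi * I * (γ 1 0 * z ^ 2) / ((γ 1 0 : ℂ) * τ + (γ 1 1 : ℂ))))
        set e := exp (2 * Real.pi * I * (γ 1 0 * z ^ 2) / ((γ 1 0 : ℂ) * τ + (γ 1 1 : ℂ))) ^ m
        refine mul_left_cancel₀ hE ?_
        rw [Finset.mul_sum] at h1 ⊢
        rw [Finset.mul_sum]
        refine Eq.trans (Finset.sum_congr rfl fun i _ => ?_) (h1.trans (Finset.sum_congr rfl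
          fun i _ => ?_)) <;> ring
      have := congrFun key i
      rw [show -(k + 2 * (i : ℤ)) = -2 * (i : ℤ) + -k by ring, zpow_add₀ hj, ← mul_assoc, this, zpow_neg]
      field_simp
    · rw [UpperHalfPlane.mdifferentiable_iff]
      intro w hw
      have hn := isOpen_im_pos.mem_nhds hw
      -- Points good at `w` remain good nearby, so the inversion formula holds in a neighbourhood.
      obtain ⟨z, hz⟩ := exists_valueMatrix_det_ne_zero m (ofComplex w)
      have hV : ∀ v, 0 < v.im → ∀ i j,
          DifferentiableAt ℂ (fun v => valueMatrix m z (ofComplex v) i j) v := fun v hv i j => by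
        have hA := (isWeakJacobiForm_formA.differentiableOn_left (z i)).differentiableAt
          (isOpen_im_pos.mem_nhds hv)
        have hB := (isWeakJacobiForm_formB.differentiableOn_left (z i)).differentiableAt
          (isOpen_im_pos.mem_nhds hv)
        simp only [valueMatrix, Matrix.projVandermonde_apply, Function.comp_apply]
        exact (hA.pow _).mul (hB.pow _)
      have hdet := (differentiableAt_matrix_det (hV w hw)).continuousAt.eventually_ne hz
      have hsum : DifferentiableAt ℂ (fun v => ∑ j, (valueMatrix m z (ofComplex v))⁻¹ i j *
          Φ (ofComplex v, z j)) w :=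
        DifferentiableAt.fun_sum fun j _ => (differentiableAt_matrix_inv (hV w hw) hz i j).mul
          ((h.differentiableOn_left (z j)).differentiableAt hn)
      refine (hsum.congr_of_eventuallyEq ?_).differentiableWithinAt
      filter_upwards [hdet] with v hv
      exact eq_of_sum_formMonomial hv (hc (ofComplex v)) i
    · obtain ⟨z, N, hN, hlim⟩ := exists_tendsto_valueMatrix m
      have hdet : ∀ᶠ τ in atImInfty, (valueMatrix m z τ).det ≠ 0 := by
        have hM : Tendsto (valueMatrix m z) atImInfty (𝓝 N) :=
          tendsto_pi_nhds.2 fun i => tendsto_pi_nhds.2 fun j => hlim i j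
        exact (((continuous_id.matrix_det).tendsto N).comp hM).eventually_ne hN
      have hsum : IsBoundedAtImInfty fun τ => ∑ j, (valueMatrix m z τ)⁻¹ i j * Φ (τ, z j) := by
        refine Asymptotics.IsBigO.fun_sum fun j _ => ?_
        exact (((tendsto_matrix_inv hlim hN i j).isBigO_one ℝ).mul
          (h.isBoundedAtImInfty (z j))).congr_right fun _ => mul_one _
      refine Asymptotics.IsBigO.congr' hsum ?_ EventuallyEq.rfl
      filter_upwards [hdet] with τ hτ
      exact (eq_of_sum_formMonomial hτ (hc τ) i).symm
  choose f hf using hF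
  refine ⟨f, fun p => ?_⟩
  rw [← Prod.mk.eta (p := p), hc]
  refine Finset.sum_congr rfl fun i _ => ?_
  rw [hf]

/-! ### Generation and independence of `E₄` and `E₆` -/

theorem exists_eq_two_mul_add_three_mul {κ : ℤ} (h : 2 ≤ κ) :
    ∃ a b : ℕ, κ = 2 * a + 3 * b := by
  rcases Int.even_or_odd' κ with ⟨c, rfl | rfl⟩
  · exact ⟨c.toNat, 0, by omega⟩
  · exact ⟨(c - 1).toNat, 1, by omega⟩

theorem exists_modularForm_monomial (a b : ℕ) : ∃ G : ModularForm 𝒮ℒ (2 * (2 * a + 3 * b)),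
    ⇑G = ModularForm.E₄ ^ a * ModularForm.E₆ ^ b :=
  ⟨ModularForm.mcast (by ring) ((ModularForm.E₄.pow a).mul (ModularForm.E₆.pow b)), by
    ext τ
    simp⟩

theorem exists_eq_discr_mul {k : ℤ} {f : ModularForm 𝒮ℒ k} (hf : Tendsto f atImInfty (𝓝 0)) :
    ∃ g : ModularForm 𝒮ℒ (k - 12), ⇑f = discr * g := by
  have h0 := tendsto_nhds_unique (tendsto_modularForm f) hf
  refine ⟨CuspForm.discriminantEquiv (ModularForm.toCuspForm f h0), ?_⟩
  rw [funext discr_eq]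
  exact (ModularForm.discriminant_mul_discriminantEquiv (ModularForm.toCuspForm f h0)).symm

/-- Modular forms of level one are polynomials in `E₄` and `E₆`: an induction principle. -/
theorem modularForm_induction {C : ℤ → (ℍ → ℂ) → Prop} (zero : ∀ κ, C κ 0) (one : C 0 1)
    (E₄ : C 2 ModularForm.E₄) (E₆ : C 3 ModularForm.E₆)
    (mul : ∀ κ l f g, C κ f → C l g → C (κ + l) (f * g))
    (add : ∀ κ f g, C κ f → C κ g → C κ (f + g)) (smul : ∀ κ (c : ℂ) f, C κ f → C κ (c • f))
    (κ : ℤ) (f : ModularForm 𝒮ℒ (2 * κ)) : C κ f := by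
  have pow : ∀ (n : ℕ) κ f, C κ f → C (n * κ) (f ^ n) := fun n κ f hf => by
    induction n with
    | zero => simpa using one
    | succ n ih =>
      rw [pow_succ, Nat.cast_succ, add_mul, one_mul]
      exact mul _ _ _ _ ih hf
  have mono : ∀ a b : ℕ, C (2 * a + 3 * b) (ModularForm.E₄ ^ a * ModularForm.E₆ ^ b) := fun a b => by
    rw [mul_comm 2, mul_comm 3]
    exact mul _ _ _ _ (pow a 2 _ E₄) (pow b 3 _ E₆)
  have hdiscr : C 6 discr := by
    have h1 := add 6 _ _ (smul _ (1 / 1728) _ (mono 3 0)) (smul _ (-(1 / 1728)) _ (mono 0 2))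
    convert h1 using 1
    ext τ
    simp [discr]
    ring
  -- Induction on the weight: removing a multiple of a monomial kills the constant term, and
  -- division by `Δ` then lowers `κ` by 6. The base cases are negative weight, weight 0 (constants)
  -- and weight 2 (zero).
  suffices h : ∀ (n : ℕ) (κ : ℤ), κ < n → ∀ f : ModularForm 𝒮ℒ (2 * κ), C κ f from
    h (κ.toNat + 1) κ (by omega) f
  intro n
  induction n with
  | zero =>
    intro κ hκ f
    have := rank_zero_iff_forall_zero.1
      (ModularForm.levelOne_neg_weight_rank_zero (k := 2 * κ) (by omega)) f
    rw [this]
    exact zero κ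
  | succ n ih =>
    intro κ hκ f
    rcases lt_or_ge κ 0 with h | h
    · exact ih κ (by omega) f
    rcases le_or_gt 2 κ with h2 | h2
    · obtain ⟨a, b, rfl⟩ := exists_eq_two_mul_add_three_mul h2
      obtain ⟨G, hG⟩ := exists_modularForm_monomial a b
      have hG1 : Tendsto G atImInfty (𝓝 1) := by
        have := (tendsto_E₄.pow a).mul (tendsto_E₆.pow b)
        rw [one_pow, one_pow, mul_one] at this
        rw [hG]
        exact this
      have hf := tendsto_modularForm f
      set s := (qExpansion 1 f).coeff 0
      have hlim : Tendsto (⇑(f - s • G)) atImInfty (𝓝 0) := by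
        have := hf.sub (hG1.const_mul s)
        rw [mul_one, sub_self] at this
        exact this
      obtain ⟨g, hg⟩ := exists_eq_discr_mul hlim
      have h3 := ih (2 * a + 3 * b - 6) (by omega) (ModularForm.mcast (by ring) g)
      have h4 := add _ _ _ (smul _ s _ (mono a b)) (mul _ _ _ _ hdiscr h3 |> fun h => by
        rwa [add_sub_cancel] at h)
      convert h4 using 1
      rw [ModularForm.coe_mcast, ← hg, ← hG]
      ext τ
      simp
    · rcases (by omega : κ = 0 ∨ κ = 1) with rfl | rfl
      · have : ModularFormClass (ModularForm 𝒮ℒ (2 * 0)) 𝒮ℒ 0 :=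
          inferInstanceAs (ModularFormClass (ModularForm 𝒮ℒ (2 * 0)) 𝒮ℒ (2 * 0))
        obtain ⟨c, hc⟩ := ModularFormClass.levelOne_weight_zero_const f
        rw [hc]
        have := smul 0 c 1 one
        convert this using 1
        ext
        simp
      · have := rank_zero_iff_forall_zero.1 ModularForm.levelOne_weight_two_rank_zero
          (ModularForm.mcast (by norm_num) f)
        have h0 : (f : ℍ → ℂ) = 0 := by
          ext τ
          simpa using DFunLike.congr_fun this τ
        rw [h0]
        exact zero 1

/-- The ratio tends to 1 at the cusp but never equals 1, because `Δ` has no zeros; a finite set of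
values would be closed and could not accumulate there. -/
theorem infinite_ratio : {u : ℂ | ∃ τ : ℍ, ModularForm.E₄ τ ≠ 0 ∧ ModularForm.E₆ τ ≠ 0 ∧
    u = ModularForm.E₄ τ ^ 3 / ModularForm.E₆ τ ^ 2}.Infinite := fun hfin => by
  have h1 := (tendsto_E₄.pow 3).div (tendsto_E₆.pow 2) (by norm_num)
  rw [one_pow, one_pow, div_one] at h1
  have h2 := h1 (hfin.isClosed.isOpen_compl.mem_nhds (x := (1 : ℂ)) (by
    rintro ⟨τ, -, h6, h⟩
    rw [eq_comm, div_eq_one_iff_eq (pow_ne_zero 2 h6)] at h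
    exact discr_ne_zero τ (by rw [discr, h, sub_self, zero_div])))
  obtain ⟨τ, hτ, h4, h6⟩ := (Filter.Eventually.and (Filter.mem_map.1 h2)
    ((tendsto_E₄.eventually_ne one_ne_zero).and (tendsto_E₆.eventually_ne one_ne_zero))).exists
  exact hτ ⟨τ, h4, h6, rfl⟩

/-- With `u = E₄³/E₆²`, multiplying `E₄^a E₆^b` by `(E₄/E₆)^N`, where `N = 2a + 3b`, gives `u^(a +
b)`. A relation becomes a polynomial in `u` with infinitely many roots, and `a = 3(a + b) - N` keeps
the exponents distinct. -/
theorem eisenstein_independent {ι : Type*} (s : Finset ι) (a b : ι → ℕ) (N : ℕ)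
    (hN : ∀ i ∈ s, 2 * a i + 3 * b i = N) (hinj : Set.InjOn a s) (c : ι → ℂ)
    (h : ∀ τ, ∑ i ∈ s, c i * (ModularForm.E₄ τ ^ a i * ModularForm.E₆ τ ^ b i) = 0) :
    ∀ i ∈ s, c i = 0 := by
  set p : Polynomial ℂ := ∑ i ∈ s, Polynomial.monomial (a i + b i) (c i)
  have hp : p = 0 := by
    refine Polynomial.eq_zero_of_infinite_isRoot p (infinite_ratio.mono ?_)
    rintro u ⟨τ, h4, h6, rfl⟩
    set x := ModularForm.E₄ τ
    set y := ModularForm.E₆ τ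
    have e4 : (x / y) ^ 2 * x = x ^ 3 / y ^ 2 := by field_simp
    have e6 : (x / y) ^ 3 * y = x ^ 3 / y ^ 2 := by field_simp
    have h1 : ∑ i ∈ s, c i * (x ^ 3 / y ^ 2) ^ (a i + b i) = 0 := by
      rw [← mul_zero ((x / y) ^ N), ← h τ, Finset.mul_sum]
      refine Finset.sum_congr rfl fun i hi => ?_
      rw [pow_add, ← hN i hi]
      nth_rw 1 [← e4]
      rw [← e6, mul_pow, mul_pow, pow_add, pow_mul, pow_mul]
      ring
    simpa [p, Polynomial.IsRoot, Polynomial.eval_finsetSum] using h1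
  intro i hi
  have h2 := congrArg (fun p => Polynomial.coeff p (a i + b i)) hp
  simp only [p, Polynomial.finsetSum_coeff, Polynomial.coeff_monomial, Polynomial.coeff_zero] at h2
  rw [Finset.sum_eq_single i] at h2
  · simpa using h2
  · intro j hj hji
    refine if_neg fun h3 => hji (hinj hj hi ?_)
    have := hN i hi
    have := hN j hj
    omega
  · exact fun h => absurd hi h

/-! ### The algebra of weak Jacobi forms as a polynomial algebra -/

/-- The elements of the algebra, as functions. -/
def toFun : JacobiAlgebra →ₐ[ℂ] (ℍ × ℂ → ℂ) := DirectSum.coeAlgHom component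

@[simp] theorem toFun_incl (i : ℤ × ℕ) (x : component i) : toFun (incl i x) = x :=
  DirectSum.coeAlgHom_of component i x

theorem incl_mul_incl (i j : ℤ × ℕ) (x : component i) (y : component j) :
    incl i x * incl j y = incl (i + j) ⟨x * y, SetLike.mul_mem_graded x.2 y.2⟩ :=
  DirectSum.of_mul_of (A := fun i => component i) x y

instance : SetLike.GradedMonoid homogeneous where
  one_mem := ⟨⟨1, SetLike.one_mem_graded component⟩, rfl⟩
  mul_mem := by
    rintro i j _ _ ⟨x, rfl⟩ ⟨y, rfl⟩
    exact ⟨_, (incl_mul_incl i j x y).symm⟩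

theorem incl_mem (i : ℤ × ℕ) (x : component i) : incl i x ∈ homogeneous i := ⟨x, rfl⟩

/-- Injectivity of `toFun` is clear only inside one component, so comparisons of functions are made
between elements of equal bidegree. -/
theorem eq_of_toFun_eq {i : ℤ × ℕ} {f g : JacobiAlgebra} (hf : f ∈ homogeneous i)
    (hg : g ∈ homogeneous i) (h : toFun f = toFun g) : f = g := by
  obtain ⟨x, rfl⟩ := hf
  obtain ⟨y, rfl⟩ := hg
  rw [toFun_incl, toFun_incl] at h
  rw [Subtype.ext h]

theorem jacobiAlgebra_induction {P : JacobiAlgebra → Prop}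
    (incl : ∀ i x, P (incl i x)) (add : ∀ f g, P f → P g → P (f + g)) (f : JacobiAlgebra) : P f :=
  DirectSum.induction_on (motive := P) f ((map_zero (WeakJacobi.incl 0)) ▸ incl 0 0) incl add

@[simp] theorem toFun_ofModular (κ : ℤ) (f : ModularForm 𝒮ℒ (2 * κ)) :
    toFun (ofModular κ f) = fun p => f p.1 := toFun_incl _ _

theorem ofModular_mem (κ : ℤ) (f : ModularForm 𝒮ℒ (2 * κ)) :
    ofModular κ f ∈ homogeneous (κ, 0) := incl_mem _ _

/-- The form `A` as a homogeneous element of the algebra. -/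
def elemA : component (-1, 1) := ⟨formA, isWeakJacobiForm_formA⟩

/-- The form `B` as a homogeneous element of the algebra. -/
def elemB : component (0, 1) := ⟨formB, isWeakJacobiForm_formB⟩

/-- The generators `E₄`, `E₆`, `A`, `B`. -/
def generator : Fin 4 → JacobiAlgebra :=
  ![ofModular 2 (ModularForm.mcast (by norm_num) ModularForm.E₄),
    ofModular 3 (ModularForm.mcast (by norm_num) ModularForm.E₆), incl _ elemA, incl _ elemB]

/-- The bidegrees of the generators. -/
def bidegree : Fin 4 → ℤ × ℕ := ![(2, 0), (3, 0), (-1, 1), (0, 1)]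

theorem generator_mem (j : Fin 4) : generator j ∈ homogeneous (bidegree j) := by
  fin_cases j
  · exact ofModular_mem 2 _
  · exact ofModular_mem 3 _
  · exact incl_mem _ _
  · exact incl_mem _ _

theorem toFun_generator (j : Fin 4) : toFun (generator j) =
    ![fun p => ModularForm.E₄ p.1, fun p => ModularForm.E₆ p.1, formA, formB] j := by
  fin_cases j
  · exact toFun_ofModular 2 _
  · exact toFun_ofModular 3 _
  · exact toFun_incl _ _
  · exact toFun_incl _ _

/-- Evaluation of polynomials at the generators. -/
def evalGenerators : MvPolynomial (Fin 4) ℂ →ₐ[ℂ] JacobiAlgebra := MvPolynomial.aeval generator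

theorem evalGenerators_monomial_mem (d : Fin 4 →₀ ℕ) (c : ℂ) :
    evalGenerators (MvPolynomial.monomial d c) ∈ homogeneous (Finsupp.weight bidegree d) := by
  rw [evalGenerators, MvPolynomial.aeval_monomial, ← Algebra.smul_def, Finsupp.weight_apply]
  exact Submodule.smul_mem _ _ (SetLike.prod_pow_mem_graded _ _ _ _ fun j _ => generator_mem j)

theorem evalGenerators_mem {p : MvPolynomial (Fin 4) ℂ} {i : ℤ × ℕ}
    (h : IsWeightedHomogeneous bidegree p i) : evalGenerators p ∈ homogeneous i := by
  rw [p.as_sum, map_sum]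
  refine Submodule.sum_mem _ fun d hd => ?_
  rw [← h (MvPolynomial.mem_support_iff.1 hd)]
  exact evalGenerators_monomial_mem d _

/-- The Serre derivation and its extension, on polynomials in the generators. -/
def polyDerivation (a b : ℂ) : Derivation ℂ (MvPolynomial (Fin 4) ℂ) (MvPolynomial (Fin 4) ℂ) :=
  MvPolynomial.mkDerivation ℂ
    ![-(1 / 3 : ℂ) • MvPolynomial.X 1, -(1 / 2 : ℂ) • MvPolynomial.X 0 ^ 2,
      a • MvPolynomial.X 3, b • (MvPolynomial.X 0 * MvPolynomial.X 2)]

/-- One induction over the ring of modular forms yields the polynomial together with the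
compatibility of `polyDerivation` with the Serre derivative: both obey the Leibniz rule, and they
agree on `E₄` and `E₆` by Ramanujan's identities. -/
theorem exists_poly_modularForm (κ : ℤ) (f : ModularForm 𝒮ℒ (2 * κ)) :
    MDiff ⇑f ∧ ∃ p, IsWeightedHomogeneous bidegree p (κ, 0) ∧
      (toFun (evalGenerators p) = fun w => f w.1) ∧
      ∀ a b, toFun (evalGenerators (polyDerivation a b p)) =
        fun w => serreDerivative ((2 * κ : ℤ) : ℂ) f w.1 := by
  refine modularForm_induction (C := fun κ φ => MDiff φ ∧
    ∃ p, IsWeightedHomogeneous bidegree p (κ, 0) ∧ (toFun (evalGenerators p) = fun w => φ w.1) ∧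
      ∀ a b, toFun (evalGenerators (polyDerivation a b p)) =
        fun w => serreDerivative ((2 * κ : ℤ) : ℂ) φ w.1) ?_ ?_ ?_ ?_ ?_ ?_ ?_ κ f
  · refine fun κ => ⟨mdifferentiable_const, 0, MvPolynomial.isWeightedHomogeneous_zero _ _ _,
      by rw [map_zero, map_zero]; rfl, fun a b => ?_⟩
    have := serreDerivative_smul ((2 * κ : ℤ) : ℂ) 0 (0 : ℍ → ℂ) mdifferentiable_const
    rw [zero_smul, zero_smul] at this
    rw [this, map_zero, map_zero, map_zero]
    rfl
  · refine ⟨mdifferentiable_const, 1, MvPolynomial.isWeightedHomogeneous_one _ _,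
      by rw [map_one, map_one]; rfl, fun a b => ?_⟩
    have := serreDerivative_mul 0 0 (1 : ℍ → ℂ) 1 mdifferentiable_const mdifferentiable_const
    rw [mul_one, one_mul, mul_one, add_zero, left_eq_add] at this
    rw [mul_zero, Int.cast_zero, this, Derivation.map_one_eq_zero, map_zero, map_zero]
    rfl
  · refine ⟨ModularFormClass.holo _, MvPolynomial.X 0, MvPolynomial.isWeightedHomogeneous_X _ _ 0,
      by simp [evalGenerators, toFun_generator], fun a b => ?_⟩
    ext w
    have := serreDerivative_E₄ w.1
    norm_num at this ⊢
    rw [this]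
    simp [evalGenerators, polyDerivation, toFun_generator]
  · refine ⟨ModularFormClass.holo _, MvPolynomial.X 1, MvPolynomial.isWeightedHomogeneous_X _ _ 1,
      by simp [evalGenerators, toFun_generator], fun a b => ?_⟩
    ext w
    have := serreDerivative_E₆ w.1
    norm_num at this ⊢
    rw [this]
    simp [evalGenerators, polyDerivation, toFun_generator]
  · rintro κ l f g ⟨hf, p, hp, hpf, hpd⟩ ⟨hg, q, hq, hqg, hqd⟩
    refine ⟨hf.mul hg, p * q, hp.mul hq, by rw [map_mul, map_mul, hpf, hqg]; rfl, fun a b => ?_⟩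
    rw [Derivation.leibniz, smul_eq_mul, smul_eq_mul, mul_add, Int.cast_add,
      serreDerivative_mul _ _ f g hf hg]
    simp only [map_add, map_mul, hpf, hqg, hpd, hqd]
    ext w
    simp only [Pi.add_apply, Pi.mul_apply]
    ring
  · rintro κ f g ⟨hf, p, hp, hpf, hpd⟩ ⟨hg, q, hq, hqg, hqd⟩
    refine ⟨hf.add hg, p + q, hp.add hq, by rw [map_add, map_add, hpf, hqg]; rfl, fun a b => ?_⟩
    rw [map_add, serreDerivative_add _ f g hf hg]
    simp only [map_add, hpd, hqd]
    rfl
  · rintro κ c f ⟨hf, p, hp, hpf, hpd⟩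
    refine ⟨hf.const_smul c, c • p, Submodule.smul_mem
      (MvPolynomial.weightedHomogeneousSubmodule ℂ bidegree (κ, 0)) c hp,
      by rw [map_smul, map_smul, hpf]; rfl, fun a b => ?_⟩
    rw [Derivation.map_smul, serreDerivative_smul _ c f hf]
    simp only [map_smul, hpd]
    rfl

theorem exists_evalGenerators_eq {i : ℤ × ℕ} {f : JacobiAlgebra} (hf : f ∈ homogeneous i) :
    ∃ p, IsWeightedHomogeneous bidegree p i ∧ evalGenerators p = f := by
  obtain ⟨κ, m⟩ := i
  obtain ⟨⟨Φ, hΦ⟩, rfl⟩ := hf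
  obtain ⟨F, hF⟩ := IsWeakJacobiForm.exists_expansion (even_two_mul κ) hΦ
  have hex : ∀ j : Fin (m + 1), ∃ p, IsWeightedHomogeneous bidegree p (κ + j, 0) ∧
      (toFun (evalGenerators p) = fun w => F j w.1) := fun j => by
    obtain ⟨-, p, hp, hpF, -⟩ := exists_poly_modularForm (κ + j) (ModularForm.mcast (by ring) (F j))
    exact ⟨p, hp, hpF⟩
  choose P hP hPF using hex
  have hw : IsWeightedHomogeneous bidegree
      (∑ j : Fin (m + 1), P j * (MvPolynomial.X 2 ^ (j : ℕ) * MvPolynomial.X 3 ^ (m - j))) (κ, m) := by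
    refine IsWeightedHomogeneous.sum _ _ _ fun j _ => ?_
    have := (hP j).mul (((MvPolynomial.isWeightedHomogeneous_X ℂ bidegree 2).pow j).mul
      ((MvPolynomial.isWeightedHomogeneous_X ℂ bidegree 3).pow (m - j)))
    convert this using 1
    have := Nat.lt_succ_iff.1 j.2
    simp [bidegree]
    omega
  refine ⟨_, hw, eq_of_toFun_eq (evalGenerators_mem hw) (incl_mem _ _) ?_⟩
  ext w
  rw [toFun_incl]
  simp only [hF, map_sum, map_mul, hPF, map_pow, Finset.sum_apply, Pi.mul_apply, Pi.pow_apply]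
  refine Finset.sum_congr rfl fun j _ => ?_
  simp [evalGenerators, toFun_generator, formMonomial]

theorem evalGenerators_surjective : Function.Surjective evalGenerators :=
  jacobiAlgebra_induction
    (fun i x => by
      obtain ⟨p, -, hp⟩ := exists_evalGenerators_eq (incl_mem i x)
      exact ⟨p, hp⟩)
    (by
      rintro _ _ ⟨p, rfl⟩ ⟨q, rfl⟩
      exact ⟨p + q, map_add _ _ _⟩)

/-- The homogeneous component of an element of the algebra, as a function. -/
def componentFun (i : ℤ × ℕ) : JacobiAlgebra →ₗ[ℂ] (ℍ × ℂ → ℂ) :=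
  extend fun j => if j = i then (component j).subtype else 0

theorem componentFun_of_mem {i j : ℤ × ℕ} {f : JacobiAlgebra} (hf : f ∈ homogeneous j) :
    componentFun i f = if j = i then toFun f else 0 := by
  obtain ⟨x, rfl⟩ := hf
  rw [componentFun, extend_incl, toFun_incl]
  split_ifs <;> rfl

theorem toFun_evalGenerators_monomial (d : Fin 4 →₀ ℕ) (c : ℂ) (p : ℍ × ℂ) :
    toFun (evalGenerators (MvPolynomial.monomial d c)) p =
      c * (ModularForm.E₄ p.1 ^ d 0 * ModularForm.E₆ p.1 ^ d 1) * (formA p ^ d 2 * formB p ^ d 3) := by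
  rw [evalGenerators, MvPolynomial.aeval_monomial, Finsupp.prod_fintype _ _ (by simp)]
  simp only [Fin.prod_univ_four, map_mul, map_pow, toFun_generator, ← Algebra.smul_def, map_smul]
  simp
  ring

theorem weight_bidegree (d : Fin 4 →₀ ℕ) :
    Finsupp.weight bidegree d = (2 * (d 0 : ℤ) + 3 * d 1 - d 2, d 2 + d 3) := by
  rw [Finsupp.weight_apply, Finsupp.sum_fintype _ _ (by simp)]
  ext <;> simp [Fin.sum_univ_four, bidegree]
  ring

theorem eq_of_weight_eq {d d' : Fin 4 →₀ ℕ}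
    (h1 : 2 * (d 0 : ℤ) + 3 * d 1 - d 2 = 2 * (d' 0 : ℤ) + 3 * d' 1 - d' 2)
    (h2 : d 2 + d 3 = d' 2 + d' 3) (h3 : d 0 = d' 0) (h4 : d 2 = d' 2) : d = d' := by
  have h5 : d 1 = d' 1 := by omega
  have h6 : d 3 = d' 3 := by omega
  ext j
  fin_cases j
  exacts [h3, h5, h4, h6]

/-- Independence in two stages: at fixed `τ` the monomials in `A`, `B` separate the exponents `d 2`,
and the remaining relation of fixed weight between `E₄` and `E₆` is trivial. -/
theorem coeff_eq_zero_of_sum_eq_zero {s : Finset (Fin 4 →₀ ℕ)} {κ : ℤ} {m : ℕ}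
    (hs : ∀ d ∈ s, 2 * (d 0 : ℤ) + 3 * d 1 - d 2 = κ ∧ d 2 + d 3 = m) (c : (Fin 4 →₀ ℕ) → ℂ)
    (h : ∀ w, ∑ d ∈ s, c d * (ModularForm.E₄ w.1 ^ d 0 * ModularForm.E₆ w.1 ^ d 1) *
      (formA w ^ d 2 * formB w ^ d 3) = 0) : ∀ d ∈ s, c d = 0 := by
  have hlt : ∀ d ∈ s, d 2 < m + 1 := fun d hd => by have := hs d hd; omega
  have h1 : ∀ τ, ∀ j : Fin (m + 1), ∑ d ∈ s with d 2 = (j : ℕ), c d *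
      (ModularForm.E₄ τ ^ d 0 * ModularForm.E₆ τ ^ d 1) = 0 := by
    intro τ
    refine congrFun (formMonomial_coeff_unique (m := m) (τ := τ) (c' := 0) fun z => ?_)
    simp only [Pi.zero_apply, zero_mul, Finset.sum_const_zero]
    rw [← h (τ, z), ← Finset.sum_fiberwise_of_maps_to (s := s) (t := Finset.range (m + 1))
      (g := fun d => d 2) fun d hd => Finset.mem_range.2 (hlt d hd), Finset.sum_range]
    refine Finset.sum_congr rfl fun j _ => ?_
    rw [Finset.sum_mul]
    refine Finset.sum_congr rfl fun d hd => ?_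
    obtain ⟨hd, hdj⟩ := Finset.mem_filter.1 hd
    have := (hs d hd).2
    rw [formMonomial, ← hdj, show m - d 2 = d 3 by omega]
  intro d₀ hd₀
  refine eisenstein_independent _ (fun d => d 0) (fun d => d 1) (κ + d₀ 2).toNat
    (fun d hd => ?_) (fun d hd d' hd' h => ?_) c (fun τ => h1 τ ⟨d₀ 2, hlt _ hd₀⟩) d₀
    (Finset.mem_filter.2 ⟨hd₀, rfl⟩)
  · obtain ⟨hd, h2⟩ := Finset.mem_filter.1 hd
    have := hs d hd
    simp only at h2
    omega
  · obtain ⟨hd, h2⟩ := Finset.mem_filter.1 hd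
    obtain ⟨hd', h2'⟩ := Finset.mem_filter.1 hd'
    have h3 := hs d hd
    have h4 := hs d' hd'
    exact eq_of_weight_eq (h3.1.trans h4.1.symm) (h3.2.trans h4.2.symm) h (h2.trans h2'.symm)

/-- Projection to the bidegree of a given monomial isolates the terms of that bidegree, where the
function-level independence applies. -/
theorem evalGenerators_injective : Function.Injective evalGenerators := by
  rw [injective_iff_map_eq_zero]
  intro p hp
  ext d₀
  rw [MvPolynomial.coeff_zero]
  by_cases hd₀ : d₀ ∈ p.support
  swap
  · exact MvPolynomial.notMem_support_iff.1 hd₀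
  refine coeff_eq_zero_of_sum_eq_zero (fun d hd => ?_) p.coeff (fun w => ?_) d₀
    (Finset.mem_filter.2 ⟨hd₀, rfl⟩ :
      d₀ ∈ p.support.filter fun d => Finsupp.weight bidegree d = Finsupp.weight bidegree d₀)
    (κ := (Finsupp.weight bidegree d₀).1) (m := (Finsupp.weight bidegree d₀).2)
  · have := (Finset.mem_filter.1 hd).2
    nth_rw 1 [weight_bidegree] at this
    exact Prod.ext_iff.1 this
  · have h1 : componentFun (Finsupp.weight bidegree d₀) (evalGenerators p) w = 0 := by
      rw [hp, map_zero]
      rfl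
    rw [p.as_sum, map_sum, map_sum, Finset.sum_apply] at h1
    refine Eq.trans ?_ h1
    rw [Finset.sum_filter]
    refine Finset.sum_congr rfl fun d _ => ?_
    rw [componentFun_of_mem (evalGenerators_monomial_mem d _)]
    split_ifs
    · rw [toFun_evalGenerators_monomial]
    · rfl

/-- The algebra of weak Jacobi forms is a polynomial algebra in `E₄`, `E₆`, `A`, `B`. -/
def polyEquiv : MvPolynomial (Fin 4) ℂ ≃ₐ[ℂ] JacobiAlgebra :=
  AlgEquiv.ofBijective evalGenerators ⟨evalGenerators_injective, evalGenerators_surjective⟩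

theorem polyEquiv_apply (p : MvPolynomial (Fin 4) ℂ) : polyEquiv p = evalGenerators p := rfl

theorem polyEquiv_X (j : Fin 4) : polyEquiv (MvPolynomial.X j) = generator j :=
  MvPolynomial.aeval_X _ _

theorem polyEquiv_mem_iff {p : MvPolynomial (Fin 4) ℂ} {i : ℤ × ℕ} :
    polyEquiv p ∈ homogeneous i ↔ IsWeightedHomogeneous bidegree p i := by
  refine ⟨fun h => ?_, evalGenerators_mem⟩
  obtain ⟨q, hq, hqp⟩ := exists_evalGenerators_eq h
  rwa [← evalGenerators_injective hqp]

end

open MvPolynomial (IsWeightedHomogeneous)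

/-! ### The derivations `S_{a,b}` -/

theorem isWeightedHomogeneous_mkDerivation {σ M : Type*} [AddCommMonoid M] {w : σ → M} {δ : M}
    {F : σ → MvPolynomial σ ℂ} (hF : ∀ j, IsWeightedHomogeneous w (F j) (w j + δ))
    {p : MvPolynomial σ ℂ} {i : M} (hp : IsWeightedHomogeneous w p i) :
    IsWeightedHomogeneous w (MvPolynomial.mkDerivation ℂ F p) (i + δ) := by
  refine IsWeightedHomogeneous.induction_on
    (motive := fun p _ => IsWeightedHomogeneous w (MvPolynomial.mkDerivation ℂ F p) (i + δ))
    ?_ (fun p q _ _ hp hq => ?_) (fun d r hr => ?_) hp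
  · rw [map_zero]
    exact MvPolynomial.isWeightedHomogeneous_zero _ _ _
  · rw [map_add]
    exact hp.add hq
  · rw [MvPolynomial.mkDerivation_monomial]
    refine Submodule.smul_mem (MvPolynomial.weightedHomogeneousSubmodule ℂ w (i + δ)) r
      (Submodule.sum_mem _ fun j hj => ?_)
    have := (MvPolynomial.isWeightedHomogeneous_monomial w (d - Finsupp.single j 1) ((d j : ℕ) : ℂ)
      rfl).mul (hF j)
    rwa [← add_assoc, Finsupp.weight_sub_single_add (Finsupp.mem_support_iff.1 hj), hr] at this

theorem isWeightedHomogeneous_polyDerivation (a b : ℂ) {p : MvPolynomial (Fin 4) ℂ} {i : ℤ × ℕ}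
    (hp : IsWeightedHomogeneous bidegree p i) :
    IsWeightedHomogeneous bidegree (polyDerivation a b p) (i + (1, 0)) := by
  refine isWeightedHomogeneous_mkDerivation (fun j => ?_) hp
  have hX := MvPolynomial.isWeightedHomogeneous_X ℂ bidegree
  have hs : ∀ (c : ℂ) {i} {p : MvPolynomial (Fin 4) ℂ}, IsWeightedHomogeneous bidegree p i →
      IsWeightedHomogeneous bidegree (c • p) i := fun c i p h =>
    Submodule.smul_mem (MvPolynomial.weightedHomogeneousSubmodule ℂ bidegree i) c h
  fin_cases j
  · exact hs _ (hX 1)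
  · exact hs _ ((hX 0).pow 2)
  · exact hs _ (hX 3)
  · exact hs _ ((hX 0).mul (hX 2))

/-- The derivation `S_{a,b}` of the algebra of weak Jacobi forms. -/
def jacobiDerivation (a b : ℂ) : Derivation ℂ JacobiAlgebra JacobiAlgebra :=
  Derivation.mk' (polyEquiv.toLinearMap ∘ₗ (polyDerivation a b).toLinearMap ∘ₗ
    polyEquiv.symm.toLinearMap) fun f g => by
    simp [Derivation.leibniz]

theorem jacobiDerivation_polyEquiv (a b : ℂ) (p : MvPolynomial (Fin 4) ℂ) :
    jacobiDerivation a b (polyEquiv p) = polyEquiv (polyDerivation a b p) :=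
  congrArg (fun q => polyEquiv (polyDerivation a b q)) (polyEquiv.symm_apply_apply p)

theorem jacobiDerivation_mem (a b : ℂ) {i : ℤ × ℕ} {f : JacobiAlgebra} (hf : f ∈ homogeneous i) :
    jacobiDerivation a b f ∈ homogeneous (i + (1, 0)) := by
  obtain ⟨p, rfl⟩ := polyEquiv.surjective f
  rw [jacobiDerivation_polyEquiv]
  exact polyEquiv_mem_iff.2 (isWeightedHomogeneous_polyDerivation a b (polyEquiv_mem_iff.1 hf))

theorem jacobiDerivation_generator (a b : ℂ) (j : Fin 4) : jacobiDerivation a b (generator j) =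
    ![-(1 / 3 : ℂ) • generator 1, -(1 / 2 : ℂ) • generator 0 ^ 2,
      a • generator 3, b • (generator 0 * generator 2)] j := by
  rw [← polyEquiv_X, jacobiDerivation_polyEquiv, polyDerivation, MvPolynomial.mkDerivation_X]
  fin_cases j <;> simp [polyEquiv_X]

theorem derivation_ext_generator {D D' : Derivation ℂ JacobiAlgebra JacobiAlgebra}
    (h : ∀ j, D (generator j) = D' (generator j)) : D = D' := by
  refine Derivation.ext_of_adjoin_eq_top (Set.range generator) ?_ ?_
  · rw [Algebra.adjoin_range_eq_range_aeval, AlgHom.range_eq_top]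
    exact evalGenerators_surjective
  · rintro _ ⟨j, rfl⟩
    exact h j

theorem exists_serre_ofModular (a b : ℂ) (κ : ℤ) (f : ModularForm 𝒮ℒ (2 * κ)) :
    ∃ h : ModularForm 𝒮ℒ (2 * (κ + 1)), ⇑h = Derivative.serreDerivative ((2 * κ : ℤ) : ℂ) f ∧
      jacobiDerivation a b (ofModular κ f) = ofModular (κ + 1) h := by
  obtain ⟨h, hh⟩ : ∃ h : ModularForm 𝒮ℒ (2 * (κ + 1)),
      ⇑h = Derivative.serreDerivative ((2 * κ : ℤ) : ℂ) f := by
    obtain ⟨h, hh⟩ := exists_serre f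
    exact ⟨ModularForm.mcast (by ring) h, by rw [ModularForm.coe_mcast, hh]⟩
  refine ⟨h, hh, eq_of_toFun_eq (i := (κ + 1, 0)) ?_ (ofModular_mem _ _) ?_⟩
  · have := jacobiDerivation_mem a b (ofModular_mem κ f)
    rwa [Prod.mk_add_mk, add_zero] at this
  · obtain ⟨-, p, hp, hpf, hpd⟩ := exists_poly_modularForm κ f
    have : ofModular κ f = polyEquiv p := eq_of_toFun_eq (ofModular_mem κ f)
      (polyEquiv_mem_iff.2 hp) (by rw [toFun_ofModular, polyEquiv_apply, hpf])
    rw [this, jacobiDerivation_polyEquiv, polyEquiv_apply, hpd, toFun_ofModular, hh]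

/-- Two such derivations agree on `E₄`, `E₆` since both extend `Se`, and on `A`, `B` by
prescription; these four generate the algebra. -/
theorem isSerreExtension_iff (a b : ℂ) (D : Derivation ℂ JacobiAlgebra JacobiAlgebra) :
    IsSerreExtension elemA elemB a b D ↔ D = jacobiDerivation a b := by
  constructor
  · intro h
    refine derivation_ext_generator fun j => ?_
    have hmod : ∀ κ f, D (ofModular κ f) = jacobiDerivation a b (ofModular κ f) := fun κ f => by
      obtain ⟨h₁, hf₁, hD₁⟩ := h.serre κ f
      obtain ⟨h₂, hf₂, hD₂⟩ := exists_serre_ofModular a b κ f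
      rw [hD₁, hD₂, DFunLike.coe_injective (hf₁.trans hf₂.symm)]
    fin_cases j
    · exact hmod 2 _
    · exact hmod 3 _
    · exact h.map_A.trans (jacobiDerivation_generator a b 2).symm
    · exact h.map_B.trans (jacobiDerivation_generator a b 3).symm
  · rintro rfl
    exact ⟨exists_serre_ofModular a b, jacobiDerivation_generator a b 2,
      jacobiDerivation_generator a b 3⟩

/-! ### Moyal brackets of two commuting derivations -/

section Moyal

variable {Q : Type*} [CommRing Q] [Algebra ℂ Q] (X Y : Derivation ℂ Q Q)

/-- The Moyal brackets `μ ∘ (X ⊗ Y - Y ⊗ X)^n`. -/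
def moyal : ℕ → Q →ₗ[ℂ] Q →ₗ[ℂ] Q
  | 0 => LinearMap.mul ℂ Q
  | n + 1 => (moyal n).compl₁₂ X.toLinearMap Y.toLinearMap -
      (moyal n).compl₁₂ Y.toLinearMap X.toLinearMap

theorem moyal_zero (f g : Q) : moyal X Y 0 f g = f * g := rfl

theorem moyal_succ (n : ℕ) (f g : Q) :
    moyal X Y (n + 1) f g = moyal X Y n (X f) (Y g) - moyal X Y n (Y f) (X g) := rfl

variable {X Y}

/-- If `[N, X] = 0` and `[N, Y] = cX`, then `N` commutes with `X⊗Y - Y⊗X`, as the extra terms `c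
X⊗X` cancel. It is used with `N = ∂_t`. -/
theorem moyal_leibniz {N : Derivation ℂ Q Q} {c : ℂ} (hX : ∀ u, N (X u) = X (N u))
    (hY : ∀ u, N (Y u) = Y (N u) + c • X u) (n : ℕ) (f g : Q) :
    N (moyal X Y n f g) = moyal X Y n (N f) g + moyal X Y n f (N g) := by
  induction n generalizing f g with
  | zero =>
    simp only [moyal_zero, Derivation.leibniz, smul_eq_mul]
    ring
  | succ n ih =>
    simp only [moyal_succ, map_sub, ih, hX, hY, map_add, map_smul, LinearMap.add_apply,
      LinearMap.smul_apply]
    abel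

theorem moyal_mul_left {u : Q} (hX : X u = 0) (hY : Y u = 0) (n : ℕ) (f g : Q) :
    moyal X Y n (u * f) g = u * moyal X Y n f g := by
  induction n generalizing f g with
  | zero => simp only [moyal_zero, mul_assoc]
  | succ n ih =>
    have h : ∀ D : Derivation ℂ Q Q, D u = 0 → ∀ v, D (u * v) = u * D v := fun D hD v => by
      rw [Derivation.leibniz, hD, smul_zero, add_zero, smul_eq_mul]
    simp only [moyal_succ, h X hX, h Y hY, ih, mul_sub]

theorem moyal_mul_right {u : Q} (hX : X u = 0) (hY : Y u = 0) (n : ℕ) (f g : Q) :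
    moyal X Y n f (u * g) = u * moyal X Y n f g := by
  induction n generalizing f g with
  | zero => simp only [moyal_zero, mul_left_comm]
  | succ n ih =>
    have h : ∀ D : Derivation ℂ Q Q, D u = 0 → ∀ v, D (u * v) = u * D v := fun D hD v => by
      rw [Derivation.leibniz, hD, smul_zero, add_zero, smul_eq_mul]
    simp only [moyal_succ, h X hX, h Y hY, ih, mul_sub]

/-- Precomposition of a function of two variables with `p` and `q`. -/
def precomp₂ (p q : Q → Q) : Module.End ℂ (Q → Q → Q) where
  toFun F f g := F (p f) (q g)
  map_add' _ _ := rfl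
  map_smul' _ _ := rfl

theorem precomp₂_pow (p q : Q → Q) (n : ℕ) : precomp₂ p q ^ n = precomp₂ p^[n] q^[n] := by
  induction n with
  | zero => rfl
  | succ n ih =>
    rw [pow_succ, ih]
    ext F f g
    change F (p (p^[n] f)) (q (q^[n] g)) = F (p^[n + 1] f) (q^[n + 1] g)
    rw [Function.iterate_succ_apply', Function.iterate_succ_apply']

/-- The binomial theorem for the commuting operators `X⊗Y` and `-Y⊗X`. -/
theorem moyal_eq_sum (hXY : ∀ u, X (Y u) = Y (X u)) (n : ℕ) (f g : Q) :
    moyal X Y n f g = ∑ r ∈ Finset.range (n + 1), ((-1 : ℂ) ^ r * n.choose r) •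
      (Y^[r] (X^[n - r] f) * Y^[n - r] (X^[r] g)) := by
  have hcomm : Commute ((-1 : ℂ) • precomp₂ Y X) (precomp₂ X Y) := by
    refine Commute.smul_left ?_ _
    ext F f g
    change F (X (Y f)) (Y (X g)) = F (Y (X f)) (X (Y g))
    rw [hXY, hXY]
  have h1 : ∀ n, (fun f g => moyal X Y n f g) =
      (((-1 : ℂ) • precomp₂ Y X + precomp₂ X Y) ^ n) fun f g : Q => f * g := fun n => by
    induction n with
    | zero => rfl
    | succ n ih =>
      rw [pow_succ', Module.End.mul_apply, ← ih]
      ext f g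
      rw [moyal_succ, sub_eq_neg_add, ← neg_one_smul ℂ]
      rfl
  have hI : ∀ (p q : ℕ) (u : Q), X^[p] (Y^[q] u) = Y^[q] (X^[p] u) := fun p q =>
    Function.Commute.iterate_iterate (f := X) (g := Y) hXY p q
  rw [show moyal X Y n f g = (fun f g => moyal X Y n f g) f g from rfl, h1, hcomm.add_pow,
    LinearMap.sum_apply, Finset.sum_apply, Finset.sum_apply]
  refine Finset.sum_congr rfl fun r _ => ?_
  rw [smul_pow, precomp₂_pow, precomp₂_pow, ← Nat.cast_comm, ← nsmul_eq_mul,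
    ← Nat.cast_smul_eq_nsmul ℂ, smul_mul_assoc, smul_smul, mul_comm ((-1 : ℂ) ^ r)]
  change ((n.choose r : ℂ) * (-1 : ℂ) ^ r) • (X^[n - r] (Y^[r] f) * Y^[n - r] (X^[r] g)) = _
  rw [hI]

/-- Precomposition of a function of three variables. -/
def precomp₃ (p q r : Q → Q) : Module.End ℂ (Q → Q → Q → Q) where
  toFun F f g h := F (p f) (q g) (r h)
  map_add' _ _ := rfl
  map_smul' _ _ := rfl

theorem precomp₃_commute {p q r p' q' r' : Q → Q} (hp : Function.Commute p p')
    (hq : Function.Commute q q') (hr : Function.Commute r r') :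
    Commute (precomp₃ p q r) (precomp₃ p' q' r') := by
  ext F f g h
  change F (p' (p f)) (q' (q g)) (r' (r h)) = F (p (p' f)) (q (q' g)) (r (r' h))
  rw [hp f, hq g, hr h]

/-- The Moyal brackets satisfy the identities which express the associativity of the product
`∑ moyal n / n! ħ^n`. -/
theorem moyal_assoc (hXY : ∀ u, X (Y u) = Y (X u)) (n : ℕ) (f g h : Q) :
    ∑ x ∈ Finset.HasAntidiagonal.antidiagonal n,
        (n.choose x.1 : ℂ) • moyal X Y x.1 (moyal X Y x.2 f g) h =
      ∑ x ∈ Finset.HasAntidiagonal.antidiagonal n,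
        (n.choose x.1 : ℂ) • moyal X Y x.1 f (moyal X Y x.2 g h) := by
  set P₁ : Module.End ℂ (Q → Q → Q → Q) := precomp₃ X Y id - precomp₃ Y X id with hP₁
  set P₂ : Module.End ℂ (Q → Q → Q → Q) := precomp₃ X id Y - precomp₃ Y id X with hP₂
  set P₃ : Module.End ℂ (Q → Q → Q → Q) := precomp₃ id X Y - precomp₃ id Y X with hP₃
  set M : Q → Q → Q → Q := fun f g h => f * g * h with hM
  have hXY : Function.Commute X Y := hXY
  have h₁ : Commute (P₂ + P₃) P₁ := by
    refine .add_left (.sub_left (.sub_right ?_ ?_) (.sub_right ?_ ?_))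
      (.sub_left (.sub_right ?_ ?_) (.sub_right ?_ ?_)) <;> refine precomp₃_commute ?_ ?_ ?_ <;>
    first
    | exact Function.Commute.id_left
    | exact Function.Commute.id_right
    | exact Function.Commute.refl _
    | exact hXY
    | exact hXY.symm
  have h₃ : Commute (P₁ + P₂) P₃ := by
    refine .add_left (.sub_left (.sub_right ?_ ?_) (.sub_right ?_ ?_))
      (.sub_left (.sub_right ?_ ?_) (.sub_right ?_ ?_)) <;> refine precomp₃_commute ?_ ?_ ?_ <;>
    first
    | exact Function.Commute.id_left
    | exact Function.Commute.id_right
    | exact Function.Commute.refl _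
    | exact hXY
    | exact hXY.symm
  -- `P₁`, `P₂`, `P₃` act as `X⊗Y - Y⊗X` on the slots 12, 13, 23. By the Leibniz rule, acting on a
  -- product in slots 12 and on slot 3 is `P₂ + P₃`, so both sides of the identity become `(P₁ + P₂
  -- + P₃)^n` applied to the triple product.
  have hl : ∀ i j f g h, moyal X Y i (moyal X Y j f g) h = ((P₂ + P₃) ^ i * P₁ ^ j) M f g h := by
    intro i j f g h
    rw [(h₁.pow_pow i j).eq]
    induction j generalizing f g h with
    | zero =>
      rw [pow_zero, one_mul]
      induction i generalizing f g h with
      | zero => rfl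
      | succ i ih =>
        simp only [moyal_zero] at ih ⊢
        rw [pow_succ', moyal_succ, Derivation.leibniz, Derivation.leibniz, map_add, map_add,
          smul_eq_mul, smul_eq_mul, smul_eq_mul, smul_eq_mul, mul_comm g, mul_comm g,
          LinearMap.add_apply, LinearMap.add_apply, ih, ih, ih, ih, add_sub_add_comm, add_comm]
        rfl
    | succ j ih =>
      rw [pow_succ', mul_assoc, moyal_succ, map_sub, LinearMap.sub_apply, ih, ih]
      rfl
  have hr : ∀ i j f g h, moyal X Y i f (moyal X Y j g h) = ((P₁ + P₂) ^ i * P₃ ^ j) M f g h := by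
    intro i j f g h
    rw [(h₃.pow_pow i j).eq]
    induction j generalizing f g h with
    | zero =>
      rw [pow_zero, one_mul]
      induction i generalizing f g h with
      | zero => exact (mul_assoc _ _ _).symm
      | succ i ih =>
        simp only [moyal_zero] at ih ⊢
        rw [pow_succ', moyal_succ, Derivation.leibniz, Derivation.leibniz, map_add, map_add,
          smul_eq_mul, smul_eq_mul, smul_eq_mul, smul_eq_mul, mul_comm h, mul_comm h,
          ih, ih, ih, ih, add_sub_add_comm, add_comm]
        rfl
    | succ j ih =>
      rw [pow_succ', mul_assoc, moyal_succ, map_sub, ih, ih]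
      rfl
  have key : ∀ U V : Module.End ℂ (Q → Q → Q → Q), Commute U V →
      ∑ x ∈ Finset.HasAntidiagonal.antidiagonal n, (n.choose x.1 : ℂ) • (U ^ x.1 * V ^ x.2) M f g h =
        ((U + V) ^ n) M f g h := fun U V hUV => by
    rw [hUV.add_pow', LinearMap.sum_apply, Finset.sum_apply, Finset.sum_apply, Finset.sum_apply]
    refine Finset.sum_congr rfl fun x _ => ?_
    rw [← Nat.cast_smul_eq_nsmul ℂ]
    rfl
  simp only [hl, hr]
  rw [key _ _ h₁, key _ _ h₃, add_comm (P₂ + P₃), add_assoc]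

end Moyal

/-! ### Rankin-Cohen brackets as Moyal brackets -/

section Lift

variable {σ : Type*} (F : σ → MvPolynomial σ ℂ) (w : σ → ℂ)

/-- The inclusion of a polynomial ring in the one with three more variables `t`, `y`, `z`. -/
def lift : MvPolynomial σ ℂ →ₐ[ℂ] MvPolynomial (σ ⊕ Fin 3) ℂ := MvPolynomial.rename Sum.inl

/-- The additional variables `t`, `y`, `z`. -/
def newVar (i : Fin 3) : MvPolynomial (σ ⊕ Fin 3) ℂ := MvPolynomial.X (Sum.inr i)

/-- The derivation `y D + z ∂_t`, where `D` has the values `F` on the variables. -/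
def liftX : Derivation ℂ (MvPolynomial (σ ⊕ Fin 3) ℂ) (MvPolynomial (σ ⊕ Fin 3) ℂ) :=
  MvPolynomial.mkDerivation ℂ (Sum.elim (fun j => newVar 1 * lift (F j)) ![newVar 2, 0, 0])

/-- The derivation `-W + y ∂_y - z ∂_z`, where `W` is the derivation of weights `w`. -/
def liftE : Derivation ℂ (MvPolynomial (σ ⊕ Fin 3) ℂ) (MvPolynomial (σ ⊕ Fin 3) ℂ) :=
  MvPolynomial.mkDerivation ℂ (Sum.elim (fun j => -w j • lift (MvPolynomial.X j))
    ![0, newVar 1, -newVar 2])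

/-- The derivation `z E - t X`. -/
def liftY : Derivation ℂ (MvPolynomial (σ ⊕ Fin 3) ℂ) (MvPolynomial (σ ⊕ Fin 3) ℂ) :=
  (newVar 2 : MvPolynomial (σ ⊕ Fin 3) ℂ) • liftE w - (newVar 0 : MvPolynomial (σ ⊕ Fin 3) ℂ) • liftX F

/-- Evaluation at `t = 0`. -/
def evalT : MvPolynomial (σ ⊕ Fin 3) ℂ →ₐ[ℂ] MvPolynomial (σ ⊕ Fin 3) ℂ :=
  MvPolynomial.aeval (Sum.elim (fun j => lift (MvPolynomial.X j)) ![0, newVar 1, newVar 2])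

variable {F w}

theorem lift_X (j : σ) : lift (MvPolynomial.X j) = MvPolynomial.X (Sum.inl j) :=
  MvPolynomial.rename_X _ _

theorem liftY_apply (u : MvPolynomial (σ ⊕ Fin 3) ℂ) :
    liftY F w u = newVar 2 * liftE w u - newVar 0 * liftX F u := rfl

@[simp] theorem liftX_lift_X (j : σ) :
    liftX F (lift (MvPolynomial.X j)) = newVar 1 * lift (F j) := by
  simp [liftX, lift_X]

@[simp] theorem liftX_newVar (i : Fin 3) :
    liftX F (newVar i) = (![newVar 2, 0, 0] : Fin 3 → MvPolynomial (σ ⊕ Fin 3) ℂ) i := by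
  simp [liftX, newVar]

@[simp] theorem liftE_lift_X (j : σ) :
    liftE w (lift (MvPolynomial.X j)) = -w j • lift (MvPolynomial.X j) := by
  simp [liftE, lift_X]

@[simp] theorem liftE_newVar (i : Fin 3) :
    liftE w (newVar i) = (![0, newVar 1, -newVar 2] : Fin 3 → MvPolynomial (σ ⊕ Fin 3) ℂ) i := by
  simp [liftE, newVar]

@[simp] theorem evalT_lift_X (j : σ) :
    evalT (lift (MvPolynomial.X j)) = lift (MvPolynomial.X j) := by
  simp [evalT, lift_X]

@[simp] theorem evalT_newVar (i : Fin 3) :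
    evalT (newVar i) = (![0, newVar 1, newVar 2] : Fin 3 → MvPolynomial (σ ⊕ Fin 3) ℂ) i := by
  simp [evalT, newVar]

theorem evalT_lift (p : MvPolynomial σ ℂ) : evalT (lift p) = lift p := by
  have : evalT.comp lift = lift (σ := σ) := MvPolynomial.algHom_ext fun j => evalT_lift_X j
  exact DFunLike.congr_fun this p

theorem pderiv_lift (p : MvPolynomial σ ℂ) (i : Fin 3) :
    MvPolynomial.pderiv (Sum.inr i) (lift p) = 0 := by
  refine MvPolynomial.pderiv_eq_zero_of_notMem_vars fun h => ?_
  obtain ⟨j, -, hj⟩ := MvPolynomial.mem_vars_rename _ _ h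
  cases hj

theorem liftX_lift (p : MvPolynomial σ ℂ) :
    liftX F (lift p) = newVar 1 * lift (MvPolynomial.mkDerivation ℂ F p) := by
  induction p using MvPolynomial.induction_on with
  | C a =>
    rw [MvPolynomial.derivation_C, map_zero, mul_zero, lift, MvPolynomial.rename_C,
      MvPolynomial.derivation_C]
  | add p q hp hq => simp only [map_add, hp, hq, mul_add]
  | mul_X p j hp =>
    simp only [map_mul, Derivation.leibniz, hp, smul_eq_mul, map_add, liftX_lift_X,
      MvPolynomial.mkDerivation_X]
    ring

theorem iterate_liftX_lift (p : MvPolynomial σ ℂ) (n : ℕ) :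
    (liftX F)^[n] (lift p) = newVar 1 ^ n * lift ((MvPolynomial.mkDerivation ℂ F)^[n] p) := by
  induction n with
  | zero => simp
  | succ n ih =>
    rw [Function.iterate_succ_apply', ih, Derivation.leibniz, Derivation.leibniz_pow, liftX_lift,
      Function.iterate_succ_apply']
    simp
    ring

theorem derivation_ext_lift {D D' : Derivation ℂ (MvPolynomial (σ ⊕ Fin 3) ℂ)
    (MvPolynomial (σ ⊕ Fin 3) ℂ)}
    (h : ∀ j, D (lift (MvPolynomial.X j)) = D' (lift (MvPolynomial.X j)))
    (h' : ∀ i, D (newVar i) = D' (newVar i)) : D = D' :=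
  MvPolynomial.derivation_ext (Sum.rec (fun j => by rw [← lift_X, h]) h')

theorem derivation_comm_of_lift {D₁ D₂ D₃ : Derivation ℂ (MvPolynomial (σ ⊕ Fin 3) ℂ)
    (MvPolynomial (σ ⊕ Fin 3) ℂ)}
    (h : ∀ j, D₁ (D₂ (lift (MvPolynomial.X j))) =
      D₂ (D₁ (lift (MvPolynomial.X j))) + D₃ (lift (MvPolynomial.X j)))
    (h' : ∀ i, D₁ (D₂ (newVar i)) = D₂ (D₁ (newVar i)) + D₃ (newVar i))
    (u : MvPolynomial (σ ⊕ Fin 3) ℂ) : D₁ (D₂ u) = D₂ (D₁ u) + D₃ u := by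
  have : ⁅D₁, D₂⁆ = D₃ := derivation_ext_lift
    (fun j => by rw [Derivation.commutator_apply, h, add_sub_cancel_left])
    (fun i => by rw [Derivation.commutator_apply, h', add_sub_cancel_left])
  rw [← sub_eq_iff_eq_add', ← Derivation.commutator_apply, this]

/-- `X` shifts eigenvalues of `E` by `-1`: in `yD` the factor `y` adds 1 and `D` subtracts 2, and
`z∂_t` subtracts 1. -/
theorem liftX_liftE (hF : ∀ j, liftE w (lift (F j)) = -(w j + 2) • lift (F j))
    (u : MvPolynomial (σ ⊕ Fin 3) ℂ) :
    liftX F (liftE w u) = liftE w (liftX F u) + liftX F u := by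
  refine derivation_comm_of_lift (fun j => ?_) (fun i => ?_) u
  · rw [liftE_lift_X, Derivation.map_smul, liftX_lift_X, Derivation.leibniz, hF, liftE_newVar]
    simp only [smul_eq_mul, Matrix.cons_val, MvPolynomial.smul_eq_C_mul, map_add, map_neg]
    rw [show (MvPolynomial.C 2 : MvPolynomial (σ ⊕ Fin 3) ℂ) = 2 from map_ofNat _ 2]
    ring
  · fin_cases i <;> simp

/-- `[X, zE - tX] = z[X, E] - X(t) X = zX - zX = 0`. -/
theorem liftX_liftY (hF : ∀ j, liftE w (lift (F j)) = -(w j + 2) • lift (F j))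
    (u : MvPolynomial (σ ⊕ Fin 3) ℂ) :
    liftX F (liftY F w u) = liftY F w (liftX F u) := by
  simp only [liftY_apply, map_sub, Derivation.leibniz, liftX_liftE hF, liftX_newVar, smul_eq_mul,
    Matrix.cons_val]
  ring

theorem liftE_iterate_liftX (hF : ∀ j, liftE w (lift (F j)) = -(w j + 2) • lift (F j))
    {p : MvPolynomial σ ℂ} {c : ℂ} (hp : liftE w (lift p) = -c • lift p)
    (n : ℕ) : liftE w ((liftX F)^[n] (lift p)) = -(c + n) • (liftX F)^[n] (lift p) := by
  induction n with
  | zero => simpa using hp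
  | succ n ih =>
    rw [Function.iterate_succ_apply', ← sub_eq_iff_eq_add.2 (liftX_liftE hF _), ih,
      Derivation.map_smul, Nat.cast_succ]
    module

theorem pderiv_liftX (u : MvPolynomial (σ ⊕ Fin 3) ℂ) :
    MvPolynomial.pderiv (Sum.inr 0) (liftX F u) = liftX F (MvPolynomial.pderiv (Sum.inr 0) u) := by
  have := derivation_comm_of_lift (D₁ := MvPolynomial.pderiv (Sum.inr 0)) (D₂ := liftX F) (D₃ := 0)
    (fun j => by
      rw [liftX_lift_X, Derivation.leibniz, pderiv_lift, pderiv_lift]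
      simp [newVar])
    (fun i => by
      rw [liftX_newVar]
      fin_cases i <;> simp [newVar]) u
  rwa [Derivation.zero_apply, add_zero] at this

theorem pderiv_liftE (u : MvPolynomial (σ ⊕ Fin 3) ℂ) :
    MvPolynomial.pderiv (Sum.inr 0) (liftE w u) = liftE w (MvPolynomial.pderiv (Sum.inr 0) u) := by
  have := derivation_comm_of_lift (D₁ := MvPolynomial.pderiv (Sum.inr 0)) (D₂ := liftE w) (D₃ := 0)
    (fun j => by
      rw [liftE_lift_X, Derivation.map_smul, pderiv_lift]
      simp)
    (fun i => by
      rw [liftE_newVar]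
      fin_cases i <;> simp [newVar]) u
  rwa [Derivation.zero_apply, add_zero] at this

theorem pderiv_liftY (u : MvPolynomial (σ ⊕ Fin 3) ℂ) :
    MvPolynomial.pderiv (Sum.inr 0) (liftY F w u) =
      liftY F w (MvPolynomial.pderiv (Sum.inr 0) u) + (-1 : ℂ) • liftX F u := by
  simp only [liftY_apply, map_sub, Derivation.leibniz, pderiv_liftX, pderiv_liftE, smul_eq_mul]
  simp [newVar]
  ring

/-- In characteristic zero a vanishing `t`-derivative means that `t` does not occur. -/
theorem evalT_eq_self {u : MvPolynomial (σ ⊕ Fin 3) ℂ}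
    (h : MvPolynomial.pderiv (Sum.inr 0) u = 0) : evalT u = u := by
  have hvars : Sum.inr 0 ∉ u.vars := fun hmem => by
    obtain ⟨d, hd, hd0⟩ := (MvPolynomial.mem_vars_iff_mem_support _).1 hmem
    have h1 := congrArg (MvPolynomial.coeff (d - Finsupp.single (Sum.inr 0) 1)) h
    rw [MvPolynomial.coeff_pderiv, Finsupp.sub_add_single_one_cancel (Finsupp.mem_support_iff.1 hd0),
      MvPolynomial.coeff_zero, mul_eq_zero] at h1
    rcases h1 with h1 | h1
    · exact MvPolynomial.mem_support_iff.1 hd h1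
    · exact Nat.cast_add_one_ne_zero _ h1
  refine MvPolynomial.hom_congr_vars (f₁ := evalT.toRingHom) (f₂ := RingHom.id _) ?_ ?_ rfl
  · ext1 a
    exact evalT.commutes a
  · rintro (j | i) hi -
    · exact (congrArg evalT (lift_X j)).symm.trans ((evalT_lift_X j).trans (lift_X j))
    · refine (evalT_newVar i).trans ?_
      fin_cases i
      · exact absurd hi hvars
      · rfl
      · rfl

theorem evalT_liftE (u : MvPolynomial (σ ⊕ Fin 3) ℂ) : evalT (liftE w u) = liftE w (evalT u) := by
  induction u using MvPolynomial.induction_on with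
  | C a =>
    have : evalT (MvPolynomial.C a : MvPolynomial (σ ⊕ Fin 3) ℂ) = MvPolynomial.C a :=
      evalT.commutes a
    rw [this, MvPolynomial.derivation_C, map_zero]
  | add p q hp hq => simp only [map_add, hp, hq]
  | mul_X p j hp =>
    have hj : evalT (liftE w (MvPolynomial.X j)) = liftE w (evalT (MvPolynomial.X j)) := by
      rcases j with j | i
      · rw [← lift_X, evalT_lift_X, liftE_lift_X, map_smul, evalT_lift_X]
      · change evalT (liftE w (newVar i)) = liftE w (evalT (newVar i))
        rw [evalT_newVar, liftE_newVar]
        fin_cases i <;> simp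
    simp only [map_mul, Derivation.leibniz, hp, smul_eq_mul, map_add, hj]

/-- At `t = 0` only `zE` is left of `Y`, and each application to `z^s u` multiplies by `-(c + s) z`;
this produces the rising factorial. -/
theorem evalT_iterate_liftY (s : ℕ) {u : MvPolynomial (σ ⊕ Fin 3) ℂ} {c : ℂ}
    (hu : liftE w u = -c • u) (hu' : evalT u = u) :
    evalT ((liftY F w)^[s] u) =
      ((-1 : ℂ) ^ s * (ascPochhammer ℂ s).eval c) • (newVar 2 ^ s * u) := by
  induction s with
  | zero => simpa using hu'
  | succ s ih =>
    rw [Function.iterate_succ_apply', liftY_apply, map_sub, map_mul, map_mul, evalT_liftE, ih,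
      Derivation.map_smul, Derivation.leibniz, Derivation.leibniz_pow, hu, ascPochhammer_succ_eval]
    simp only [evalT_newVar, liftE_newVar, Matrix.cons_val, zero_mul, sub_zero, smul_eq_mul,
      MvPolynomial.smul_eq_C_mul, map_mul, map_add, map_neg, map_pow, map_one, map_natCast,
      nsmul_eq_mul]
    rcases s with _ | s
    · simp [mul_left_comm]
    · rw [Nat.add_sub_cancel]
      ring

/-- The Rankin-Cohen bracket with derivation `D`, of elements of weights `c` and `c'`. -/
def rankinCohen {R : Type*} [CommRing R] [Algebra ℂ R] (D : R → R) (c c' : ℂ) (n : ℕ) (f g : R) : R :=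
  ∑ r ∈ Finset.range (n + 1), ((-1 : ℂ) ^ r * Ring.choose (c + n - 1) (n - r) *
    Ring.choose (c' + n - 1) r) • (D^[r] f * D^[n - r] g)

theorem factorial_mul_choose (c : ℂ) {n r : ℕ} (h : r ≤ n) :
    (r.factorial : ℂ) * Ring.choose (c + n - 1) r = (ascPochhammer ℂ r).eval (c + (n - r : ℕ)) := by
  have h1 := Ring.factorial_nsmul_multichoose_eq_ascPochhammer (c + (n - r : ℕ)) r
  rw [Polynomial.ascPochhammer_smeval_eq_eval, Ring.multichoose_eq, nsmul_eq_mul] at h1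
  rw [← h1, Nat.cast_sub h]
  congr 2
  ring

/-- The Moyal bracket of lifts is annihilated by `∂_t`, so it may be computed at `t = 0`. There
powers of `X` give powers of `yD`, powers of `Y` give Pochhammer factors, and the binomial expansion
becomes the Rankin-Cohen sum. -/
theorem moyal_lift (hF : ∀ j, liftE w (lift (F j)) = -(w j + 2) • lift (F j))
    {f g : MvPolynomial σ ℂ} {c c' : ℂ} (hf : liftE w (lift f) = -c • lift f)
    (hg : liftE w (lift g) = -c' • lift g) (n : ℕ) :
    moyal (liftX F) (liftY F w) n (lift f) (lift g) = (n.factorial : ℂ) •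
      ((newVar 1 * newVar 2) ^ n * lift (rankinCohen (MvPolynomial.mkDerivation ℂ F) c c' n f g)) := by
  have h0 : MvPolynomial.pderiv (Sum.inr 0)
      (moyal (liftX F) (liftY F w) n (lift f) (lift g)) = 0 := by
    rw [moyal_leibniz pderiv_liftX pderiv_liftY, pderiv_lift, pderiv_lift, map_zero, map_zero,
      LinearMap.zero_apply, add_zero]
  have hX : ∀ (p : MvPolynomial σ ℂ) r, evalT ((liftX F)^[r] (lift p)) = (liftX F)^[r] (lift p) :=
    fun p r => by
      rw [iterate_liftX_lift, map_mul, map_pow, evalT_newVar, evalT_lift]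
      rfl
  -- The Moyal sum carries `X^(n-r)` on the first argument and the bracket `D^r`, so one of them is
  -- summed backwards.
  rw [rankinCohen, ← Finset.sum_range_reflect, ← evalT_eq_self h0, moyal_eq_sum (liftX_liftY hF),
    map_sum, map_sum, Finset.mul_sum, Finset.smul_sum]
  refine Finset.sum_congr rfl fun r hr => ?_
  have hr := Nat.lt_succ_iff.1 (Finset.mem_range.1 hr)
  rw [map_smul, map_mul, evalT_iterate_liftY _ (liftE_iterate_liftX hF hf _) (hX _ _),
    evalT_iterate_liftY _ (liftE_iterate_liftX hF hg _) (hX _ _), iterate_liftX_lift,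
    iterate_liftX_lift, ← factorial_mul_choose c hr]
  have h1 := factorial_mul_choose c' (Nat.sub_le n r)
  rw [Nat.sub_sub_self hr] at h1
  rw [← h1, map_smul, map_mul, show n + 1 - 1 - r = n - r by omega, Nat.sub_sub_self hr,
    ← Nat.choose_mul_factorial_mul_factorial hr]
  have h2 : (-1 : ℂ) ^ r * (-1) ^ r = 1 := by rw [← mul_pow]; simp
  have h3 : (newVar 1 * newVar 2 : MvPolynomial (σ ⊕ Fin 3) ℂ) ^ n =
      (newVar 1 * newVar 2) ^ r * (newVar 1 * newVar 2) ^ (n - r) := by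
    rw [← pow_add, Nat.add_sub_cancel' hr]
  rw [h3, smul_mul_smul_comm, smul_smul, mul_smul_comm, smul_smul, Nat.cast_mul, Nat.cast_mul]
  congr 1
  · linear_combination ((n.choose r : ℂ) * r.factorial * (n - r).factorial * (-1) ^ (n - r) *
      Ring.choose (c + n - 1) r * Ring.choose (c' + n - 1) (n - r)) * h2
  · ring

end Lift

/-! ### Associativity -/

theorem sum_antidiagonal_assoc {M : Type*} [AddCommMonoid M] (n : ℕ) (f : ℕ → ℕ → ℕ → M) :
    ∑ x ∈ Finset.HasAntidiagonal.antidiagonal n, ∑ y ∈ Finset.HasAntidiagonal.antidiagonal x.1,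
        f y.1 y.2 x.2 =
      ∑ x ∈ Finset.HasAntidiagonal.antidiagonal n, ∑ y ∈ Finset.HasAntidiagonal.antidiagonal x.2,
        f x.1 y.1 y.2 := by
  simp only [Finset.sum_sigma']
  apply Finset.sum_nbij' (fun ⟨⟨_i, j⟩, ⟨k, l⟩⟩ ↦ ⟨(k, l + j), (l, j)⟩)
    (fun ⟨⟨i, _j⟩, ⟨k, l⟩⟩ ↦ ⟨(i + k, l), (i, k)⟩)
  all_goals rintro ⟨⟨a, b⟩, ⟨c, d⟩⟩ h
  all_goals simp only [Finset.mem_sigma, Finset.HasAntidiagonal.mem_antidiagonal] at h ⊢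
  all_goals obtain ⟨h1, h2⟩ := h
  · subst h1 h2; exact ⟨by simp only [add_assoc], trivial⟩
  · subst h1 h2; exact ⟨by simp only [add_assoc], trivial⟩
  · subst h2; rfl
  · subst h2; rfl

/-- Associativity on constants suffices: regroup the coefficients of triple products so that the
powers of `ħ` from the brackets form an inner sum. -/
theorem isFormalDeformation_of_assoc {R : Type*} [CommRing R] [Algebra ℂ R]
    {μ : ℕ → R →ₗ[ℂ] R →ₗ[ℂ] R} (h0 : ∀ f g, μ 0 f g = f * g)
    (h : ∀ n f g h, ∑ x ∈ Finset.HasAntidiagonal.antidiagonal n, μ x.1 (μ x.2 f g) h =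
      ∑ x ∈ Finset.HasAntidiagonal.antidiagonal n, μ x.1 f (μ x.2 g h)) :
    IsFormalDeformation μ where
  zero := h0
  assoc F G H := by
    ext n
    simp only [starProduct, PowerSeries.coeff_mk, map_sum, LinearMap.sum_apply]
    set a := fun i => PowerSeries.coeff i F
    set b := fun i => PowerSeries.coeff i G
    set c := fun i => PowerSeries.coeff i H
    open Finset.HasAntidiagonal in
    calc ∑ x ∈ antidiagonal n, ∑ y ∈ antidiagonal x.2, ∑ u ∈ antidiagonal y.1,
          ∑ v ∈ antidiagonal u.2, μ x.1 (μ u.1 (a v.1) (b v.2)) (c y.2)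
        = ∑ x ∈ antidiagonal n, ∑ y ∈ antidiagonal x.2, ∑ u ∈ antidiagonal y.2,
          ∑ v ∈ antidiagonal u.1, μ x.1 (μ y.1 (a v.1) (b v.2)) (c u.2) :=
          Finset.sum_congr rfl fun x _ => sum_antidiagonal_assoc x.2
            fun j s q => ∑ v ∈ antidiagonal s, μ x.1 (μ j (a v.1) (b v.2)) (c q)
      _ = ∑ x ∈ antidiagonal n, ∑ y ∈ antidiagonal x.1, ∑ u ∈ antidiagonal x.2,
          ∑ v ∈ antidiagonal u.1, μ y.1 (μ y.2 (a v.1) (b v.2)) (c u.2) :=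
          (sum_antidiagonal_assoc n fun i j m => ∑ u ∈ antidiagonal m,
            ∑ v ∈ antidiagonal u.1, μ i (μ j (a v.1) (b v.2)) (c u.2)).symm
      _ = ∑ x ∈ antidiagonal n, ∑ u ∈ antidiagonal x.2, ∑ v ∈ antidiagonal u.1,
          ∑ y ∈ antidiagonal x.1, μ y.1 (μ y.2 (a v.1) (b v.2)) (c u.2) :=
          Finset.sum_congr rfl fun x _ => by
            rw [Finset.sum_comm]
            exact Finset.sum_congr rfl fun u _ => Finset.sum_comm
      _ = ∑ x ∈ antidiagonal n, ∑ u ∈ antidiagonal x.2, ∑ v ∈ antidiagonal u.1,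
          ∑ y ∈ antidiagonal x.1, μ y.1 (a v.1) (μ y.2 (b v.2) (c u.2)) := by simp only [h]
      _ = ∑ x ∈ antidiagonal n, ∑ u ∈ antidiagonal x.2, ∑ v ∈ antidiagonal u.2,
          ∑ y ∈ antidiagonal x.1, μ y.1 (a u.1) (μ y.2 (b v.1) (c v.2)) :=
          Finset.sum_congr rfl fun x _ => sum_antidiagonal_assoc x.2
            fun j s q => ∑ y ∈ antidiagonal x.1, μ y.1 (a j) (μ y.2 (b s) (c q))
      _ = ∑ x ∈ antidiagonal n, ∑ y ∈ antidiagonal x.1, ∑ u ∈ antidiagonal x.2,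
          ∑ v ∈ antidiagonal u.2, μ y.1 (a u.1) (μ y.2 (b v.1) (c v.2)) :=
          Finset.sum_congr rfl fun x _ => by
            rw [Finset.sum_comm]
            exact Finset.sum_congr rfl fun u _ => Finset.sum_comm
      _ = ∑ x ∈ antidiagonal n, ∑ y ∈ antidiagonal x.2, ∑ u ∈ antidiagonal y.2,
          ∑ v ∈ antidiagonal u.2, μ x.1 (a u.1) (μ y.1 (b v.1) (c v.2)) :=
          sum_antidiagonal_assoc n fun i j m => ∑ u ∈ antidiagonal m,
            ∑ v ∈ antidiagonal u.2, μ i (a u.1) (μ j (b v.1) (c v.2))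
      _ = ∑ x ∈ antidiagonal n, ∑ y ∈ antidiagonal x.2, ∑ u ∈ antidiagonal y.1,
          ∑ v ∈ antidiagonal y.2, μ x.1 (a u.2) (μ u.1 (b v.1) (c v.2)) :=
          Finset.sum_congr rfl fun x _ => (sum_antidiagonal_assoc x.2
            fun j s q => ∑ v ∈ antidiagonal q, μ x.1 (a s) (μ j (b v.1) (c v.2))).symm
      _ = ∑ x ∈ antidiagonal n, ∑ y ∈ antidiagonal x.2, ∑ u ∈ antidiagonal y.1,
          ∑ v ∈ antidiagonal y.2, μ x.1 (a u.1) (μ u.2 (b v.1) (c v.2)) :=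
          Finset.sum_congr rfl fun x _ => Finset.sum_congr rfl fun y _ =>
            Finset.Nat.sum_antidiagonal_swap (n := y.1) (f := fun u : ℕ × ℕ =>
              ∑ v ∈ antidiagonal y.2, μ x.1 (a u.1) (μ u.2 (b v.1) (c v.2)))
      _ = ∑ x ∈ antidiagonal n, ∑ y ∈ antidiagonal x.2, ∑ u ∈ antidiagonal y.2,
          ∑ v ∈ antidiagonal u.2, μ x.1 (a y.1) (μ u.1 (b v.1) (c v.2)) :=
          Finset.sum_congr rfl fun x _ => sum_antidiagonal_assoc x.2
            fun j s q => ∑ v ∈ antidiagonal q, μ x.1 (a j) (μ s (b v.1) (c v.2))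

/-- The weight `k + cm` of the forms of weight `k = 2κ` and index `m`. -/
def modifiedWeight (c : ℂ) : ℤ × ℕ →+ ℂ where
  toFun i := ((2 * i.1 : ℤ) : ℂ) + c * i.2
  map_zero' := by simp
  map_add' i j := by
    simp
    ring

theorem modifiedWeight_apply (c : ℂ) (i : ℤ × ℕ) :
    modifiedWeight c i = ((2 * i.1 : ℤ) : ℂ) + c * i.2 := rfl

theorem derivation_prod_pow {ι R : Type*} [CommRing R] [Algebra ℂ R] (E : Derivation ℂ R R)
    {x : ι → R} {e : ι → ℂ} (hx : ∀ i, E (x i) = e i • x i)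
    (s : Finset ι) (d : ι → ℕ) :
    E (∏ j ∈ s, x j ^ d j) = (∑ j ∈ s, d j * e j) • ∏ j ∈ s, x j ^ d j := by
  classical
  induction s using Finset.induction_on with
  | empty => simp
  | insert j s hj ih =>
    have h1 : E (x j ^ d j) = (d j * e j) • x j ^ d j := by
      rw [Derivation.leibniz_pow, hx]
      rcases d j with _ | n
      · simp
      · rw [Nat.add_sub_cancel, pow_succ, smul_eq_mul, mul_smul_comm, mul_smul,
          ← Nat.cast_smul_eq_nsmul ℂ]
    rw [Finset.prod_insert hj, Finset.sum_insert hj, Derivation.leibniz, h1, ih, smul_eq_mul,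
      smul_eq_mul, mul_smul_comm, mul_smul_comm, add_smul, mul_comm (∏ j ∈ s, x j ^ d j), add_comm]

/-- The modified weight is additive in the bidegree, so a homogeneous polynomial is an eigenvector
for every value of `c`. -/
theorem liftE_lift_of_isWeightedHomogeneous (c : ℂ) {p : MvPolynomial (Fin 4) ℂ} {i : ℤ × ℕ}
    (hp : IsWeightedHomogeneous bidegree p i) :
    liftE (fun j => modifiedWeight c (bidegree j)) (lift p) = -modifiedWeight c i • lift p := by
  refine IsWeightedHomogeneous.induction_on (motive := fun p _ =>
    liftE (fun j => modifiedWeight c (bidegree j)) (lift p) = -modifiedWeight c i • lift p)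
    ?_ (fun p q _ _ hp hq => ?_) (fun d r hr => ?_) hp
  · rw [map_zero, map_zero, smul_zero]
  · rw [map_add, map_add, hp, hq, smul_add]
  · have h1 : lift (MvPolynomial.monomial d r) =
        r • ∏ j ∈ d.support, lift (MvPolynomial.X (R := ℂ) j) ^ d j := by
      rw [MvPolynomial.monomial_eq, Finsupp.prod, ← MvPolynomial.smul_eq_C_mul, map_smul, map_prod]
      simp only [map_pow]
    rw [h1, Derivation.map_smul, derivation_prod_pow _ liftE_lift_X, smul_comm, ← hr,
      Finsupp.weight_apply, Finsupp.sum, map_sum]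
    simp only [map_nsmul]
    simp only [nsmul_eq_mul, mul_neg, Finset.sum_neg_distrib]

theorem mkDerivation_polyDerivation (a b : ℂ) :
    MvPolynomial.mkDerivation ℂ (fun j => polyDerivation a b (MvPolynomial.X j)) =
      polyDerivation a b :=
  MvPolynomial.derivation_ext fun _ => MvPolynomial.mkDerivation_X _ _ _

theorem bracket_of_mem (V : Module.End ℂ JacobiAlgebra) (c : ℂ) (n : ℕ) {i j : ℤ × ℕ}
    {f g : JacobiAlgebra} (hf : f ∈ homogeneous i) (hg : g ∈ homogeneous j) :
    bracket V c n f g = rankinCohen V (modifiedWeight c i) (modifiedWeight c j) n f g := by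
  obtain ⟨x, rfl⟩ := hf
  obtain ⟨y, rfl⟩ := hg
  rw [bracket_incl, rankinCohen]
  simp only [Module.End.pow_apply, modifiedWeight_apply]

theorem map_rankinCohen {R R' : Type*} [CommRing R] [Algebra ℂ R] [CommRing R'] [Algebra ℂ R']
    (φ : R →ₐ[ℂ] R') {D : R → R} {D' : R' → R'} (h : ∀ x, φ (D x) = D' (φ x)) (c c' : ℂ) (n : ℕ)
    (f g : R) : φ (rankinCohen D c c' n f g) = rankinCohen D' c c' n (φ f) (φ g) := by
  have h1 : ∀ r x, φ (D^[r] x) = D'^[r] (φ x) := fun r => Function.Semiconj.iterate_right h r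
  simp only [rankinCohen, map_sum, map_smul, map_mul, h1]

/-- The brackets, on polynomials in the generators. -/
def polyBracket (a b c : ℂ) (n : ℕ) :
    MvPolynomial (Fin 4) ℂ →ₗ[ℂ] MvPolynomial (Fin 4) ℂ →ₗ[ℂ] MvPolynomial (Fin 4) ℂ :=
  ((bracket (jacobiDerivation a b) c n).compl₁₂ polyEquiv.toLinearMap polyEquiv.toLinearMap).compr₂
    polyEquiv.symm.toLinearMap

theorem polyEquiv_polyBracket (a b c : ℂ) (n : ℕ) (p q : MvPolynomial (Fin 4) ℂ) :
    polyEquiv (polyBracket a b c n p q) =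
      bracket (jacobiDerivation a b) c n (polyEquiv p) (polyEquiv q) :=
  polyEquiv.apply_symm_apply _

theorem polyBracket_eq (a b c : ℂ) (n : ℕ) {i j : ℤ × ℕ} {p q : MvPolynomial (Fin 4) ℂ}
    (hp : IsWeightedHomogeneous bidegree p i) (hq : IsWeightedHomogeneous bidegree q j) :
    polyBracket a b c n p q =
      rankinCohen (polyDerivation a b) (modifiedWeight c i) (modifiedWeight c j) n p q := by
  refine polyEquiv.injective ?_
  rw [polyEquiv_polyBracket, bracket_of_mem _ _ _ (polyEquiv_mem_iff.2 hp) (polyEquiv_mem_iff.2 hq)]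
  exact (map_rankinCohen polyEquiv.toAlgHom (fun p => (jacobiDerivation_polyEquiv a b p).symm)
    _ _ n p q).symm

/-- The derivation `y D + z ∂_t` that lifts the derivation `S_{a,b}`. -/
def jacobiX (a b : ℂ) := liftX fun j => polyDerivation a b (MvPolynomial.X j)

/-- The derivation `z E - t X` that lifts the derivation `S_{a,b}`. -/
def jacobiY (a b c : ℂ) :=
  liftY (fun j => polyDerivation a b (MvPolynomial.X j)) fun j => modifiedWeight c (bidegree j)

/-- `S_{a,b}` has bidegree `(1, 0)`, so it raises `k + cm` by 2 for every `c`: the hypothesis under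
which `X` and `Y` commute. -/
theorem liftE_lift_polyDerivation (a b c : ℂ) (j : Fin 4) :
    liftE (fun j => modifiedWeight c (bidegree j)) (lift (polyDerivation a b (MvPolynomial.X j))) =
      -(modifiedWeight c (bidegree j) + 2) • lift (polyDerivation a b (MvPolynomial.X j)) := by
  rw [liftE_lift_of_isWeightedHomogeneous c (isWeightedHomogeneous_polyDerivation a b
    (MvPolynomial.isWeightedHomogeneous_X ℂ bidegree j)), map_add]
  congr 3
  simp [modifiedWeight_apply]

theorem moyal_lift_eq (a b c : ℂ) (n : ℕ) (p q : MvPolynomial (Fin 4) ℂ) :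
    moyal (jacobiX a b) (jacobiY a b c) n (lift p) (lift q) =
      (n.factorial : ℂ) • ((newVar 1 * newVar 2) ^ n * lift (polyBracket a b c n p q)) := by
  induction p using MvPolynomial.induction_on' with
  | add p p' hp hp' =>
    simp only [map_add, LinearMap.add_apply, hp, hp', mul_add, smul_add]
  | monomial d r =>
    induction q using MvPolynomial.induction_on' with
    | add q q' hq hq' => simp only [map_add, hq, hq', mul_add, smul_add]
    | monomial d' r' =>
      have h1 := MvPolynomial.isWeightedHomogeneous_monomial bidegree d r rfl
      have h2 := MvPolynomial.isWeightedHomogeneous_monomial bidegree d' r' rfl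
      have := moyal_lift (liftE_lift_polyDerivation a b c)
        (liftE_lift_of_isWeightedHomogeneous c h1) (liftE_lift_of_isWeightedHomogeneous c h2) n
      rw [mkDerivation_polyDerivation, ← polyBracket_eq a b c n h1 h2] at this
      exact this

theorem jacobiX_newVar_mul (a b : ℂ) (n : ℕ) : jacobiX a b ((newVar 1 * newVar 2) ^ n) = 0 := by
  rw [Derivation.leibniz_pow, Derivation.leibniz, jacobiX, liftX_newVar, liftX_newVar]
  simp

theorem jacobiY_newVar_mul (a b c : ℂ) (n : ℕ) :
    jacobiY a b c ((newVar 1 * newVar 2) ^ n) = 0 := by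
  have h := jacobiX_newVar_mul a b n
  rw [jacobiX] at h
  rw [jacobiY, liftY_apply, h, Derivation.leibniz_pow, Derivation.leibniz, liftE_newVar, liftE_newVar]
  simp [mul_comm (newVar 2)]

/-- Since `X` and `Y` kill `yz`, its powers pass through the outer Moyal bracket. Each summand of
the Moyal identity becomes `n! (yz)^n` times a lifted double bracket, and these common factors
cancel. -/
theorem polyBracket_assoc (a b c : ℂ) (n : ℕ) (f g h : MvPolynomial (Fin 4) ℂ) :
    ∑ x ∈ Finset.HasAntidiagonal.antidiagonal n,
        polyBracket a b c x.1 (polyBracket a b c x.2 f g) h =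
      ∑ x ∈ Finset.HasAntidiagonal.antidiagonal n,
        polyBracket a b c x.1 f (polyBracket a b c x.2 g h) := by
  have key := moyal_assoc (X := jacobiX a b) (Y := jacobiY a b c)
    (liftX_liftY (liftE_lift_polyDerivation a b c)) n (lift f) (lift g) (lift h)
  have hfac : ∀ x ∈ Finset.HasAntidiagonal.antidiagonal n,
      (n.choose x.1 : ℂ) * ((x.2.factorial : ℂ) * x.1.factorial) = n.factorial := fun x hx => by
    rw [Finset.HasAntidiagonal.mem_antidiagonal] at hx
    have := Nat.choose_mul_factorial_mul_factorial (n := n) (k := x.1) (by omega)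
    rw [show n - x.1 = x.2 by omega] at this
    rw [← this]
    push_cast
    ring
  have hl : ∀ x ∈ Finset.HasAntidiagonal.antidiagonal n, (n.choose x.1 : ℂ) •
      moyal (jacobiX a b) (jacobiY a b c) x.1
        (moyal (jacobiX a b) (jacobiY a b c) x.2 (lift f) (lift g)) (lift h) =
      (n.factorial : ℂ) • ((newVar 1 * newVar 2) ^ n *
        lift (polyBracket a b c x.1 (polyBracket a b c x.2 f g) h)) := fun x hx => by
    rw [moyal_lift_eq, map_smul, LinearMap.smul_apply,
      moyal_mul_left (jacobiX_newVar_mul a b _) (jacobiY_newVar_mul a b c _), moyal_lift_eq,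
      mul_smul_comm, smul_smul, smul_smul, mul_assoc (n.choose x.1 : ℂ), hfac x hx, ← mul_assoc, ← pow_add,
      ← Finset.HasAntidiagonal.mem_antidiagonal.1 hx, add_comm x.2]
  have hr : ∀ x ∈ Finset.HasAntidiagonal.antidiagonal n, (n.choose x.1 : ℂ) •
      moyal (jacobiX a b) (jacobiY a b c) x.1 (lift f)
        (moyal (jacobiX a b) (jacobiY a b c) x.2 (lift g) (lift h)) =
      (n.factorial : ℂ) • ((newVar 1 * newVar 2) ^ n *
        lift (polyBracket a b c x.1 f (polyBracket a b c x.2 g h))) := fun x hx => by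
    rw [moyal_lift_eq, map_smul,
      moyal_mul_right (jacobiX_newVar_mul a b _) (jacobiY_newVar_mul a b c _), moyal_lift_eq,
      mul_smul_comm, smul_smul, smul_smul, mul_assoc (n.choose x.1 : ℂ), hfac x hx, ← mul_assoc, ← pow_add,
      ← Finset.HasAntidiagonal.mem_antidiagonal.1 hx, add_comm x.2]
  rw [Finset.sum_congr rfl hl, Finset.sum_congr rfl hr, ← Finset.smul_sum, ← Finset.smul_sum,
    ← Finset.mul_sum, ← Finset.mul_sum, ← map_sum, ← map_sum] at key
  have h1 := smul_right_injective _ (Nat.cast_ne_zero.2 n.factorial_ne_zero : (n.factorial : ℂ) ≠ 0) key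
  have h2 : (newVar 1 * newVar 2 : MvPolynomial (Fin 4 ⊕ Fin 3) ℂ) ^ n ≠ 0 :=
    pow_ne_zero _ (mul_ne_zero (MvPolynomial.X_ne_zero _) (MvPolynomial.X_ne_zero _))
  exact MvPolynomial.rename_injective _ Sum.inl_injective (mul_left_cancel₀ h2 h1)

theorem isFormalDeformation_bracket (a b c : ℂ) :
    IsFormalDeformation (bracket (jacobiDerivation a b) c) := by
  refine isFormalDeformation_of_assoc (fun f g => ?_) fun n f g h => ?_
  · induction f using jacobiAlgebra_induction with
    | add f f' hf hf' => rw [map_add, LinearMap.add_apply, hf, hf', add_mul]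
    | incl i x =>
      induction g using jacobiAlgebra_induction with
      | add g g' hg hg' => rw [map_add, hg, hg', mul_add]
      | incl j y => rw [bracket_incl]; simp
  · obtain ⟨f, rfl⟩ := polyEquiv.surjective f
    obtain ⟨g, rfl⟩ := polyEquiv.surjective g
    obtain ⟨h, rfl⟩ := polyEquiv.surjective h
    simp only [← polyEquiv_polyBracket, ← map_sum, polyBracket_assoc]

/-! ### Degrees, and the brackets of modular forms -/

theorem iterate_jacobiDerivation_mem (a b : ℂ) {i : ℤ × ℕ} {f : JacobiAlgebra}
    (hf : f ∈ homogeneous i) (r : ℕ) : (jacobiDerivation a b)^[r] f ∈ homogeneous (i + ((r : ℤ), 0)) := by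
  induction r with
  | zero => rwa [Nat.cast_zero, Prod.mk_zero_zero, add_zero]
  | succ r ih =>
    rw [Function.iterate_succ_apply']
    have e : (((r + 1 : ℕ) : ℤ), (0 : ℕ)) = ((r : ℤ), 0) + (1, 0) := by ext <;> simp
    rw [e, ← add_assoc]
    exact jacobiDerivation_mem a b ih

theorem bracket_mem (a b c : ℂ) (n : ℕ) {i j : ℤ × ℕ} {f g : JacobiAlgebra}
    (hf : f ∈ homogeneous i) (hg : g ∈ homogeneous j) :
    bracket (jacobiDerivation a b) c n f g ∈ homogeneous (i.1 + j.1 + n, i.2 + j.2) := by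
  rw [bracket_of_mem _ _ _ hf hg]
  refine Submodule.sum_mem _ fun r hr => Submodule.smul_mem _ _ ?_
  have hr := Nat.lt_succ_iff.1 (Finset.mem_range.1 hr)
  have hdeg : (i.1 + j.1 + (n : ℤ), i.2 + j.2) = i + ((r : ℤ), 0) + (j + (((n - r : ℕ) : ℤ), 0)) := by
    refine Prod.ext ?_ rfl
    change i.1 + j.1 + (n : ℤ) = i.1 + (r : ℤ) + (j.1 + ((n - r : ℕ) : ℤ))
    omega
  rw [hdeg]
  exact SetLike.mul_mem_graded (iterate_jacobiDerivation_mem a b hf r)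
    (iterate_jacobiDerivation_mem a b hg (n - r))

theorem exists_iterate_ofModular (a b : ℂ) {κ : ℤ} (f : ModularForm 𝒮ℒ (2 * κ)) (r : ℕ) (l : ℤ)
    (hl : l = κ + r) : ∃ h : ModularForm 𝒮ℒ (2 * l), ⇑h = serreIterate (2 * κ) f r ∧
      (jacobiDerivation a b)^[r] (ofModular κ f) = ofModular l h := by
  induction r generalizing l with
  | zero =>
    obtain rfl : l = κ := by simpa using hl
    exact ⟨f, rfl, rfl⟩
  | succ r ih =>
    obtain ⟨h, hh, hr⟩ := ih (κ + r) rfl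
    obtain ⟨h', hh', hr'⟩ := exists_serre_ofModular a b (κ + r) h
    obtain rfl : l = κ + r + 1 := by rw [hl, Nat.cast_succ, add_assoc]
    refine ⟨h', ?_, by rw [Function.iterate_succ_apply', hr, hr']⟩
    rw [hh', hh, serreIterate, mul_add]

theorem exists_ofModular_mul {κ l m : ℤ} (hm : m = κ + l) (f : ModularForm 𝒮ℒ (2 * κ))
    (g : ModularForm 𝒮ℒ (2 * l)) : ∃ h : ModularForm 𝒮ℒ (2 * m),
      ofModular κ f * ofModular l g = ofModular m h := by
  subst hm
  obtain ⟨h, hh⟩ : ∃ h : ModularForm 𝒮ℒ (2 * (κ + l)), ∀ τ, h τ = f τ * g τ :=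
    ⟨ModularForm.mcast (by ring) (f.mul g), fun τ => by simp⟩
  refine ⟨h, eq_of_toFun_eq (i := (κ + l, 0)) ?_ (ofModular_mem _ _) ?_⟩
  · have := SetLike.mul_mem_graded (ofModular_mem κ f) (ofModular_mem l g)
    rwa [Prod.mk_add_mk, add_zero] at this
  · rw [map_mul]
    simp only [toFun_ofModular, hh]
    rfl

theorem exists_bracket_ofModular (a b c : ℂ) (n : ℕ) (κ l : ℤ) (f : ModularForm 𝒮ℒ (2 * κ))
    (g : ModularForm 𝒮ℒ (2 * l)) : ∃ h : ModularForm 𝒮ℒ (2 * (κ + l + n)),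
      ⇑h = serreRankinCohen (2 * κ) (2 * l) n f g ∧
      bracket (jacobiDerivation a b) c n (ofModular κ f) (ofModular l g) =
        ofModular (κ + l + n) h := by
  have hb := bracket_of_mem (jacobiDerivation a b) c n (ofModular_mem κ f) (ofModular_mem l g)
  choose F hF hFS using fun r => exists_iterate_ofModular a b f r _ rfl
  choose G hG hGS using fun r => exists_iterate_ofModular a b g r _ rfl
  obtain ⟨h, hh⟩ : rankinCohen (jacobiDerivation a b) (modifiedWeight c (κ, 0))
      (modifiedWeight c (l, 0)) n (ofModular κ f) (ofModular l g) ∈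
        LinearMap.range (ofModular (κ + l + n)) := by
    refine Submodule.sum_mem _ fun r hr => Submodule.smul_mem _ _ ?_
    have hr := Nat.lt_succ_iff.1 (Finset.mem_range.1 hr)
    obtain ⟨h, hh⟩ := exists_ofModular_mul (m := κ + l + n) (by omega) (F r) (G (n - r))
    exact ⟨h, by rw [hFS, hGS, hh]⟩
  refine ⟨h, ?_, hb.trans hh.symm⟩
  ext τ
  -- Forms of index 0 coming from `M_*` do not depend on `z`, so evaluation at `z = 0` recovers
  -- them.
  have h1 := congrFun (congrArg toFun hh) (τ, 0)
  rw [toFun_ofModular] at h1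
  refine h1.trans ?_
  rw [rankinCohen, map_sum, Finset.sum_apply, serreRankinCohen]
  refine Finset.sum_congr rfl fun r _ => ?_
  rw [hFS, hGS, map_smul, map_mul, toFun_ofModular, toFun_ofModular, hF, hG]
  simp [modifiedWeight_apply]

theorem bracket_mem_modularPart (a b c : ℂ) (n : ℕ) {f g : JacobiAlgebra} (hf : f ∈ modularPart)
    (hg : g ∈ modularPart) : bracket (jacobiDerivation a b) c n f g ∈ modularPart := by
  refine Submodule.iSup_induction _ (motive := fun f =>
    bracket (jacobiDerivation a b) c n f g ∈ modularPart) hf ?_ ?_ fun f f' hf hf' => ?_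
  · rintro κ _ ⟨f, rfl⟩
    refine Submodule.iSup_induction _ (motive := fun g =>
      bracket (jacobiDerivation a b) c n (ofModular κ f) g ∈ modularPart) hg ?_ ?_
      fun g g' hg hg' => ?_
    · rintro l _ ⟨g, rfl⟩
      obtain ⟨h, -, hh⟩ := exists_bracket_ofModular a b c n κ l f g
      rw [hh]
      exact Submodule.mem_iSup_of_mem (κ + l + n) ⟨h, rfl⟩
    · rw [map_zero]
      exact Submodule.zero_mem _
    · rw [map_add]
      exact Submodule.add_mem _ hg hg'
  · rw [map_zero, LinearMap.zero_apply]
    exact Submodule.zero_mem _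
  · rw [map_add, LinearMap.add_apply]
    exact Submodule.add_mem _ hf hf'

/-! ### Normal forms -/

/-- The endomorphism of the polynomial algebra that multiplies the generator `A` by `s`. -/
def scaleHom (s : ℂ) : MvPolynomial (Fin 4) ℂ →ₐ[ℂ] MvPolynomial (Fin 4) ℂ :=
  MvPolynomial.aeval ![MvPolynomial.X 0, MvPolynomial.X 1, s • MvPolynomial.X 2, MvPolynomial.X 3]

theorem scaleHom_comp {s t : ℂ} (h : s * t = 1) : (scaleHom s).comp (scaleHom t) = AlgHom.id ℂ _ :=
  MvPolynomial.algHom_ext fun j => by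
    fin_cases j <;> simp [scaleHom, smul_smul, mul_comm t, h]

theorem isWeightedHomogeneous_scaleHom (s : ℂ) {p : MvPolynomial (Fin 4) ℂ} {i : ℤ × ℕ}
    (h : IsWeightedHomogeneous bidegree p i) : IsWeightedHomogeneous bidegree (scaleHom s p) i := by
  have hX := MvPolynomial.isWeightedHomogeneous_X ℂ bidegree
  have := MvPolynomial.WeightedHomogeneousSubmodule.gradedMonoid (R := ℂ) (w := bidegree)
  rw [← MvPolynomial.mem_weightedHomogeneousSubmodule, p.as_sum, map_sum]
  refine Submodule.sum_mem _ fun d hd => ?_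
  rw [← h (MvPolynomial.mem_support_iff.1 hd), scaleHom, MvPolynomial.aeval_monomial,
    ← Algebra.smul_def, Finsupp.weight_apply]
  refine Submodule.smul_mem _ _ (SetLike.prod_pow_mem_graded _ _ _ _ fun j _ => ?_)
  fin_cases j
  exacts [hX 0, hX 1, Submodule.smul_mem (MvPolynomial.weightedHomogeneousSubmodule ℂ _ _) s (hX 2),
    hX 3]

/-- The automorphism of the algebra that multiplies the generator `A` by `s`. -/
def scaleEquiv {s : ℂ} (hs : s ≠ 0) : JacobiAlgebra ≃ₐ[ℂ] JacobiAlgebra :=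
  (polyEquiv.symm.trans (AlgEquiv.ofAlgHom (scaleHom s) (scaleHom s⁻¹)
    (scaleHom_comp (mul_inv_cancel₀ hs)) (scaleHom_comp (inv_mul_cancel₀ hs)))).trans polyEquiv

theorem scaleEquiv_polyEquiv {s : ℂ} (hs : s ≠ 0) (p : MvPolynomial (Fin 4) ℂ) :
    scaleEquiv hs (polyEquiv p) = polyEquiv (scaleHom s p) :=
  congrArg (fun q => polyEquiv (scaleHom s q)) (polyEquiv.symm_apply_apply p)

theorem scaleEquiv_generator {s : ℂ} (hs : s ≠ 0) (j : Fin 4) : scaleEquiv hs (generator j) =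
    ![generator 0, generator 1, s • generator 2, generator 3] j := by
  rw [← polyEquiv_X, scaleEquiv_polyEquiv, scaleHom, MvPolynomial.aeval_X]
  fin_cases j <;> simp [polyEquiv_X]

theorem scaleEquiv_mem {s : ℂ} (hs : s ≠ 0) {i : ℤ × ℕ} {f : JacobiAlgebra}
    (hf : f ∈ homogeneous i) : scaleEquiv hs f ∈ homogeneous i := by
  obtain ⟨p, rfl⟩ := polyEquiv.surjective f
  rw [scaleEquiv_polyEquiv, polyEquiv_mem_iff]
  exact isWeightedHomogeneous_scaleHom s (polyEquiv_mem_iff.1 hf)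

/-- It suffices to compare the conjugated derivation on the generators, where the factor `s` moves
from `a` to `b`. -/
theorem scaleEquiv_jacobiDerivation {s : ℂ} (hs : s ≠ 0) (a b : ℂ) (f : JacobiAlgebra) :
    scaleEquiv hs (jacobiDerivation (s * a) b f) =
      jacobiDerivation a (s * b) (scaleEquiv hs f) := by
  let E : Derivation ℂ JacobiAlgebra JacobiAlgebra := Derivation.mk'
    ((scaleEquiv hs).symm.toLinearMap ∘ₗ (jacobiDerivation a (s * b)).toLinearMap ∘ₗ
      (scaleEquiv hs).toLinearMap) fun f g => by simp [Derivation.leibniz]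
  have hE : ∀ f, scaleEquiv hs (E f) = jacobiDerivation a (s * b) (scaleEquiv hs f) := fun f =>
    (scaleEquiv hs).apply_symm_apply _
  have : jacobiDerivation (s * a) b = E := derivation_ext_generator fun j =>
    (scaleEquiv hs).injective (by
      rw [hE, jacobiDerivation_generator, scaleEquiv_generator]
      fin_cases j <;> simp [jacobiDerivation_generator, scaleEquiv_generator, smul_smul, mul_comm b])
  rw [this, hE]

theorem modularIsomorphic_scale {s : ℂ} (hs : s ≠ 0) (a b c : ℂ) :
    ModularIsomorphic (bracket (jacobiDerivation (s * a) b) c)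
      (bracket (jacobiDerivation a (s * b)) c) := by
  refine ⟨(scaleEquiv hs).toLinearEquiv, fun i x hx => scaleEquiv_mem hs hx, fun n f g => ?_⟩
  change scaleEquiv hs _ = bracket _ c n (scaleEquiv hs f) (scaleEquiv hs g)
  induction f using jacobiAlgebra_induction with
  | add f f' hf hf' => simp only [map_add, LinearMap.add_apply, hf, hf']
  | incl i x =>
    induction g using jacobiAlgebra_induction with
    | add g g' hg hg' => simp only [map_add, hg, hg']
    | incl j y =>
      have hx := incl_mem i x
      have hy := incl_mem j y
      rw [bracket_of_mem _ _ _ hx hy,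
        bracket_of_mem _ _ _ (scaleEquiv_mem hs hx) (scaleEquiv_mem hs hy)]
      exact map_rankinCohen (scaleEquiv hs).toAlgHom (scaleEquiv_jacobiDerivation hs a b) _ _ n _ _

/-- For `a ≠ 0` the scaling `s = a` gives `[1, ab, c]`; for `a = 0` and `b ≠ 0` the scaling `s =
b⁻¹` gives `[0, 1, c]`. The parameter `c` is unchanged. -/
theorem exists_normal_form (a b c : ℂ) :
    (∃ b' c' : ℂ, ModularIsomorphic (bracket (jacobiDerivation a b) c)
        (bracket (jacobiDerivation 1 b') c')) ∨
      (∃ c' : ℂ, ModularIsomorphic (bracket (jacobiDerivation a b) c)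
        (bracket (jacobiDerivation 0 1) c')) ∨
      ∃ c' : ℂ, ModularIsomorphic (bracket (jacobiDerivation a b) c)
        (bracket (jacobiDerivation 0 0) c') := by
  rcases eq_or_ne a 0 with rfl | ha
  · refine Or.inr ?_
    rcases eq_or_ne b 0 with rfl | hb
    · exact Or.inr ⟨c, LinearEquiv.refl _ _, fun _ _ h => h, fun _ _ _ => rfl⟩
    · have := modularIsomorphic_scale (inv_ne_zero hb) 0 b c
      rw [mul_zero, inv_mul_cancel₀ hb] at this
      exact Or.inl ⟨c, this⟩
  · have := modularIsomorphic_scale ha 1 b c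
    rw [mul_one] at this
    exact Or.inl ⟨a * b, c, this⟩

/-! ### Uniqueness of the normal forms -/

/-- The character of the algebra with given values on the generators. -/
def evalPoint (v : Fin 4 → ℂ) : JacobiAlgebra →ₐ[ℂ] ℂ :=
  (MvPolynomial.aeval v).comp polyEquiv.symm.toAlgHom

theorem evalPoint_generator (v : Fin 4 → ℂ) (j : Fin 4) : evalPoint v (generator j) = v j := by
  rw [← polyEquiv_X]
  change MvPolynomial.aeval v (polyEquiv.symm (polyEquiv _)) = _
  rw [AlgEquiv.symm_apply_apply, MvPolynomial.aeval_X]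

theorem generator_ne_zero (j : Fin 4) : generator j ≠ 0 := fun h => by
  have := evalPoint_generator 1 j
  rw [h, map_zero] at this
  exact zero_ne_one this

/-- In the bidegree of a generator no other monomial occurs, so these components are lines preserved
by any modular isomorphism. -/
theorem exists_smul_generator {j : Fin 4} {f : JacobiAlgebra} (hf : f ∈ homogeneous (bidegree j)) :
    ∃ s : ℂ, f = s • generator j := by
  obtain ⟨p, rfl⟩ := polyEquiv.surjective f
  have hw : ∀ d : Fin 4 →₀ ℕ, Finsupp.weight bidegree d = bidegree j → d = Finsupp.single j 1 := by
    intro d hd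
    rw [weight_bidegree] at hd
    rcases Nat.eq_zero_or_pos (d 1) with h1 | h1 <;> ext i <;>
    fin_cases j <;> simp [bidegree] at hd <;> fin_cases i <;> simp <;> omega
  have := (polyEquiv_mem_iff.1 hf).eq_monomial_of_unique_weight hw
  refine ⟨p.coeff (Finsupp.single j 1), ?_⟩
  rw [← polyEquiv_X, ← map_smul, MvPolynomial.X, MvPolynomial.smul_monomial, smul_eq_mul, mul_one,
    ← this]

theorem bracket_one (V : Module.End ℂ JacobiAlgebra) (c : ℂ) {i j : ℤ × ℕ} {f g : JacobiAlgebra}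
    (hf : f ∈ homogeneous i) (hg : g ∈ homogeneous j) :
    bracket V c 1 f g = modifiedWeight c i • (f * V g) - modifiedWeight c j • (V f * g) := by
  rw [bracket_of_mem V c 1 hf hg, rankinCohen, Finset.sum_range_succ, Finset.sum_range_one]
  simp [sub_eq_add_neg]

/-- The isomorphism multiplies each generator by a nonzero scalar, and it is multiplicative by the
bracket of order 0. The first bracket of `E₄` and `E₆` forces their scalars to be 1; those of `E₄`
with `A` and `B` then relate the parameters. -/
theorem eq_of_modularIsomorphic {a b c a' b' c' : ℂ} (h : IsNormal a b) (h' : IsNormal a' b')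
    (hiso : ModularIsomorphic (bracket (jacobiDerivation a b) c)
      (bracket (jacobiDerivation a' b') c')) : a = a' ∧ b = b' ∧ c = c' := by
  obtain ⟨φ, hφ, hbr⟩ := hiso
  choose s hs using fun j => exists_smul_generator (hφ _ _ (generator_mem j))
  have hs0 : ∀ j, s j ≠ 0 := fun j h0 => generator_ne_zero j (φ.injective (by
    rw [hs, h0, zero_smul, map_zero]))
  have hmul : ∀ f g, φ (f * g) = φ f * φ g := fun f g => by
    have := hbr 0 f g
    rwa [(isFormalDeformation_bracket a b c).zero, (isFormalDeformation_bracket a' b' c').zero] at this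
  have key : ∀ (i j : Fin 4) (v : Fin 4 → ℂ),
      evalPoint v (φ (bracket (jacobiDerivation a b) c 1 (generator i) (generator j))) = s i * s j *
        evalPoint v (bracket (jacobiDerivation a' b') c' 1 (generator i) (generator j)) :=
    fun i j v => by
      rw [hbr, hs, hs]
      simp only [map_smul, LinearMap.smul_apply, smul_eq_mul]
      ring
  have h01 := key 0 1
  have h02 := key 0 2
  have h03 := key 0 3
  simp only [bracket_one _ _ (generator_mem _) (generator_mem _), Derivation.coeFn_coe,
    jacobiDerivation_generator, map_sub, map_smul, hmul, pow_two, Matrix.cons_val, hs, map_mul,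
    evalPoint_generator, modifiedWeight_apply, bidegree, smul_eq_mul] at h01 h02 h03
  -- These points isolate the coefficients of `E₄³`, `E₆²`, `E₄B`, `E₆A` and `E₄²A` in the
  -- respective brackets.
  have e1 := h01 ![1, 0, 0, 0]
  have e2 := h01 ![0, 1, 0, 0]
  have e3 := h02 ![1, 0, 0, 1]
  have e4 := h02 ![0, 1, 1, 0]
  have e5 := h03 ![1, 0, 1, 0]
  simp at e1 e2 e3 e4 e5
  have hs01 : s 0 = s 1 := mul_right_cancel₀ (hs0 1) (by linear_combination -e2 / 2)
  have hs1 : s 0 = 1 := by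
    refine mul_right_cancel₀ (mul_ne_zero (hs0 0) (hs0 0)) ?_
    rw [← hs01] at e1
    linear_combination e1 / 2
  rw [← hs01, hs1] at e4
  rw [hs1] at e3 e5
  have hc : c = c' := mul_right_cancel₀ (hs0 2) (by linear_combination 3 * e4)
  have ha : a * s 3 = s 2 * a' := by linear_combination e3 / 4
  have hb : b * s 2 = s 3 * b' := by linear_combination e5 / 4
  have hcases : ∀ {a b : ℂ}, IsNormal a b → a = 1 ∨ a = 0 ∧ (b = 1 ∨ b = 0) := fun h => by
    rcases h with h | ⟨h, h'⟩ | ⟨h, h'⟩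
    exacts [Or.inl h, Or.inr ⟨h, Or.inl h'⟩, Or.inr ⟨h, Or.inr h'⟩]
  rcases hcases h with rfl | ⟨rfl, hb1⟩ <;> rcases hcases h' with rfl | ⟨rfl, hb2⟩
  · rw [one_mul, mul_one] at ha
    rw [ha, mul_comm] at hb
    exact ⟨rfl, mul_left_cancel₀ (hs0 2) hb, hc⟩
  · exact absurd (by simpa using ha) (hs0 3)
  · exact absurd (by simpa using ha) (hs0 2).symm
  · refine ⟨rfl, ?_, hc⟩
    rcases hb1 with rfl | rfl <;> rcases hb2 with rfl | rfl
    · rfl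
    · exact absurd (by simpa using hb) (hs0 2)
    · exact absurd (by simpa using hb) (hs0 3).symm
    · rfl

end WeakJacobi

end

open WeakJacobi in
theorem theoremA :
    ∃ (A : component (-1, 1)) (B : component (0, 1)),
      (A : UpperHalfPlane × ℂ → ℂ) = formA ∧ (B : UpperHalfPlane × ℂ → ℂ) = formB ∧
      ∃ S : ℂ → ℂ → Derivation ℂ JacobiAlgebra JacobiAlgebra,
        (∀ (a b : ℂ) (D : Derivation ℂ JacobiAlgebra JacobiAlgebra),
          IsSerreExtension A B a b D ↔ D = S a b) ∧
        (∀ a b c : ℂ,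
          IsFormalDeformation (bracket (S a b) c) ∧
          (∀ (i j : ℤ × ℕ) (n : ℕ), ∀ f ∈ homogeneous i, ∀ g ∈ homogeneous j,
            bracket (S a b) c n f g ∈ homogeneous (i.1 + j.1 + n, i.2 + j.2)) ∧
          (∀ n : ℕ, ∀ f ∈ modularPart, ∀ g ∈ modularPart, bracket (S a b) c n f g ∈ modularPart) ∧
          (∀ (n : ℕ) (κ l : ℤ) (f : ModularForm 𝒮ℒ (2 * κ)) (g : ModularForm 𝒮ℒ (2 * l)),
            ∃ h : ModularForm 𝒮ℒ (2 * (κ + l + n)),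
              ⇑h = serreRankinCohen (2 * κ) (2 * l) n f g ∧
              bracket (S a b) c n (ofModular κ f) (ofModular l g) = ofModular (κ + l + n) h) ∧
          ((∃ b' c' : ℂ, ModularIsomorphic (bracket (S a b) c) (bracket (S 1 b') c')) ∨
            (∃ c' : ℂ, ModularIsomorphic (bracket (S a b) c) (bracket (S 0 1) c')) ∨
            (∃ c' : ℂ, ModularIsomorphic (bracket (S a b) c) (bracket (S 0 0) c')))) ∧
        (∀ a b c a' b' c' : ℂ, IsNormal a b → IsNormal a' b' →
          ModularIsomorphic (bracket (S a b) c) (bracket (S a' b') c') →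
            a = a' ∧ b = b' ∧ c = c') := by
  refine ⟨elemA, elemB, rfl, rfl, jacobiDerivation, isSerreExtension_iff, fun a b c =>
    ⟨isFormalDeformation_bracket a b c, fun i j n f hf g hg => bracket_mem a b c n hf hg,
      fun n f hf g hg => bracket_mem_modularPart a b c n hf hg, exists_bracket_ofModular a b c,
      exists_normal_form a b c⟩, fun a b c a' b' c' h h' => eq_of_modularIsomorphic h h'⟩
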